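/- Let $V\subset\mathbb{R}^m$ and $W\subset\mathbb{R}^n$ be open sets, let $\phi:W\to\mathbb{R}^m$ be real-analytic, and put $Z(x,t)=x+i\phi(t)$ for $x\in\mathbb{R}^m$, $t\in W$ (a tube structure). For $z\in\mathbb{C}^m$ write $\langle z\rangle^2=z_1^2+\dots+z_m^2$, and for $\xi\in\mathbb{R}^m$ write $\xi\cdot z=\sum_k\xi_kz_k$. Let $0<\kappa\le 1$, and let $\Delta_\kappa(z,\xi)$ be the Jacobian determinant (with respect to $\xi\in\mathbb{R}^m\setminus\{0\}$) of the map $\xi\mapsto\xi+iz|\xi|^\kappa$. For $u\in C^1(W;\mathcal{E}'(V))$ the partial $\kappa$-F.B.I. transform of $u$ is $$\mathfrak{F}_\kappa[u](t;z,\xi)=\Big\langle u(y,t),\,e^{i\xi\cdot(z-Z(y,t))-|\xi|^\kappa\langle z-Z(y,t)\rangle^2}\,\Delta_\kappa(z-Z(y,t),\xi)\Big\rangle_{y},\qquad t\in W,\ z\in\mathbb{C}^m,\ \xi\in\mathbb{R}^m\setminus\{0\}.$$ **Proposition.** Let $u\in C^1(W;\mathcal{E}'(V))$ and $0<\kappa\le1$.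 For $\epsilon>0$, $t\in W$ and $x\in\mathbb{R}^m$ set $$u_\epsilon(x,t)=\frac{1}{(2\pi^3)^{m/2}}\iint_{\mathbb{R}^{2m}}e^{i\xi\cdot(Z(x,t)-Z(x',t))-|\xi|^\kappa\langle Z(x,t)-Z(x',t)\rangle^2-\epsilon|\xi|^2}\;\mathfrak{F}_\kappa[u](t;Z(x',t),\xi)\;|\xi|^{\kappa m/2}\,dx'\,d\xi .$$ Then the integral converges absolutely, the function $u_\epsilon(\cdot,t)$ is locally integrable on $V$ for every $t\in W$, $u_\epsilon$ and $u$ belong to $C^1(W;\mathcal{D}'(V))$, and $$u=\lim_{\epsilon\to0^+}u_\epsilon\qquad\text{in } C^1(W;\mathcal{D}'(V)),$$ that is, $u_\epsilon\to u$ in $\mathcal{D}'(V)$ uniformly for $t$ in compact subsets of $W$, together with the first derivatives in $t$. -/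

import Mathlib

open Set Filter Topology MeasureTheory TopologicalSpace
open scoped ContDiff Distributions CompactConvergenceCLM

noncomputable section

namespace KappaFBI

/-! ### The spaces `C^∞(V)`, `E'(V)`, `D'(V)` -/

/-- The complex vector space of complex-valued `C^∞` functions on the open set `V ⊆ ℝ^m`. An element
is represented by its extension by zero to all of `ℝ^m`, so that two elements are equal if and only
if they agree on `V`. -/
def smoothSubmodule {m : ℕ} (V : Opens (EuclideanSpace ℝ (Fin m))) :
    Submodule ℂ (EuclideanSpace ℝ (Fin m) → ℂ) where
  carrier := {f | ContDiffOn ℝ ∞ f V ∧ ∀ x ∉ V, f x = 0}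
  add_mem' := by
    rintro f g ⟨hf, hf0⟩ ⟨hg, hg0⟩
    exact ⟨hf.add hg, fun x hx => by simp [hf0 x hx, hg0 x hx]⟩
  zero_mem' := ⟨contDiffOn_const, fun _ _ => rfl⟩
  smul_mem' := by
    rintro c f ⟨hf, hf0⟩
    exact ⟨contDiffOn_const.smul hf, fun x hx => by simp [hf0 x hx]⟩

/-- The type `C^∞(V)`; it gets its Fréchet topology below. -/
def SmoothFun {m : ℕ} (V : Opens (EuclideanSpace ℝ (Fin m))) : Type :=
  smoothSubmodule V

namespace SmoothFun

variable {m : ℕ} {V : Opens (EuclideanSpace ℝ (Fin m))}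

instance : AddCommGroup (SmoothFun V) := inferInstanceAs (AddCommGroup (smoothSubmodule V))

instance : Module ℂ (SmoothFun V) := inferInstanceAs (Module ℂ (smoothSubmodule V))

instance : CoeFun (SmoothFun V) (fun _ => EuclideanSpace ℝ (Fin m) → ℂ) := ⟨fun f => f.1⟩

theorem contDiffOn (f : SmoothFun V) : ContDiffOn ℝ ∞ f V := f.2.1

/-- The `k`-th derivative of `f ∈ C^∞(V)`, as a continuous function on `V`. -/
def derivMap (k : ℕ) (f : SmoothFun V) :
    C(V, ContinuousMultilinearMap ℝ (fun _ : Fin k => EuclideanSpace ℝ (Fin m)) ℂ) where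
  toFun x := iteratedFDeriv ℝ k f x
  continuous_toFun := by
    have h : ContinuousOn (iteratedFDeriv ℝ k f) V := by
      have h1 := f.contDiffOn.continuousOn_iteratedFDerivWithin (m := k)
        (by exact_mod_cast le_top) V.isOpen.uniqueDiffOn
      exact h1.congr fun x hx => (iteratedFDerivWithin_of_isOpen k V.isOpen hx).symm
    exact continuousOn_iff_continuous_domRestrict.1 h

theorem contDiffAt (f : SmoothFun V) (k : ℕ) (x : V) : ContDiffAt ℝ k f (x : _) :=
  (f.contDiffOn.contDiffAt (V.isOpen.mem_nhds x.2)).of_le (by exact_mod_cast le_top)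

/-- `derivMap` is linear. -/
def derivLin (V : Opens (EuclideanSpace ℝ (Fin m))) (k : ℕ) : SmoothFun V →ₗ[ℂ]
    C(V, ContinuousMultilinearMap ℝ (fun _ : Fin k => EuclideanSpace ℝ (Fin m)) ℂ) where
  toFun := derivMap k
  map_add' f g := by
    ext1 x
    exact iteratedFDeriv_add_apply (f.contDiffAt k x) (g.contDiffAt k x)
  map_smul' c f := by
    ext1 x
    exact iteratedFDeriv_const_smul_apply (f.contDiffAt k x)

/-- The usual Fréchet topology of `C^∞(V)`: uniform convergence on the compact subsets of `V` of
the derivatives of every order. -/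
instance : TopologicalSpace (SmoothFun V) :=
  ⨅ k : ℕ, TopologicalSpace.induced (derivLin V k) inferInstance

instance : IsTopologicalAddGroup (SmoothFun V) :=
  topologicalAddGroup_iInf fun k => topologicalAddGroup_induced (derivLin V k)

instance : ContinuousSMul ℂ (SmoothFun V) :=
  continuousSMul_iInf fun k => continuousSMul_induced (derivLin V k)

theorem continuous_iff {Y : Type*} [TopologicalSpace Y] {g : Y → SmoothFun V} :
    Continuous g ↔ ∀ k, Continuous fun y => derivMap k (g y) := by
  simp only [continuous_iInf_rng, continuous_induced_rng]
  rfl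

open Classical in
/-- The element of `C^∞(V)` given by (the restriction to `V` of) a function which is smooth on
`V`. If `f` is not smooth on `V`, this is `0`. -/
def ofFun (V : Opens (EuclideanSpace ℝ (Fin m))) (f : EuclideanSpace ℝ (Fin m) → ℂ) :
    SmoothFun V :=
  if hf : ContDiffOn ℝ ∞ f V then
    ⟨(V : Set (EuclideanSpace ℝ (Fin m))).indicator f,
      hf.congr fun _ hx => indicator_of_mem hx f, fun _ hx => indicator_of_notMem hx f⟩
  else 0

theorem ofFun_apply {f : EuclideanSpace ℝ (Fin m) → ℂ} (hf : ContDiffOn ℝ ∞ f V)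
    {x : EuclideanSpace ℝ (Fin m)} (hx : x ∈ V) : ofFun V f x = f x := by
  have h : ofFun V f = ⟨(V : Set (EuclideanSpace ℝ (Fin m))).indicator f,
      hf.congr fun _ hx => indicator_of_mem hx f, fun _ hx => indicator_of_notMem hx f⟩ :=
    dif_pos hf
  rw [h]
  exact indicator_of_mem hx f

theorem ext_on {f g : SmoothFun V} (h : ∀ x ∈ V, f x = g x) : f = g := by
  refine Subtype.ext (funext fun x => ?_)
  by_cases hx : x ∈ V
  · exact h x hx
  · rw [f.2.2 x hx, g.2.2 x hx]

/-- A real test function on `V`, seen as an element of `C^∞(V)`. -/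
def ofTest (ψ : 𝓓(V, ℝ)) : SmoothFun V :=
  ofFun V fun x => (ψ x : ℂ)

theorem contDiff_ofReal_test (ψ : 𝓓(V, ℝ)) : ContDiff ℝ ∞ fun x => (ψ x : ℂ) :=
  Complex.ofRealCLM.contDiff.comp ψ.contDiff

theorem ofTest_apply (ψ : 𝓓(V, ℝ)) {x : EuclideanSpace ℝ (Fin m)} (hx : x ∈ V) :
    ofTest ψ x = (ψ x : ℂ) :=
  ofFun_apply (contDiff_ofReal_test ψ).contDiffOn hx

theorem ofTest_add (f g : 𝓓(V, ℝ)) : ofTest (f + g) = ofTest f + ofTest g := by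
  refine ext_on fun x hx => ?_
  rw [ofTest_apply _ hx]
  change _ = ofTest f x + ofTest g x
  rw [ofTest_apply _ hx, ofTest_apply _ hx]
  simp

theorem ofTest_smul (c : ℝ) (f : 𝓓(V, ℝ)) : ofTest (c • f) = (c : ℂ) • ofTest f := by
  refine ext_on fun x hx => ?_
  rw [ofTest_apply _ hx]
  change _ = (c : ℂ) * ofTest f x
  rw [ofTest_apply _ hx]
  simp

theorem continuous_ofTest_comp (K : Compacts (EuclideanSpace ℝ (Fin m)))
    (hK : (K : Set (EuclideanSpace ℝ (Fin m))) ⊆ V) :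
    Continuous fun ψ : ContDiffMapSupportedIn (EuclideanSpace ℝ (Fin m)) ℝ ⊤ K =>
      ofTest (TestFunction.ofSupportedIn hK ψ) := by
  refine continuous_iff.2 fun k => ?_
  let S := (ContDiffMapSupportedIn.structureMapCLM (E := EuclideanSpace ℝ (Fin m)) (F := ℂ)
    (K := K) ℝ ⊤ k) ∘L (ContDiffMapSupportedIn.postcompCLM Complex.ofRealCLM)
  have hS : Continuous fun ψ => ((S ψ).toContinuousMap).comp
      (⟨Subtype.val, continuous_subtype_val⟩ : C(V, EuclideanSpace ℝ (Fin m))) :=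
    (ContinuousMap.continuous_precomp _).comp
      (continuous_iff_continuousAt.2 fun ψ =>
        ContinuousMap.tendsto_iff_tendstoLocallyUniformly.2
          (BoundedContinuousFunction.tendsto_iff_tendstoUniformly.1
            S.continuous.continuousAt).tendstoLocallyUniformly)
  refine hS.congr fun ψ => ?_
  ext1 x
  have h1 : S ψ x = iteratedFDeriv ℝ k (fun y => (ψ y : ℂ)) x := by
    simp only [S, ContinuousLinearMap.comp_apply]
    rw [ContDiffMapSupportedIn.structureMapCLM_top_apply]
    rfl
  change S ψ x = iteratedFDeriv ℝ k (ofTest (TestFunction.ofSupportedIn hK ψ)) x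
  rw [h1]
  refine (Filter.EventuallyEq.iteratedFDeriv ℝ ?_ k).eq_of_nhds
  filter_upwards [V.isOpen.mem_nhds x.2] with y hy
  exact (ofTest_apply (TestFunction.ofSupportedIn hK ψ) hy).symm

end SmoothFun

/-- `E'(V)`: the space of compactly supported distributions on `V`, that is, the dual of `C^∞(V)`.
It carries the topology of uniform convergence on the compact subsets of `C^∞(V)`, which is the
strong dual topology because `C^∞(V)` is a Montel space (this is Mathlib's convention for `D'(V)`
as well). -/
abbrev CompactDistribution {m : ℕ} (V : Opens (EuclideanSpace ℝ (Fin m))) : Type :=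
  SmoothFun V →L_c[ℂ] ℂ

/-- The pairing `⟨u, f⟩` of `u ∈ E'(V)` with a function `f` which is smooth on `V`. -/
def CompactDistribution.pair {m : ℕ} {V : Opens (EuclideanSpace ℝ (Fin m))}
    (u : CompactDistribution V) (f : EuclideanSpace ℝ (Fin m) → ℂ) : ℂ :=
  u (SmoothFun.ofFun V f)

/-- The inclusion `E'(V) ⊆ D'(V)`: the functional `u` is restricted to test functions. -/
def CompactDistribution.toDistribution {m : ℕ} {V : Opens (EuclideanSpace ℝ (Fin m))}
    (u : CompactDistribution V) : 𝓓'(V, ℂ) :=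
  ContinuousLinearMap.toUniformConvergenceCLM _ _ _ <|
    TestFunction.mkCLM ℝ (fun ψ => u (SmoothFun.ofTest ψ))
      (fun f g => by rw [SmoothFun.ofTest_add, map_add])
      (fun c f => by rw [SmoothFun.ofTest_smul, map_smul]; simp)
      (fun K hK => (show Continuous u from map_continuous u).comp
        (SmoothFun.continuous_ofTest_comp K hK))

theorem CompactDistribution.toDistribution_apply {m : ℕ} {V : Opens (EuclideanSpace ℝ (Fin m))}
    (u : CompactDistribution V) (ψ : 𝓓(V, ℝ)) :
    u.toDistribution ψ = u (SmoothFun.ofTest ψ) := rfl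

/-- The distribution `ψ ↦ ∫ ψ(x) f(x) dx` on `V` given by a locally integrable function `f` on `V`
(it is `0` if `f` is not locally integrable on `V`). -/
def functionDistribution {m : ℕ} (V : Opens (EuclideanSpace ℝ (Fin m)))
    (f : EuclideanSpace ℝ (Fin m) → ℂ) : 𝓓'(V, ℂ) :=
  ContinuousLinearMap.toUniformConvergenceCLM _ _ _ <|
    TestFunction.integralAgainstBilinCLM (ContinuousLinearMap.lsmul ℝ ℝ) volume f

theorem functionDistribution_apply {m : ℕ} {V : Opens (EuclideanSpace ℝ (Fin m))}
    {f : EuclideanSpace ℝ (Fin m) → ℂ} (hf : LocallyIntegrableOn f V volume) (ψ : 𝓓(V, ℝ)) :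
    functionDistribution V f ψ = ∫ x, (ψ x : ℂ) * f x := by
  change TestFunction.integralAgainstBilinCLM (ContinuousLinearMap.lsmul ℝ ℝ) volume f ψ = _
  rw [TestFunction.integralAgainstBilinCLM_eq_integral hf]
  simp

/-! ### The spaces `C¹(W; F)` -/

section C1

variable {n : ℕ} {F : Type*} [AddCommGroup F] [Module ℝ F] [UniformSpace F] [IsUniformAddGroup F]
  [ContinuousConstSMul ℝ F]

/-- `v ∈ C¹(W; F)` for an open set `W ⊆ ℝ^n` and a topological vector space `F`. Only the values of
`v` on `W` matter. -/
def IsC1On (W : Opens (EuclideanSpace ℝ (Fin n))) (v : EuclideanSpace ℝ (Fin n) → F) : Prop :=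
  (∀ t ∈ W, DifferentiableAt ℝ v t) ∧ ContinuousOn (fderiv ℝ v) W

/-- Convergence in `C¹(W; F)`: uniform convergence, on every compact subset of `W`, of the functions
and of their first derivatives. -/
def TendstoC1On {ι : Type*} (l : Filter ι) (W : Opens (EuclideanSpace ℝ (Fin n)))
    (v : ι → EuclideanSpace ℝ (Fin n) → F) (v₀ : EuclideanSpace ℝ (Fin n) → F) : Prop :=
  ∀ K : Set (EuclideanSpace ℝ (Fin n)), IsCompact K → K ⊆ W →
    TendstoUniformlyOn v v₀ l K ∧
    TendstoUniformlyOn (fun i => fderiv ℝ (v i)) (fderiv ℝ v₀) l K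

end C1

/-! ### The partial `κ`-FBI transform for a tube structure -/

/-- `Z(x,t) = x + i φ(t)`, the first integrals of a tube structure. -/
def tubeZ {m n : ℕ} (φ : EuclideanSpace ℝ (Fin n) → EuclideanSpace ℝ (Fin m))
    (x : EuclideanSpace ℝ (Fin m)) (t : EuclideanSpace ℝ (Fin n)) : Fin m → ℂ :=
  fun k => (x k : ℂ) + Complex.I * (φ t k : ℂ)

/-- `ξ · z = ∑ ξ_k z_k` for `ξ ∈ ℝ^m` and `z ∈ ℂ^m`. -/
def realDot {m : ℕ} (ξ : EuclideanSpace ℝ (Fin m)) (z : Fin m → ℂ) : ℂ :=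
  ∑ k, (ξ k : ℂ) * z k

/-- `⟨z⟩² = z · z = ∑ z_k²` for `z ∈ ℂ^m`. -/
def sqBracket {m : ℕ} (z : Fin m → ℂ) : ℂ :=
  ∑ k, z k ^ 2

/-- `Δ_κ(z, ξ)`, the Jacobian determinant at `ξ` of the map `ℝ^m → ℂ^m`,
`η ↦ η + i z |η|^κ`. -/
def kappaJacobian {m : ℕ} (κ : ℝ) (z : Fin m → ℂ) (ξ : EuclideanSpace ℝ (Fin m)) : ℂ :=
  Matrix.det (Matrix.of fun i j : Fin m =>
    fderiv ℝ (fun η : EuclideanSpace ℝ (Fin m) =>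
      (η i : ℂ) + Complex.I * z i * ((‖η‖ ^ κ : ℝ) : ℂ)) ξ (EuclideanSpace.single j 1))

/-- The function `y ↦ e^{i ξ·(z - Z(y,t)) - |ξ|^κ ⟨z - Z(y,t)⟩²} Δ_κ(z - Z(y,t), ξ)`. -/
def kappaKernel {m n : ℕ} (κ : ℝ) (φ : EuclideanSpace ℝ (Fin n) → EuclideanSpace ℝ (Fin m))
    (t : EuclideanSpace ℝ (Fin n)) (z : Fin m → ℂ) (ξ y : EuclideanSpace ℝ (Fin m)) : ℂ :=
  Complex.exp (Complex.I * realDot ξ (z - tubeZ φ y t)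
      - ((‖ξ‖ ^ κ : ℝ) : ℂ) * sqBracket (z - tubeZ φ y t))
    * kappaJacobian κ (z - tubeZ φ y t) ξ

/-- The partial `κ`-FBI transform `𝔉_κ[u](t; z, ξ)`. The kernel is smooth in `y` for every
`ξ ≠ 0` (see `contDiff_kappaKernel`), so that the pairing is defined for every `ξ ≠ 0`. -/
def kappaFBI {m n : ℕ} {V : Opens (EuclideanSpace ℝ (Fin m))} (κ : ℝ)
    (φ : EuclideanSpace ℝ (Fin n) → EuclideanSpace ℝ (Fin m))
    (u : EuclideanSpace ℝ (Fin n) → CompactDistribution V)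
    (t : EuclideanSpace ℝ (Fin n)) (z : Fin m → ℂ) (ξ : EuclideanSpace ℝ (Fin m)) : ℂ :=
  (u t).pair (kappaKernel κ φ t z ξ)

/-- The integrand, as a function of `p = (x', ξ) ∈ ℝ^{2m}`, of the regularized inversion formula:
`e^{i ξ·(Z(x,t) - Z(x',t)) - |ξ|^κ ⟨Z(x,t) - Z(x',t)⟩² - ε|ξ|²} 𝔉_κ[u](t; Z(x',t), ξ) |ξ|^{κm/2}`. -/
def inversionIntegrand {m n : ℕ} {V : Opens (EuclideanSpace ℝ (Fin m))} (κ : ℝ)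
    (φ : EuclideanSpace ℝ (Fin n) → EuclideanSpace ℝ (Fin m))
    (u : EuclideanSpace ℝ (Fin n) → CompactDistribution V) (ε : ℝ)
    (t : EuclideanSpace ℝ (Fin n)) (x : EuclideanSpace ℝ (Fin m))
    (p : EuclideanSpace ℝ (Fin m) × EuclideanSpace ℝ (Fin m)) : ℂ :=
  Complex.exp (Complex.I * realDot p.2 (tubeZ φ x t - tubeZ φ p.1 t)
      - ((‖p.2‖ ^ κ : ℝ) : ℂ) * sqBracket (tubeZ φ x t - tubeZ φ p.1 t)
      - ((ε * ‖p.2‖ ^ 2 : ℝ) : ℂ))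
    * kappaFBI κ φ u t (tubeZ φ p.1 t) p.2
    * ((‖p.2‖ ^ (κ * m / 2) : ℝ) : ℂ)

/-- The regularized inversion integral, as a function of `x` and `t`:
`(2π³)^{-m/2} ∬_{ℝ^{2m}} (integrand) dx' dξ`. -/
def regularizedInversion {m n : ℕ} {V : Opens (EuclideanSpace ℝ (Fin m))} (κ : ℝ)
    (φ : EuclideanSpace ℝ (Fin n) → EuclideanSpace ℝ (Fin m))
    (u : EuclideanSpace ℝ (Fin n) → CompactDistribution V) (ε : ℝ)
    (t : EuclideanSpace ℝ (Fin n)) (x : EuclideanSpace ℝ (Fin m)) : ℂ :=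
  ((1 / (2 * Real.pi ^ 3) ^ ((m : ℝ) / 2) : ℝ) : ℂ) *
    ∫ p : EuclideanSpace ℝ (Fin m) × EuclideanSpace ℝ (Fin m),
      inversionIntegrand κ φ u ε t x p

/-! ### The kernel is smooth -/

theorem fderiv_kappaMap {m : ℕ} (κ : ℝ) {ξ : EuclideanSpace ℝ (Fin m)} (hξ : ξ ≠ 0) (c : ℂ)
    (i : Fin m) (v : EuclideanSpace ℝ (Fin m)) :
    fderiv ℝ (fun η : EuclideanSpace ℝ (Fin m) =>
      (η i : ℂ) + Complex.I * c * ((‖η‖ ^ κ : ℝ) : ℂ)) ξ v =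
    (v i : ℂ) + Complex.I * c *
      ((fderiv ℝ (fun η : EuclideanSpace ℝ (Fin m) => ‖η‖ ^ κ) ξ v : ℝ) : ℂ) := by
  have h1 : HasFDerivAt (fun η : EuclideanSpace ℝ (Fin m) => (η i : ℂ))
      (Complex.ofRealCLM ∘L (EuclideanSpace.proj i : EuclideanSpace ℝ (Fin m) →L[ℝ] ℝ)) ξ :=
    (Complex.ofRealCLM ∘L
      (EuclideanSpace.proj i : EuclideanSpace ℝ (Fin m) →L[ℝ] ℝ)).hasFDerivAt
  have h2 : DifferentiableAt ℝ (fun η : EuclideanSpace ℝ (Fin m) => ‖η‖ ^ κ) ξ :=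
    (differentiableAt_id.norm ℝ hξ).rpow_const (Or.inl (norm_ne_zero_iff.2 hξ))
  have h3 := (Complex.ofRealCLM.hasFDerivAt.comp ξ h2.hasFDerivAt).const_mul (Complex.I * c)
  have h4 := (h1.add h3).fderiv
  have h5 : (fun η : EuclideanSpace ℝ (Fin m) =>
      (η i : ℂ) + Complex.I * c * ((‖η‖ ^ κ : ℝ) : ℂ)) =
      (fun η : EuclideanSpace ℝ (Fin m) => (η i : ℂ)) + fun η => Complex.I * c *
        (Complex.ofRealCLM ∘ fun η : EuclideanSpace ℝ (Fin m) => ‖η‖ ^ κ) η := rfl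
  rw [h5, h4]
  simp

theorem contDiff_kappaKernel {m n : ℕ} (κ : ℝ)
    (φ : EuclideanSpace ℝ (Fin n) → EuclideanSpace ℝ (Fin m))
    (t : EuclideanSpace ℝ (Fin n)) (z : Fin m → ℂ) {ξ : EuclideanSpace ℝ (Fin m)} (hξ : ξ ≠ 0) :
    ContDiff ℝ ∞ (kappaKernel κ φ t z ξ) := by
  have hw : ∀ k : Fin m, ContDiff ℝ ∞ fun y : EuclideanSpace ℝ (Fin m) =>
      (z - tubeZ φ y t) k := by
    intro k
    have : ContDiff ℝ ∞ fun y : EuclideanSpace ℝ (Fin m) => (y k : ℂ) :=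
      (Complex.ofRealCLM ∘L
        (EuclideanSpace.proj k : EuclideanSpace ℝ (Fin m) →L[ℝ] ℝ)).contDiff
    exact contDiff_const.sub (this.add contDiff_const)
  have hJ : ContDiff ℝ ∞ fun y => kappaJacobian κ (z - tubeZ φ y t) ξ := by
    simp only [kappaJacobian, Matrix.det_apply, Matrix.of_apply, fderiv_kappaMap κ hξ]
    refine ContDiff.sum fun σ _ => ContDiff.const_smul _ (contDiff_prod fun i _ => ?_)
    exact contDiff_const.add ((contDiff_const.mul (hw _)).mul contDiff_const)
  unfold kappaKernel realDot sqBracket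
  refine ContDiff.mul (ContDiff.cexp (ContDiff.sub ?_ ?_)) hJ
  · exact contDiff_const.mul (ContDiff.sum fun k _ => contDiff_const.mul (hw k))
  · exact contDiff_const.mul (ContDiff.sum fun k _ => (hw k).pow 2)

end KappaFBI

end

/-!
For a tube structure `Z(x,t) - Z(y,t) = x - y` is real, so that neither `φ` nor `t` enters the
kernel of the double integral. After the (Gaussian) integration in `x'`, the regularized inversion
of `u` is `u_ε(x,t) = ⟨u(y,t), G_ε(x - y)⟩` with the kernel (`reproducingKernel`)
`G_ε(w) = (2π)^{-m} ∫ e^{i⟨ξ,w⟩ - |ξ|^κ |w|²/2 - ε|ξ|²} (1 + (iκ/2) ⟨w,ξ⟩ |ξ|^{κ-2}) dξ`,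
see `integral_inversionWeight_mul_planeKernel`. Since a compactly supported distribution is a
continuous functional of a jet in a Banach space (`CompactDistribution.exists_eq_comp_jet`), it
commutes with the integrals (`CompactDistribution.pair_integral`), and `u_ε(·,t)` is the transpose
of the operator `P_ε ψ(y) = ∫ G_ε(w) ψ(y + w) dw`, from `D(V)` to `C^∞(V)`, applied to `u(·,t)`
(`integral_mul_regularizedInversion`).

That `G_ε` is an approximate identity is a matter of the Jacobian factor: it makes
`i|w|² (e^{-|ξ|^κ |w|²/2} (1 + (iκ/2) ⟨w,ξ⟩ |ξ|^{κ-2}) - 1) e^{i⟨ξ,w⟩}` the derivative in `ξ`, in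
the direction `w`, of `e^{i⟨ξ,w⟩} (e^{-|ξ|^κ |w|²/2} - 1)`. An integration by parts
(`integral_gaussian_amplitude`) moves this derivative to `e^{-ε|ξ|²}`, whence `G_ε` is the heat
kernel plus `ε` times an oscillatory integral whose symbol is, up to powers of `|ξ|`, a bounded
function of `|ξ|^{κ/2} w` with bounded derivatives (`errorSymbol`). As `κ ≤ 1`, each
derivative of this symbol costs a factor `1 + |ξ|^{1/2}` only, while each integration by parts in
`w` gains `|ξ|^{-1}`. Thus `P_ε ψ - ψ = O(ε)` with all its derivatives
(`exists_norm_integral_reproducingKernel_sub_le`).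

The rate gives more than the pointwise convergence `P_ε ψ → ψ` in `C^∞(V)`: the transposes converge
in the space of operators from `E'(V)` to `D'(V)`, uniformly on bounded sets
(`tendsto_transposeCLM`). A convergent family of operators, applied to one fixed function in
`C¹(W; E'(V))`, converges in `C¹(W; D'(V))` (`tendstoC1On_of_tendsto`), which is the theorem. The
dimension `m = 0` is treated apart, because there `ξ = 0` is not a null set.
-/

noncomputable section

namespace KappaFBI

/-! ### Continuous real-linear maps between the function and distribution spaces -/

section Spaces

variable {m : ℕ} {V : Opens (EuclideanSpace ℝ (Fin m))}

instance : LocallyConvexSpace ℝ (SmoothFun V) := by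
  refine LocallyConvexSpace.iInf (𝕜 := ℝ) (E := SmoothFun V) fun k => ?_
  exact LocallyConvexSpace.induced ((SmoothFun.derivLin V k).restrictScalars ℝ)

instance : ContinuousSMul ℝ (SmoothFun V) where
  continuous_smul :=
    (continuous_smul (M := ℂ) (X := SmoothFun V)).comp
      (Complex.continuous_ofReal.prodMap continuous_id)

theorem CompactDistribution.real_smul_eq (c : ℝ) (v : CompactDistribution V) :
    c • v = (c : ℂ) • v :=
  DFunLike.ext _ _ fun f => by
    change c • (v f) = (c : ℂ) • v f
    simp

instance : ContinuousSMul ℝ (CompactDistribution V) where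
  continuous_smul := by
    refine ((continuous_smul (M := ℂ) (X := CompactDistribution V)).comp
      (Complex.continuous_ofReal.prodMap continuous_id)).congr fun p => ?_
    exact (CompactDistribution.real_smul_eq p.1 p.2).symm

/-- Bounds for the derivatives of each order that hold on all of `V` and tend to zero imply
convergence to zero in `C^∞(V)`. -/
theorem SmoothFun.tendsto_zero_of_derivMap {ι : Type*} {l : Filter ι} {f : ι → SmoothFun V}
    (h : ∀ k : ℕ, ∃ q : ι → ℝ, Tendsto q l (𝓝 0) ∧
      ∀ i, ∀ y ∈ V, ‖iteratedFDeriv ℝ k (f i) y‖ ≤ q i) :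
    Tendsto f l (𝓝 0) := by
  have h0 : 𝓝 (0 : SmoothFun V) = ⨅ k, comap (SmoothFun.derivLin V k) (𝓝 0) := by
    rw [nhds_iInf]
    simp only [nhds_induced, map_zero]
  rw [h0, tendsto_iInf]
  intro k
  rw [tendsto_comap_iff]
  obtain ⟨q, hq, hf⟩ := h k
  rw [ContinuousMap.tendsto_iff_forall_isCompact_tendstoUniformlyOn]
  intro K _
  rw [Metric.tendstoUniformlyOn_iff]
  intro ε hε
  filter_upwards [hq.eventually_lt_const hε] with i hi y _
  rw [ContinuousMap.zero_apply, dist_zero_left]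
  exact (hf i y y.2).trans_lt hi

/-- A linear map from `D(V)` to `C^∞(V)` is continuous if each derivative of the image is bounded
by a continuous gauge of the test function. -/
def smoothFunMkCLM (A : 𝓓(V, ℝ) →ₗ[ℝ] SmoothFun V)
    (h : ∀ k : ℕ, ∃ q : 𝓓(V, ℝ) → ℝ, Continuous q ∧ q 0 = 0 ∧
      ∀ ψ, ∀ y ∈ V, ‖iteratedFDeriv ℝ k (A ψ) y‖ ≤ q ψ) :
    𝓓(V, ℝ) →L[ℝ] SmoothFun V where
  toLinearMap := A
  cont := by
    refine continuous_of_continuousAt_zero A ?_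
    rw [ContinuousAt, map_zero]
    refine SmoothFun.tendsto_zero_of_derivMap fun k => ?_
    obtain ⟨q, hq, hq0, hb⟩ := h k
    exact ⟨q, hq0 ▸ hq.tendsto 0, hb⟩

/-- The restriction map `D(V) → C^∞(V)`. -/
def ofTestCLM (V : Opens (EuclideanSpace ℝ (Fin m))) : 𝓓(V, ℝ) →L[ℝ] SmoothFun V :=
  TestFunction.mkCLM ℝ SmoothFun.ofTest SmoothFun.ofTest_add
    (fun c f => SmoothFun.ofTest_smul c f) SmoothFun.continuous_ofTest_comp

theorem integrable_iteratedFDeriv_test (ψ : 𝓓(V, ℝ)) (k : ℕ) :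
    Integrable (iteratedFDeriv ℝ k ψ) :=
  (ψ.contDiff.continuous_iteratedFDeriv (by exact_mod_cast le_top)).integrable_of_hasCompactSupport
    (ψ.hasCompactSupport.iteratedFDeriv k)

/-- The `k`-th derivative of a test function, as an element of `L¹`. -/
def iteratedFDerivL1 (V : Opens (EuclideanSpace ℝ (Fin m))) (k : ℕ) : 𝓓(V, ℝ) →L[ℝ]
    Lp (ContinuousMultilinearMap ℝ (fun _ : Fin k => EuclideanSpace ℝ (Fin m)) ℝ) 1
      (volume : Measure (EuclideanSpace ℝ (Fin m))) :=
  have hi : ∀ ψ : 𝓓(V, ℝ), Integrable (iteratedFDeriv ℝ k ψ) := fun ψ =>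
    integrable_iteratedFDeriv_test ψ k
  have hadd : ∀ f g : 𝓓(V, ℝ), (hi (f + g)).toL1 = (hi f).toL1 + (hi g).toL1 := fun f g => by
    rw [← Integrable.toL1_add]
    congr 1
    exact iteratedFDeriv_add (f.contDiff.of_le (by exact_mod_cast le_top))
      (g.contDiff.of_le (by exact_mod_cast le_top))
  have hsmul : ∀ (c : ℝ) (f : 𝓓(V, ℝ)), (hi (c • f)).toL1 = c • (hi f).toL1 := fun c f => by
    rw [← Integrable.toL1_smul]
    congr 1
    funext x
    exact iteratedFDeriv_const_smul_apply (f.contDiff.of_le (by exact_mod_cast le_top)).contDiffAt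
  TestFunction.mkCLM ℝ (fun ψ => (hi ψ).toL1) hadd hsmul fun K hK =>
    (ContDiffMapSupportedIn.mkCLMtoNormedSpace (𝕜 := ℝ)
      (fun ψ => (hi (TestFunction.ofSupportedIn hK ψ)).toL1)
      (fun f g => hadd (TestFunction.ofSupportedIn hK f) (TestFunction.ofSupportedIn hK g))
      (fun c f => hsmul c (TestFunction.ofSupportedIn hK f))
      ⟨{k}, volume.real (K : Set (EuclideanSpace ℝ (Fin m))), measureReal_nonneg, fun ψ => by
        rw [L1.norm_of_fun_eq_integral_norm, Finset.sup_singleton, mul_comm]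
        have h0 : ∀ x ∉ (K : Set (EuclideanSpace ℝ (Fin m))),
            ‖iteratedFDeriv ℝ k (TestFunction.ofSupportedIn hK ψ) x‖ = 0 := fun x hx => by
          rw [norm_eq_zero]
          exact ψ.iteratedFDeriv_zero_on_compl hx
        rw [← setIntegral_eq_integral_of_forall_compl_eq_zero h0]
        refine (Real.le_norm_self _).trans (norm_setIntegral_le_of_norm_le_const
          K.isCompact.measure_lt_top fun x _ => ?_)
        rw [norm_norm]
        exact ContDiffMapSupportedIn.norm_iteratedFDeriv_apply_le_seminorm_top ℝ⟩).continuous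

/-- The `L¹` norm of the `k`-th derivative is a continuous gauge on `D(V)`. -/
theorem continuous_integral_norm_iteratedFDeriv (k : ℕ) :
    Continuous fun ψ : 𝓓(V, ℝ) => ∫ x, ‖iteratedFDeriv ℝ k (fun x => (ψ x : ℂ)) x‖ := by
  refine (iteratedFDerivL1 V k).continuous.norm.congr fun ψ => ?_
  refine (L1.norm_of_fun_eq_integral_norm (integrable_iteratedFDeriv_test ψ k)).trans ?_
  refine integral_congr_ae (.of_forall fun x => ?_)
  exact (Complex.ofRealLI.norm_iteratedFDeriv_comp_left
    (ψ.contDiff.of_le (by exact_mod_cast le_top)).contDiffAt le_rfl).symm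

/-- The transpose `E'(V) → D'(V)` of a continuous linear map `D(V) → C^∞(V)`. -/
def transposeCLM (P : 𝓓(V, ℝ) →L[ℝ] SmoothFun V) : CompactDistribution V →L[ℝ] 𝓓'(V, ℂ) where
  toFun v := ContinuousLinearMap.toUniformConvergenceCLM _ _ _ <|
    (ContinuousLinearMap.restrictScalars ℝ (show SmoothFun V →L[ℂ] ℂ from v)).comp P
  map_add' _ _ := rfl
  map_smul' _ _ := rfl
  cont := by
    refine continuous_of_continuousAt_zero
      (AddMonoidHom.mk' (fun v : CompactDistribution V =>
        (ContinuousLinearMap.toUniformConvergenceCLM (RingHom.id ℝ) ℂ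
          {S : Set 𝓓(V, ℝ) | IsCompact S}
        ((ContinuousLinearMap.restrictScalars ℝ (show SmoothFun V →L[ℂ] ℂ from v)).comp P)
          : 𝓓'(V, ℂ)))
        (fun _ _ => rfl)) ?_
    rw [ContinuousAt, map_zero]
    refine ((CompactConvergenceCLM.hasBasis_nhds_zero (σ := RingHom.id ℂ)
      (E := SmoothFun V) (F := ℂ)).tendsto_iff
      (CompactConvergenceCLM.hasBasis_nhds_zero (σ := RingHom.id ℝ)
      (E := 𝓓(V, ℝ)) (F := ℂ))).2 ?_
    rintro ⟨B, U⟩ ⟨hB, hU⟩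
    exact ⟨⟨P '' B, U⟩, ⟨hB.image P.continuous, hU⟩, fun v hv ψ hψ => hv _ ⟨ψ, hψ, rfl⟩⟩

theorem transposeCLM_apply (P : 𝓓(V, ℝ) →L[ℝ] SmoothFun V) (v : CompactDistribution V)
    (ψ : 𝓓(V, ℝ)) : transposeCLM P v ψ = v (P ψ) := rfl

/-- If `P ε - P₀` is `O(ε)`, derivative by derivative, then the transposes converge uniformly on
bounded subsets of `E'(V)`. The functions `(P ε - P₀) ψ / √ε`, for `ψ` in a compact set and `ε` in a
null sequence, form a relatively compact set, on which a bounded set of functionals is bounded. -/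
theorem tendsto_transposeCLM {P : ℝ → 𝓓(V, ℝ) →L[ℝ] SmoothFun V} {P₀ : 𝓓(V, ℝ) →L[ℝ] SmoothFun V}
    (h : ∀ k : ℕ, ∃ q : 𝓓(V, ℝ) → ℝ, Continuous q ∧
      ∀ ε : ℝ, 0 < ε → ∀ ψ, ∀ y ∈ V,
        ‖iteratedFDeriv ℝ k (P ε ψ - P₀ ψ : SmoothFun V) y‖ ≤ ε * q ψ) :
    Tendsto (fun ε => transposeCLM (P ε)) (𝓝[>] (0 : ℝ)) (𝓝 (transposeCLM P₀)) := by
  refine tendsto_of_seq_tendsto fun e he => ?_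
  have hmem : ∀ᶠ i in atTop, 0 < e i := (tendsto_nhdsWithin_iff.1 he).2
  have he0 : Tendsto e atTop (𝓝 0) := (tendsto_nhdsWithin_iff.1 he).1
  obtain ⟨N, hN⟩ := eventually_atTop.1 hmem
  have hs : Tendsto (fun i => √(e i)) atTop (𝓝 0) := by
    simpa [Function.comp_def] using (Real.continuous_sqrt.tendsto 0).comp he0
  rw [← tendsto_sub_nhds_zero_iff, ← tendsto_add_atTop_iff_nat N]
  set e' : ℕ → ℝ := fun i => e (i + N) with he'
  have hpos : ∀ i, 0 < e' i := fun i => hN _ (Nat.le_add_left _ _)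
  have hs' : Tendsto (fun i => √(e' i)) atTop (𝓝 0) :=
    hs.comp (tendsto_add_atTop_nat N)
  refine (ContinuousLinearMap.hasBasis_nhds_zero (𝕜₁ := ℝ)).tendsto_right_iff.2 ?_
  rintro ⟨C, U⟩ ⟨hC, hU⟩
  obtain ⟨⟨B, r⟩, ⟨hB, hr⟩, hBU⟩ := (CompactConvergenceCLM.hasBasis_nhds_zero_of_basis
    (σ := RingHom.id ℝ) (E := 𝓓(V, ℝ)) (F := ℂ) Metric.nhds_basis_ball).mem_iff.1 hU
  -- the normalized differences, extended by zero to the point at infinity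
  let R : OnePoint ℕ × 𝓓(V, ℝ) → SmoothFun V := fun x =>
    x.1.elim (0 : SmoothFun V) fun i => (√(e' i))⁻¹ • (P (e' i) x.2 - P₀ x.2)
  have hR : Continuous R := by
    rw [continuous_iff_continuousAt]
    rintro ⟨x, ψ⟩
    induction x using OnePoint.rec with
    | infty =>
      change Tendsto R _ (𝓝 0)
      refine SmoothFun.tendsto_zero_of_derivMap fun k => ?_
      obtain ⟨q, hq, hb⟩ := h k
      let a : OnePoint ℕ → ℝ := fun x => x.elim 0 fun i => √(e' i)
      have ha : Continuous a := (OnePoint.continuous_iff_from_nat a).2 hs'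
      refine ⟨fun x => a x.1 * q x.2, ?_, ?_⟩
      · have h1 : Continuous fun x : OnePoint ℕ × 𝓓(V, ℝ) => a x.1 * q x.2 :=
          (ha.comp continuous_fst).mul (hq.comp continuous_snd)
        have h2 := h1.tendsto (OnePoint.infty, ψ)
        rwa [show a OnePoint.infty = 0 from rfl, zero_mul] at h2
      · rintro ⟨x, χ⟩ y hy
        induction x using OnePoint.rec with
        | infty =>
          change ‖iteratedFDeriv ℝ k (fun _ => (0 : ℂ)) y‖ ≤ 0 * q χ
          rw [show (fun _ : EuclideanSpace ℝ (Fin m) => (0 : ℂ)) = 0 from rfl, iteratedFDeriv_zero]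
          simp
        | coe i =>
          change ‖iteratedFDeriv ℝ k
            ((√(e' i))⁻¹ • (P (e' i) χ - P₀ χ : SmoothFun V) : SmoothFun V) y‖ ≤ √(e' i) * q χ
          have h1 := (((SmoothFun.derivLin V k).map_smul (((√(e' i))⁻¹ : ℝ) : ℂ)
            (P (e' i) χ - P₀ χ)))
          have h2 : iteratedFDeriv ℝ k
              ((√(e' i))⁻¹ • (P (e' i) χ - P₀ χ : SmoothFun V) : SmoothFun V) y =
              (((√(e' i))⁻¹ : ℝ) : ℂ) • iteratedFDeriv ℝ k (P (e' i) χ - P₀ χ : SmoothFun V) y :=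
            congrArg (fun g => g ⟨y, hy⟩) h1
          rw [h2, norm_smul, Complex.norm_real, norm_inv, Real.norm_of_nonneg (Real.sqrt_nonneg _),
            inv_mul_le_iff₀ (Real.sqrt_pos.2 (hpos i)), ← mul_assoc,
            Real.mul_self_sqrt (hpos i).le]
          exact hb _ (hpos i) χ y hy
    | coe i =>
      have h1 : ContinuousAt (fun x : ℕ × 𝓓(V, ℝ) => R ((x.1 : OnePoint ℕ), x.2)) (i, ψ) := by
        refine Continuous.continuousAt ?_
        refine continuous_prod_of_discrete_left.2 fun j => ?_
        exact ((P (e' j)).continuous.sub P₀.continuous).const_smul (√(e' j))⁻¹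
      have h2 : IsOpenEmbedding (Prod.map ((↑) : ℕ → OnePoint ℕ) (id : 𝓓(V, ℝ) → 𝓓(V, ℝ))) :=
        OnePoint.isOpenEmbedding_coe.prodMap .id
      exact (h2.continuousAt_iff (g := R) (x := (i, ψ))).1 h1
  have hQ : IsCompact (R '' (univ ×ˢ B)) := (isCompact_univ.prod hB).image hR
  have hbd := UniformConvergenceCLM.isVonNBounded_image2_apply (R := ℝ) hC hQ
  rw [NormedSpace.isVonNBounded_iff] at hbd
  obtain ⟨M, hM⟩ := hbd.exists_norm_le
  have hlim : Tendsto (fun i => √(e' i) * M) atTop (𝓝 0) := by simpa using hs'.mul_const M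
  filter_upwards [hlim.eventually_lt_const hr] with i hi v hv
  refine hBU fun ψ hψ => ?_
  have h1 : ‖v (R ((i : OnePoint ℕ), ψ))‖ ≤ M :=
    hM _ ⟨v, hv, _, ⟨((i : OnePoint ℕ), ψ), ⟨mem_univ _, hψ⟩, rfl⟩, rfl⟩
  have h2 : v (R ((i : OnePoint ℕ), ψ)) = (((√(e' i))⁻¹ : ℝ) : ℂ) * v (P (e' i) ψ - P₀ ψ) := by
    change v ((((√(e' i))⁻¹ : ℝ) : ℂ) • (P (e' i) ψ - P₀ ψ)) = _
    rw [map_smul, smul_eq_mul]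
  rw [h2, norm_mul, Complex.norm_real, norm_inv, Real.norm_of_nonneg (Real.sqrt_nonneg _),
    inv_mul_le_iff₀ (Real.sqrt_pos.2 (hpos i))] at h1
  rw [mem_ball_zero_iff]
  refine lt_of_le_of_lt ?_ hi
  refine le_trans (le_of_eq ?_) h1
  rw [map_sub]
  rfl

end Spaces

/-! ### Composition of `C¹` maps with continuous linear maps -/

section C1

theorem hasFDerivAt_clm_comp {n : ℕ} {F G : Type*} [AddCommGroup F] [Module ℝ F]
    [TopologicalSpace F] [AddCommGroup G] [Module ℝ G] [TopologicalSpace G]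
    {v : EuclideanSpace ℝ (Fin n) → F} (T : F →L[ℝ] G) {v' : EuclideanSpace ℝ (Fin n) →L[ℝ] F}
    {t : EuclideanSpace ℝ (Fin n)} (h : HasFDerivAt v v' t) :
    HasFDerivAt (fun s => T (v s)) (T.comp v') t := by
  refine .of_isLittleOTVS ?_
  have h1 := (T.isBigOTVS_comp (l := 𝓝 t)
    (f := fun x' => v x' - v t - v' (x' - t))).trans_isLittleOTVS h.isLittleOTVS
  refine h1.congr_left fun x => ?_
  simp

theorem hasFDerivAt_of_eqOn {n : ℕ} {F G : Type*} [AddCommGroup F] [Module ℝ F] [UniformSpace F]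
    [IsUniformAddGroup F] [ContinuousConstSMul ℝ F] [AddCommGroup G] [Module ℝ G]
    [TopologicalSpace G] {W : Opens (EuclideanSpace ℝ (Fin n))} {v : EuclideanSpace ℝ (Fin n) → F}
    {w : EuclideanSpace ℝ (Fin n) → G} (hv : IsC1On W v) (T : F →L[ℝ] G)
    (hw : ∀ t ∈ W, w t = T (v t)) {t : EuclideanSpace ℝ (Fin n)} (ht : t ∈ W) :
    HasFDerivAt w (T.comp (fderiv ℝ v t)) t := by
  have h1 := hasFDerivAt_clm_comp T (hv.1 t ht).hasFDerivAt
  refine h1.congr_of_eventuallyEq ?_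
  filter_upwards [W.isOpen.mem_nhds ht] with s hs using hw s hs

variable {n : ℕ} {F G : Type*} [AddCommGroup F] [Module ℝ F] [UniformSpace F] [IsUniformAddGroup F]
  [ContinuousSMul ℝ F] [AddCommGroup G] [Module ℝ G] [UniformSpace G] [IsUniformAddGroup G]
  [ContinuousSMul ℝ G] [T2Space G]
  {W : Opens (EuclideanSpace ℝ (Fin n))} {v : EuclideanSpace ℝ (Fin n) → F}

theorem isC1On_of_eqOn {w : EuclideanSpace ℝ (Fin n) → G} (hv : IsC1On W v) (T : F →L[ℝ] G)
    (hw : ∀ t ∈ W, w t = T (v t)) : IsC1On W w := by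
  refine ⟨fun t ht => (hasFDerivAt_of_eqOn hv T hw ht).differentiableAt, ?_⟩
  have h1 : ContinuousOn (fun t => T.comp (fderiv ℝ v t)) W :=
    (ContinuousLinearMap.postcomp (EuclideanSpace ℝ (Fin n)) T).continuous.comp_continuousOn hv.2
  exact h1.congr fun t ht => (hasFDerivAt_of_eqOn hv T hw ht).fderiv

/-- Composition with operators which converge uniformly on bounded sets gives convergence in `C¹`:
on a compact set the values of `v` and of its derivative are bounded. -/
theorem tendstoC1On_of_tendsto {ι : Type*} {l : Filter ι} {T : ι → F →L[ℝ] G} {T₀ : F →L[ℝ] G}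
    (hT : Tendsto T l (𝓝 T₀)) (hv : IsC1On W v) {w : ι → EuclideanSpace ℝ (Fin n) → G}
    {w₀ : EuclideanSpace ℝ (Fin n) → G}
    (hw : ∀ᶠ i in l, ∀ t ∈ W, w i t = T i (v t)) (hw₀ : ∀ t ∈ W, w₀ t = T₀ (v t)) :
    TendstoC1On l W w w₀ := by
  have hT' := tendsto_sub_nhds_zero_iff.2 hT
  intro K hK hKW
  constructor
  · rw [tendstoUniformlyOn_iff_tendstoUniformlyOnFilter, tendstoUniformlyOnFilter_iff_tendsto,
      uniformity_eq_comap_nhds_zero, tendsto_comap_iff]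
    intro U hU
    have hvc : ContinuousOn v K := fun t ht =>
      ((hv.1 t (hKW ht)).hasFDerivAt.continuousAt).continuousWithinAt
    have hb : Bornology.IsVonNBounded ℝ (v '' K) := (hK.image_of_continuousOn hvc).isVonNBounded ℝ
    have h1 := hT' ((ContinuousLinearMap.hasBasis_nhds_zero (𝕜₁ := ℝ)).mem_of_mem
      (i := (v '' K, U)) ⟨hb, hU⟩)
    rw [mem_map] at h1
    rw [mem_map]
    filter_upwards [prod_mem_prod (inter_mem h1 hw) (mem_principal_self K)] with p hp
    obtain ⟨⟨hp1, hp3⟩, hp2⟩ := hp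
    have h2 := hp1 (v p.2) ⟨_, hp2, rfl⟩
    simp only [mem_preimage, Function.comp_apply]
    rw [hp3 _ (hKW hp2), hw₀ _ (hKW hp2)]
    exact h2
  · rw [tendstoUniformlyOn_iff_tendstoUniformlyOnFilter, tendstoUniformlyOnFilter_iff_tendsto,
      uniformity_eq_comap_nhds_zero, tendsto_comap_iff]
    intro U hU
    obtain ⟨⟨S, U'⟩, ⟨hS, hU'⟩, hSU⟩ :=
      (ContinuousLinearMap.hasBasis_nhds_zero (𝕜₁ := ℝ)).mem_iff.1 hU
    have hc : IsCompact (fderiv ℝ v '' K) := hK.image_of_continuousOn (hv.2.mono hKW)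
    have hb := ContinuousLinearMap.isVonNBounded_image2_apply (R := ℝ) (hc.isVonNBounded ℝ) hS
    have h1 := hT' ((ContinuousLinearMap.hasBasis_nhds_zero (𝕜₁ := ℝ)).mem_of_mem
      (i := (_, U')) ⟨hb, hU'⟩)
    rw [mem_map] at h1
    rw [mem_map]
    filter_upwards [prod_mem_prod (inter_mem h1 hw) (mem_principal_self K)] with p hp
    obtain ⟨⟨hp1, hp3⟩, hp2⟩ := hp
    simp only [mem_preimage, Function.comp_apply]
    rw [(hasFDerivAt_of_eqOn hv (T p.1) hp3 (hKW hp2)).fderiv,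
      (hasFDerivAt_of_eqOn hv T₀ hw₀ (hKW hp2)).fderiv]
    exact hSU fun s hs => hp1 _ ⟨_, ⟨_, hp2, rfl⟩, _, hs, rfl⟩

end C1

/-! ### Bounds for derivatives and decay of oscillatory integrals -/

section Bounds

universe u

open scoped RealInnerProductSpace

variable {E F : Type u} [NormedAddCommGroup E] [InnerProductSpace ℝ E]
  [NormedAddCommGroup F] [NormedSpace ℝ F]

theorem contDiff_rexp_neg_norm_sq (a : ℝ) : ContDiff ℝ ∞ fun v : E => Real.exp (-a * ‖v‖ ^ 2) :=
  (contDiff_const.mul (contDiff_norm_sq ℝ)).exp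

theorem hasTemperateGrowth_fderiv {P : E → F} (hP : P.HasTemperateGrowth) :
    (fderiv ℝ P).HasTemperateGrowth := by
  refine ⟨hP.1.fderiv_right (by simp), fun n => ?_⟩
  obtain ⟨k, C, h⟩ := hP.2 (n + 1)
  exact ⟨k, C, fun x => norm_iteratedFDeriv_fderiv.trans_le (h x)⟩

/-- A Gaussian times a function of temperate growth has bounded derivatives of all orders. -/
theorem exists_bound_iteratedFDeriv_gaussian_smul {a : ℝ} (ha : 0 < a) {P : E → F}
    (hP : P.HasTemperateGrowth) (k : ℕ) :
    ∃ C, 0 ≤ C ∧ ∀ v, ‖iteratedFDeriv ℝ k (fun v => Real.exp (-a * ‖v‖ ^ 2) • P v) v‖ ≤ C := by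
  induction k generalizing F with
  | zero =>
    obtain ⟨n, C, hC, h⟩ := hP.norm_iteratedFDeriv_le_uniform 0
    refine ⟨Real.exp (n ^ 2 / (4 * a)) * C, by positivity, fun v => ?_⟩
    have h1 := h 0 le_rfl v
    rw [norm_iteratedFDeriv_zero] at h1 ⊢
    have h2 : (1 + ‖v‖) ^ n ≤ Real.exp (n * ‖v‖) := by
      rw [Real.exp_nat_mul]
      gcongr
      rw [add_comm]
      exact Real.add_one_le_exp _
    have h3 : -a * ‖v‖ ^ 2 + n * ‖v‖ ≤ n ^ 2 / (4 * a) := by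
      rw [le_div_iff₀ (by positivity)]
      nlinarith [sq_nonneg (2 * a * ‖v‖ - n)]
    rw [norm_smul, Real.norm_of_nonneg (Real.exp_nonneg _)]
    calc _ ≤ Real.exp (-a * ‖v‖ ^ 2) * (C * Real.exp (n * ‖v‖)) := by
          gcongr
          exact h1.trans (by gcongr)
      _ = Real.exp (-a * ‖v‖ ^ 2 + n * ‖v‖) * C := by rw [Real.exp_add]; ring
      _ ≤ _ := by gcongr
  | succ k ih =>
    have hd : Differentiable ℝ P := hP.1.differentiable (by simp)
    have hQ : (fun v =>
        fderiv ℝ P v + (-(2 * a)) • (innerSL ℝ v).smulRight (P v)).HasTemperateGrowth :=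
      (hasTemperateGrowth_fderiv hP).add ((Function.HasTemperateGrowth.const (-(2 * a))).smul
        ((ContinuousLinearMap.smulRightL ℝ E F).bilinear_hasTemperateGrowth
          (innerSL ℝ).hasTemperateGrowth hP))
    obtain ⟨C, hC, h⟩ := ih hQ
    refine ⟨C, hC, fun v => ?_⟩
    have key : fderiv ℝ (fun v => Real.exp (-a * ‖v‖ ^ 2) • P v) = fun v =>
        Real.exp (-a * ‖v‖ ^ 2) • (fderiv ℝ P v + (-(2 * a)) • (innerSL ℝ v).smulRight (P v)) := by
      funext w
      have h1 : HasFDerivAt (fun v : E => Real.exp (-a * ‖v‖ ^ 2))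
          (Real.exp (-a * ‖w‖ ^ 2) • (-a) • (2 • innerSL ℝ w)) w :=
        ((hasStrictFDerivAt_norm_sq w).hasFDerivAt.const_mul (-a)).exp
      refine (h1.smul (hd w).hasFDerivAt).fderiv.trans ?_
      ext x
      simp only [_root_.add_apply, _root_.smul_apply,
        ContinuousLinearMap.smulRight_apply, nsmul_eq_mul, smul_add, smul_smul, smul_eq_mul,
        innerSL_apply_apply]
      congr 2
      push_cast
      ring
    rw [← norm_iteratedFDeriv_fderiv, key]
    exact h v

theorem norm_iteratedFDeriv_comp_const_smul_le {f : E → F} (hf : ContDiff ℝ ∞ f) {C τ : ℝ}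
    (hτ : 0 ≤ τ) (k : ℕ) (h : ∀ v, ‖iteratedFDeriv ℝ k f v‖ ≤ C) (w : E) :
    ‖iteratedFDeriv ℝ k (fun v => f (τ • v)) w‖ ≤ τ ^ k * C := by
  rw [iteratedFDeriv_comp_const_smul τ (hf.of_le (by exact_mod_cast le_top)), norm_smul, norm_pow,
    Real.norm_of_nonneg hτ]
  gcongr
  exact h _

theorem contDiff_cexp_inner (ξ : E) :
    ContDiff ℝ ∞ fun w : E => Complex.exp (Complex.I * (⟪ξ, w⟫ : ℝ)) :=
  (contDiff_const.mul (Complex.ofRealCLM.contDiff.comp (innerSL ℝ ξ).contDiff)).cexp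

theorem norm_iteratedFDeriv_cexp_inner_le (ξ : E) (k : ℕ) (w : E) :
    ‖iteratedFDeriv ℝ k (fun w : E => Complex.exp (Complex.I * (⟪ξ, w⟫ : ℝ))) w‖ ≤ ‖ξ‖ ^ k := by
  have h0 : ContDiff ℝ k fun r : ℝ => Complex.exp (Complex.I * (r : ℂ)) :=
    (contDiff_const.mul Complex.ofRealCLM.contDiff).cexp
  have h1 := (innerSL ℝ ξ).iteratedFDeriv_comp_right h0 w (i := k) le_rfl
  have h2 : (fun w : E => Complex.exp (Complex.I * (⟪ξ, w⟫ : ℝ))) =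
    (fun r : ℝ => Complex.exp (Complex.I * (r : ℂ))) ∘ innerSL ℝ ξ := rfl
  have h3 : ∀ r : ℝ,
      ‖iteratedFDeriv ℝ k (fun r : ℝ => Complex.exp (Complex.I * (r : ℂ))) r‖ ≤ 1 := by
    intro r
    rw [norm_iteratedFDeriv_eq_norm_iteratedDeriv]
    have h4 : ∀ k : ℕ, iteratedDeriv k (fun r : ℝ => Complex.exp (Complex.I * (r : ℂ))) =
        fun r : ℝ => Complex.I ^ k * Complex.exp (Complex.I * (r : ℂ)) := by
      intro k
      induction k with
      | zero => simp
      | succ k ih =>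
        rw [iteratedDeriv_succ, ih]
        ext r
        have h5 : HasDerivAt (fun r : ℝ => Complex.exp (Complex.I * (r : ℂ)))
            (Complex.exp (Complex.I * (r : ℂ)) * (Complex.I * 1)) r :=
          ((Complex.ofRealCLM.hasDerivAt (x := r)).const_mul Complex.I).cexp
        rw [(h5.const_mul (Complex.I ^ k)).deriv]
        ring
    rw [h4, norm_mul, norm_pow, Complex.norm_I, one_pow, one_mul, mul_comm,
      Complex.norm_exp_ofReal_mul_I]
  rw [h2, h1]
  refine (ContinuousMultilinearMap.norm_compContinuousLinearMap_le _ _).trans ?_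
  rw [Finset.prod_const, Finset.card_univ, Fintype.card_fin, innerSL_apply_norm]
  exact mul_le_of_le_one_left (by positivity) (h3 _)

end Bounds

section Decay

open scoped FourierTransform RealInnerProductSpace

variable {E : Type*} [NormedAddCommGroup E] [InnerProductSpace ℝ E] [FiniteDimensional ℝ E]
  [MeasurableSpace E] [BorelSpace E]
  {F : Type*} [NormedAddCommGroup F] [NormedSpace ℂ F]

theorem integral_cexp_inner_smul_eq_fourier (f : E → F) (ξ : E) :
    ∫ w, Complex.exp (Complex.I * (⟪ξ, w⟫ : ℝ)) • f w = 𝓕 f (-(2 * Real.pi)⁻¹ • ξ) := by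
  rw [Real.fourier_eq']
  refine integral_congr_ae (.of_forall fun w => ?_)
  simp only [inner_smul_right, real_inner_comm]
  congr 2
  push_cast
  have : (Real.pi : ℂ) ≠ 0 := by exact_mod_cast Real.pi_ne_zero
  field_simp

theorem integrable_norm_iteratedFDeriv {f : E → F} (hf : ContDiff ℝ ∞ f) (hc : HasCompactSupport f)
    (k : ℕ) : Integrable fun x => ‖iteratedFDeriv ℝ k f x‖ :=
  ((hf.continuous_iteratedFDeriv (by exact_mod_cast le_top)).integrable_of_hasCompactSupport
    (hc.iteratedFDeriv k)).norm

/-- Non-stationary phase: an oscillatory integral decays as fast as the amplitude is smooth. -/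
theorem exists_oscillatory_decay (E : Type*) [NormedAddCommGroup E] [InnerProductSpace ℝ E]
    [FiniteDimensional ℝ E] [MeasurableSpace E] [BorelSpace E] (N : ℕ) :
    ∃ C, 0 ≤ C ∧ ∀ (f : E → F), ContDiff ℝ ∞ f → HasCompactSupport f → ∀ ξ : E,
      (1 + ‖ξ‖) ^ N * ‖∫ w, Complex.exp (Complex.I * (⟪ξ, w⟫ : ℝ)) • f w‖ ≤
        C * ∑ j ∈ Finset.range (N + 1), ∫ w, ‖iteratedFDeriv ℝ j f w‖ := by
  refine ⟨2 ^ N * (1 + (2 * Real.pi) ^ N * 2 ^ N), by positivity, fun f hf hc ξ => ?_⟩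
  set S := ∑ j ∈ Finset.range (N + 1), ∫ w, ‖iteratedFDeriv ℝ j f w‖ with hS
  have hS0 : ∫ w, ‖iteratedFDeriv ℝ 0 f w‖ ≤ S :=
    Finset.single_le_sum (f := fun j => ∫ w, ‖iteratedFDeriv ℝ j f w‖)
      (fun i _ => integral_nonneg fun _ => norm_nonneg _) (Finset.mem_range.2 (Nat.succ_pos N))
  have hSnn : 0 ≤ S := Finset.sum_nonneg fun i _ => integral_nonneg fun _ => norm_nonneg _
  have h1 : ‖∫ w, Complex.exp (Complex.I * (⟪ξ, w⟫ : ℝ)) • f w‖ ≤ S := by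
    refine (norm_integral_le_integral_norm _).trans (le_trans (le_of_eq ?_) hS0)
    refine integral_congr_ae (.of_forall fun w => ?_)
    simp only [norm_iteratedFDeriv_zero]
    rw [norm_smul, mul_comm Complex.I, Complex.norm_exp_ofReal_mul_I, one_mul]
  have h2 : ‖ξ‖ ^ N * ‖∫ w, Complex.exp (Complex.I * (⟪ξ, w⟫ : ℝ)) • f w‖ ≤
      (2 * Real.pi) ^ N * 2 ^ N * S := by
    rw [integral_cexp_inner_smul_eq_fourier]
    have h3 := Real.pow_mul_norm_iteratedFDeriv_fourier_le (K := 0) (N := N) (f := f)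
      (hf.of_le (by exact_mod_cast le_top)) (fun k n hk hn => by
        have hk0 : k = 0 := by simpa using hk
        subst hk0
        simpa using integrable_norm_iteratedFDeriv hf hc n) (k := 0) (n := N) le_rfl le_rfl
      (-(2 * Real.pi)⁻¹ • ξ)
    rw [norm_smul, norm_neg, norm_inv, Real.norm_of_nonneg (by positivity), mul_pow, inv_pow,
      mul_assoc, inv_mul_le_iff₀ (by positivity), norm_iteratedFDeriv_zero] at h3
    refine h3.trans (le_of_eq ?_)
    rw [zero_add, Finset.range_one, Finset.sum_product]
    simp [hS]
    ring
  have h4 : (1 + ‖ξ‖) ^ N ≤ 2 ^ N * (1 + ‖ξ‖ ^ N) := by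
    rcases le_total ‖ξ‖ 1 with h | h
    · calc (1 + ‖ξ‖) ^ N ≤ 2 ^ N := by gcongr; linarith
        _ ≤ _ := le_mul_of_one_le_right (by positivity) (by simp)
    · calc (1 + ‖ξ‖) ^ N ≤ (2 * ‖ξ‖) ^ N := by gcongr; linarith
        _ = 2 ^ N * ‖ξ‖ ^ N := mul_pow ..
        _ ≤ _ := by gcongr; linarith
  calc _ ≤ 2 ^ N * (1 + ‖ξ‖ ^ N) * ‖∫ w, Complex.exp (Complex.I * (⟪ξ, w⟫ : ℝ)) • f w‖ := by gcongr
    _ = 2 ^ N * (‖∫ w, Complex.exp (Complex.I * (⟪ξ, w⟫ : ℝ)) • f w‖ +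
        ‖ξ‖ ^ N * ‖∫ w, Complex.exp (Complex.I * (⟪ξ, w⟫ : ℝ)) • f w‖) := by ring
    _ ≤ 2 ^ N * (S + (2 * Real.pi) ^ N * 2 ^ N * S) := by gcongr
    _ = _ := by ring

/-- The decay of an oscillatory integral whose amplitude is a translate of `f` times a dilated
symbol `γ (τ w)`: each power of decay costs a power of the dilation `τ`. -/
theorem exists_oscillatory_decay_dilated (E : Type*) [NormedAddCommGroup E] [InnerProductSpace ℝ E]
    [FiniteDimensional ℝ E] [MeasurableSpace E] [BorelSpace E] (N : ℕ) :
    ∃ C, 0 ≤ C ∧ ∀ (f : E → F), ContDiff ℝ ∞ f → HasCompactSupport f →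
      ∀ (γ : E → ℂ), ContDiff ℝ ∞ γ → ∀ B : ℝ, (∀ j ≤ N, ∀ v, ‖iteratedFDeriv ℝ j γ v‖ ≤ B) →
      ∀ τ : ℝ, 0 ≤ τ → ∀ y ξ : E,
      (1 + ‖ξ‖) ^ N * ‖∫ w, Complex.exp (Complex.I * (⟪ξ, w⟫ : ℝ)) • γ (τ • w) • f (y + w)‖ ≤
        C * (1 + τ) ^ N * B * ∑ j ∈ Finset.range (N + 1), ∫ w, ‖iteratedFDeriv ℝ j f w‖ := by
  obtain ⟨C, hC, h⟩ := exists_oscillatory_decay (F := F) E N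
  refine ⟨C * ∑ j ∈ Finset.range (N + 1), ∑ i ∈ Finset.range (j + 1), (j.choose i : ℝ),
    by positivity, ?_⟩
  intro f hf hc γ hγ B hB τ hτ y ξ
  set S := ∑ j ∈ Finset.range (N + 1), ∫ w, ‖iteratedFDeriv ℝ j f w‖ with hS
  have hSj : ∀ j ≤ N, ∫ w, ‖iteratedFDeriv ℝ j f w‖ ≤ S := fun j hj =>
    Finset.single_le_sum (f := fun j => ∫ w, ‖iteratedFDeriv ℝ j f w‖)
      (fun i _ => integral_nonneg fun _ => norm_nonneg _) (Finset.mem_range.2 (by omega))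
  have hB0 : 0 ≤ B := (norm_nonneg _).trans (hB 0 (Nat.zero_le _) 0)
  have hfy : ContDiff ℝ ∞ fun w => f (y + w) := hf.comp (contDiff_const.add contDiff_id)
  have hγτ : ContDiff ℝ ∞ fun w => γ (τ • w) := hγ.comp (contDiff_const.smul contDiff_id)
  have hcy : HasCompactSupport fun w => f (y + w) := hc.comp_homeomorph (Homeomorph.addLeft y)
  refine (h _ (hγτ.smul hfy) hcy.smul_left ξ).trans ?_
  rw [mul_assoc, mul_assoc, mul_assoc]
  refine mul_le_mul_of_nonneg_left ?_ hC
  rw [Finset.sum_mul]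
  refine Finset.sum_le_sum fun j hj => ?_
  have hjN : j ≤ N := by simpa [Nat.lt_succ_iff] using hj
  have hint : ∀ i, Integrable fun w => ‖iteratedFDeriv ℝ i f (y + w)‖ := fun i =>
    (integrable_norm_iteratedFDeriv hf hc i).comp_add_left y
  calc ∫ w, ‖iteratedFDeriv ℝ j (fun w => γ (τ • w) • f (y + w)) w‖
      ≤ ∫ w, ∑ i ∈ Finset.range (j + 1), (j.choose i : ℝ) * ((1 + τ) ^ N * B) *
          ‖iteratedFDeriv ℝ (j - i) f (y + w)‖ := by
        refine integral_mono_of_nonneg (.of_forall fun _ => norm_nonneg _)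
          (integrable_finsetSum _ fun i _ => (hint _).const_mul _) (.of_forall fun w => ?_)
        refine (norm_iteratedFDeriv_smul_le hγτ hfy w (by exact_mod_cast le_top)).trans ?_
        refine Finset.sum_le_sum fun i hi => ?_
        have hij : i ≤ j := by simpa [Nat.lt_succ_iff] using hi
        rw [iteratedFDeriv_comp_add_left]
        have h1 : ‖iteratedFDeriv ℝ i (fun w => γ (τ • w)) w‖ ≤ (1 + τ) ^ N * B := by
          rw [iteratedFDeriv_comp_const_smul τ (hγ.of_le (by exact_mod_cast le_top)), norm_smul,
            norm_pow, Real.norm_of_nonneg hτ]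
          have h2 : τ ^ i ≤ (1 + τ) ^ N := by
            calc τ ^ i ≤ (1 + τ) ^ i := by gcongr; linarith
              _ ≤ (1 + τ) ^ N := pow_le_pow_right₀ (by linarith) (by omega)
          gcongr
          exact hB i (by omega) _
        gcongr
    _ = ∑ i ∈ Finset.range (j + 1), (j.choose i : ℝ) * ((1 + τ) ^ N * B) *
          ∫ w, ‖iteratedFDeriv ℝ (j - i) f w‖ := by
        rw [integral_finsetSum _ fun i _ => (hint _).const_mul _]
        refine Finset.sum_congr rfl fun i _ => ?_
        rw [integral_const_mul, integral_add_left_eq_self fun w => ‖iteratedFDeriv ℝ (j - i) f w‖]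
    _ ≤ ∑ i ∈ Finset.range (j + 1), (j.choose i : ℝ) * ((1 + τ) ^ N * B) * S := by
        gcongr with i hi
        exact hSj _ (by omega)
    _ = _ := by
        rw [Finset.sum_mul]
        exact Finset.sum_congr rfl fun i _ => by ring

end Decay

/-! ### Differentiation under the integral sign -/

section Parametric

variable {X : Type*} [MeasurableSpace X] {μ : Measure X}
  {E : Type*} [NormedAddCommGroup E] [NormedSpace ℝ E]
  {F : Type*} [NormedAddCommGroup F] [NormedSpace ℝ F]

/-- Differentiation under the integral sign, to every order, for locally dominated derivatives. -/
theorem iteratedFDeriv_integral {Φ : X → E → F} (hΦ : ∀ᵐ p ∂μ, ContDiff ℝ ∞ (Φ p))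
    (hm : ∀ k y, AEStronglyMeasurable (fun p => iteratedFDeriv ℝ k (Φ p) y) μ)
    (hb : ∀ k y, ∃ s ∈ 𝓝 y, ∃ b : X → ℝ, Integrable b μ ∧
      ∀ᵐ p ∂μ, ∀ z ∈ s, ‖iteratedFDeriv ℝ k (Φ p) z‖ ≤ b p) (k : ℕ) :
    (iteratedFDeriv ℝ k fun y => ∫ p, Φ p y ∂μ) =
      (fun y => ∫ p, iteratedFDeriv ℝ k (Φ p) y ∂μ) ∧
    Differentiable ℝ (iteratedFDeriv ℝ k fun y => ∫ p, Φ p y ∂μ) := by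
  have key : ∀ k y, HasFDerivAt (fun y => ∫ p, iteratedFDeriv ℝ k (Φ p) y ∂μ)
      (∫ p, fderiv ℝ (iteratedFDeriv ℝ k (Φ p)) y ∂μ) y := by
    intro k y
    obtain ⟨s, hs, b, hbi, hbs⟩ := hb (k + 1) y
    have hi : Integrable (fun p => iteratedFDeriv ℝ k (Φ p) y) μ := by
      obtain ⟨s, hs, b, hbi, hbs⟩ := hb k y
      exact hbi.mono' (hm k y) (hbs.mono fun p hp => hp y (mem_of_mem_nhds hs))
    refine hasFDerivAt_integral_of_dominated_of_fderiv_le (𝕜 := ℝ) (μ := μ)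
      (F := fun y p => iteratedFDeriv ℝ k (Φ p) y)
      (F' := fun y p => fderiv ℝ (iteratedFDeriv ℝ k (Φ p)) y) (s := s) (bound := b) hs
      (.of_forall fun z => hm k z) hi ?_ ?_ hbi ?_
    · let L : (E [×(k + 1)]→L[ℝ] F) ≃ₗᵢ[ℝ] (E →L[ℝ] E [×k]→L[ℝ] F) :=
        continuousMultilinearCurryLeftEquiv ℝ (fun _ : Fin (k + 1) => E) F
      have h := L.continuous.comp_aestronglyMeasurable (hm (k + 1) y)
      refine h.congr (.of_forall fun p => ?_)
      simp only [iteratedFDeriv_succ_eq_comp_left, Function.comp_apply]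
      exact LinearIsometryEquiv.apply_symm_apply _ _
    · filter_upwards [hbs] with p hp z hz
      rw [norm_fderiv_iteratedFDeriv]
      exact hp z hz
    · filter_upwards [hΦ] with p hp z _
      exact ((hp.differentiable_iteratedFDeriv (m := k)
        (by exact_mod_cast WithTop.coe_lt_top _)) z).hasFDerivAt
  have h1 : ∀ k, (iteratedFDeriv ℝ k fun y => ∫ p, Φ p y ∂μ) =
      fun y => ∫ p, iteratedFDeriv ℝ k (Φ p) y ∂μ := by
    intro k
    induction k with
    | zero =>
      funext y
      simp only [iteratedFDeriv_zero_eq_comp, Function.comp_apply]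
      exact ((continuousMultilinearCurryFin0 ℝ E F).symm.toContinuousLinearEquiv
        |>.integral_comp_comm _).symm
    | succ k ih =>
      funext y
      rw [iteratedFDeriv_succ_eq_comp_left, ih]
      simp only [Function.comp_apply]
      rw [(key k y).fderiv]
      simp only [iteratedFDeriv_succ_eq_comp_left, Function.comp_apply]
      let L : (E [×(k + 1)]→L[ℝ] F) ≃ₗᵢ[ℝ] (E →L[ℝ] E [×k]→L[ℝ] F) :=
        continuousMultilinearCurryLeftEquiv ℝ (fun _ : Fin (k + 1) => E) F
      exact (ContinuousLinearEquiv.integral_comp_comm (𝕜 := ℝ) (E := E →L[ℝ] E [×k]→L[ℝ] F)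
        (F := E [×(k + 1)]→L[ℝ] F) L.symm.toContinuousLinearEquiv
        (fun p => fderiv ℝ (iteratedFDeriv ℝ k (Φ p)) y)).symm
  refine ⟨h1 k, ?_⟩
  rw [h1 k]
  exact fun y => (key k y).differentiableAt

theorem contDiff_integral {Φ : X → E → F} (hΦ : ∀ᵐ p ∂μ, ContDiff ℝ ∞ (Φ p))
    (hm : ∀ k y, AEStronglyMeasurable (fun p => iteratedFDeriv ℝ k (Φ p) y) μ)
    (hb : ∀ k y, ∃ s ∈ 𝓝 y, ∃ b : X → ℝ, Integrable b μ ∧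
      ∀ᵐ p ∂μ, ∀ z ∈ s, ‖iteratedFDeriv ℝ k (Φ p) z‖ ≤ b p) :
    ContDiff ℝ ∞ fun y => ∫ p, Φ p y ∂μ :=
  contDiff_of_differentiable_iteratedFDeriv fun k _ => (iteratedFDeriv_integral hΦ hm hb k).2

end Parametric

/-! ### The symbol of the error term -/

section Symbol

open scoped RealInnerProductSpace

universe u

variable {E : Type u} [NormedAddCommGroup E] [InnerProductSpace ℝ E]

/-- The vector field `v ↦ (1 - e^{-|v|²/2}) v / |v|²`, which is smooth with bounded derivatives.
(Its value at `0` is `0`, whatever the value of the quotient.) -/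
def errorSymbol (v : E) : E := ((1 - Real.exp (-(‖v‖ ^ 2 / 2))) / ‖v‖ ^ 2) • v

theorem errorSymbol_eq_integral [CompleteSpace E] (v : E) :
    errorSymbol v = ∫ σ in (0 : ℝ)..1, Real.exp (-2⁻¹ * ‖σ • v‖ ^ 2) • σ • v := by
  have h1 : ∀ σ : ℝ, Real.exp (-2⁻¹ * ‖σ • v‖ ^ 2) • σ • v =
      (σ * Real.exp (-2⁻¹ * (σ ^ 2 * ‖v‖ ^ 2))) • v := fun σ => by
    rw [smul_smul, norm_smul, mul_pow, Real.norm_eq_abs, sq_abs, mul_comm]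
  simp only [h1]
  rw [intervalIntegral.integral_smul_const, errorSymbol]
  rcases eq_or_ne v 0 with rfl | hv
  · simp
  congr 1
  have hv' : ‖v‖ ^ 2 ≠ 0 := pow_ne_zero _ (norm_ne_zero_iff.2 hv)
  have h2 : ∀ σ ∈ uIcc (0 : ℝ) 1, HasDerivAt
      (fun σ : ℝ => -(‖v‖ ^ 2)⁻¹ * Real.exp (-2⁻¹ * (σ ^ 2 * ‖v‖ ^ 2)))
      (σ * Real.exp (-2⁻¹ * (σ ^ 2 * ‖v‖ ^ 2))) σ := by
    intro σ _
    have := ((((hasDerivAt_pow 2 σ).mul_const (‖v‖ ^ 2)).const_mul (-2⁻¹)).exp).const_mul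
      (-(‖v‖ ^ 2)⁻¹)
    refine this.congr_deriv ?_
    simp
    field_simp
  rw [intervalIntegral.integral_eq_sub_of_hasDerivAt h2
    ((by fun_prop : Continuous fun σ : ℝ =>
      σ * Real.exp (-2⁻¹ * (σ ^ 2 * ‖v‖ ^ 2))).intervalIntegrable _ _)]
  simp
  field_simp
  ring_nf

theorem contDiff_errorSymbol_and_bound [FiniteDimensional ℝ E] :
    ContDiff ℝ ∞ (errorSymbol : E → E) ∧
      ∀ k, ∃ C, 0 ≤ C ∧ ∀ v : E, ‖iteratedFDeriv ℝ k (errorSymbol : E → E) v‖ ≤ C := by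
  let γ : E → E := fun v => Real.exp (-2⁻¹ * ‖v‖ ^ 2) • v
  have hγ : ContDiff ℝ ∞ γ := (contDiff_rexp_neg_norm_sq _).smul contDiff_id
  have hC : ∀ k, ∃ C, 0 ≤ C ∧ ∀ v, ‖iteratedFDeriv ℝ k γ v‖ ≤ C := fun k =>
    exists_bound_iteratedFDeriv_gaussian_smul (by norm_num) Function.HasTemperateGrowth.id k
  choose C hC0 hC using hC
  let μ : Measure ℝ := volume.restrict (Ioc 0 1)
  let Φ : ℝ → E → E := fun σ v => γ (σ • v)
  have hΦ : ∀ σ, ContDiff ℝ ∞ (Φ σ) := fun σ => hγ.comp (contDiff_const.smul contDiff_id)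
  have hb : ∀ k, ∀ᵐ σ ∂μ, ∀ v, ‖iteratedFDeriv ℝ k (Φ σ) v‖ ≤ C k := by
    intro k
    filter_upwards [ae_restrict_mem measurableSet_Ioc] with σ hσ v
    refine (norm_iteratedFDeriv_comp_const_smul_le hγ hσ.1.le k (hC k) v).trans ?_
    exact mul_le_of_le_one_left (hC0 k) (pow_le_one₀ hσ.1.le hσ.2)
  have hm : ∀ k y, AEStronglyMeasurable (fun σ => iteratedFDeriv ℝ k (Φ σ) y) μ := by
    intro k y
    have : Continuous fun σ : ℝ => iteratedFDeriv ℝ k (Φ σ) y := by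
      have h1 : (fun σ : ℝ => iteratedFDeriv ℝ k (Φ σ) y) =
          fun σ : ℝ => σ ^ k • iteratedFDeriv ℝ k γ (σ • y) := by
        funext σ
        exact congrFun (iteratedFDeriv_comp_const_smul σ (hγ.of_le (by exact_mod_cast le_top))) y
      rw [h1]
      exact (continuous_pow k).smul ((hγ.continuous_iteratedFDeriv (by exact_mod_cast le_top)).comp
        (continuous_id.smul continuous_const))
    exact this.aestronglyMeasurable
  have hb' : ∀ k y, ∃ s ∈ 𝓝 y, ∃ b : ℝ → ℝ, Integrable b μ ∧
      ∀ᵐ p ∂μ, ∀ z ∈ s, ‖iteratedFDeriv ℝ k (Φ p) z‖ ≤ b p := fun k y =>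
    ⟨univ, univ_mem, fun _ => C k, integrable_const _, (hb k).mono fun σ h z _ => h z⟩
  have heq : (errorSymbol : E → E) = fun v => ∫ σ, Φ σ v ∂μ := by
    funext v
    rw [errorSymbol_eq_integral, intervalIntegral.integral_of_le zero_le_one]
  rw [heq]
  refine ⟨contDiff_integral (.of_forall hΦ) hm hb', fun k => ⟨C k, hC0 k, fun v => ?_⟩⟩
  rw [(iteratedFDeriv_integral (.of_forall hΦ) hm hb' k).1]
  refine (norm_integral_le_of_norm_le_const ((hb k).mono fun σ h => h v)).trans ?_
  simp [μ]

theorem exists_bound_iteratedFDeriv_inner_errorSymbol [FiniteDimensional ℝ E] (N : ℕ) :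
    ∃ B, 0 ≤ B ∧ ∀ ξ : E, ∀ j ≤ N, ∀ v : E,
      ‖iteratedFDeriv ℝ j (fun v => ((⟪ξ, errorSymbol v⟫ : ℝ) : ℂ)) v‖ ≤ ‖ξ‖ * B := by
  obtain ⟨hs, hC⟩ := contDiff_errorSymbol_and_bound (E := E)
  choose C hC0 hC using hC
  refine ⟨∑ j ∈ Finset.range (N + 1), C j, Finset.sum_nonneg fun j _ => hC0 j,
    fun ξ j hj v => ?_⟩
  let L : E →L[ℝ] ℂ := Complex.ofRealCLM ∘L innerSL ℝ ξ
  have hL : ‖L‖ ≤ ‖ξ‖ := by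
    refine (ContinuousLinearMap.opNorm_comp_le _ _).trans ?_
    rw [Complex.ofRealCLM_norm, one_mul, innerSL_apply_norm]
  have h1 := L.norm_iteratedFDeriv_comp_left (f := (errorSymbol : E → E)) (x := v) (n := j)
    (hs.contDiffAt) (by exact_mod_cast le_top)
  refine (show _ ≤ _ from h1).trans ?_
  have h2 : C j ≤ ∑ j ∈ Finset.range (N + 1), C j :=
    Finset.single_le_sum (fun j _ => hC0 j) (Finset.mem_range.2 (by omega))
  gcongr
  exact (hC j v).trans h2

end Symbol

/-! ### Integrability against Gaussians -/

section GaussianIntegrable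

theorem norm_rpow_eq_sq_rpow {E : Type*} [NormedAddCommGroup E] (ξ : E) (s : ℝ) :
    ‖ξ‖ ^ s = (0 + ‖ξ‖ ^ 2) ^ (s / 2) := by
  rw [zero_add, ← Real.rpow_natCast_mul (norm_nonneg _)]
  congr 1
  push_cast
  ring

theorem neg_finrank_lt {E : Type*} [NormedAddCommGroup E] [NormedSpace ℝ E]
    [FiniteDimensional ℝ E] [Nontrivial E] {s : ℝ} (hs : -1 < s) :
    -(Module.finrank ℝ E : ℝ) < s := by
  have hm : (1 : ℝ) ≤ Module.finrank ℝ E := by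
    exact_mod_cast (Module.finrank_pos (R := ℝ) (M := E))
  linarith

variable {E : Type*} [NormedAddCommGroup E] [NormedSpace ℝ E] [FiniteDimensional ℝ E]
  [MeasurableSpace E] [BorelSpace E] {μ : Measure E} [μ.IsAddHaarMeasure]

theorem exp_neg_mul_sq_mul_pow_le {ε : ℝ} (hε : 0 < ε) (N : ℕ) {r : ℝ} (hr : 0 ≤ r) :
    Real.exp (-ε * r ^ 2) * (1 + r) ^ N ≤
      Real.exp (N ^ 2 / (2 * ε)) * Real.exp (-(ε / 2) * r ^ 2) := by
  have h2 : (1 + r) ^ N ≤ Real.exp (N * r) := by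
    rw [Real.exp_nat_mul]
    gcongr
    rw [add_comm]
    exact Real.add_one_le_exp _
  have h3 : N * r - ε / 2 * r ^ 2 ≤ N ^ 2 / (2 * ε) := by
    rw [le_div_iff₀ (by positivity)]
    nlinarith [sq_nonneg (ε * r - N)]
  calc _ ≤ Real.exp (-ε * r ^ 2) * Real.exp (N * r) := by gcongr
    _ = Real.exp (-ε * r ^ 2 + N * r) := (Real.exp_add _ _).symm
    _ ≤ Real.exp (N ^ 2 / (2 * ε) + -(ε / 2) * r ^ 2) := by
        refine Real.exp_le_exp.2 ?_
        linarith
    _ = _ := Real.exp_add _ _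

theorem integrable_gaussian_mul_rpow [Nontrivial E] {ε : ℝ} (hε : 0 < ε) {s : ℝ}
    (hs : -(Module.finrank ℝ E : ℝ) < s) :
    Integrable (fun ξ : E => Real.exp (-ε * ‖ξ‖ ^ 2) * ‖ξ‖ ^ s) μ := by
  rw [integrable_fun_norm_addHaar μ (f := fun r => Real.exp (-ε * r ^ 2) * r ^ s)]
  have hm : 1 ≤ Module.finrank ℝ E := Module.finrank_pos
  have h := (integrable_rpow_mul_exp_neg_mul_sq hε
    (s := ((Module.finrank ℝ E - 1 : ℕ) : ℝ) + s) (by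
      rw [Nat.cast_sub hm]; push_cast; linarith)).integrableOn (s := Ioi 0)
  refine h.congr_fun (fun r hr => ?_) measurableSet_Ioi
  have hr' : (0 : ℝ) < r := hr
  simp only [smul_eq_mul]
  rw [Real.rpow_add hr', Real.rpow_natCast]
  ring

/-- A Gaussian dominates polynomial growth and integrable power singularities at the origin. -/
theorem integrable_gaussian_mul_growth [Nontrivial E] {ε : ℝ} (hε : 0 < ε) (N : ℕ) {s : ℝ}
    (hs : -(Module.finrank ℝ E : ℝ) < s) :
    Integrable (fun ξ : E => Real.exp (-ε * ‖ξ‖ ^ 2) * ((1 + ‖ξ‖) ^ N * (1 + ‖ξ‖ ^ s))) μ := by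
  have hm : (1 : ℝ) ≤ Module.finrank ℝ E := by exact_mod_cast (Module.finrank_pos (R := ℝ) (M := E))
  have h0 := integrable_gaussian_mul_rpow (E := E) (μ := μ) (half_pos hε) (s := 0) (by linarith)
  have h1 := integrable_gaussian_mul_rpow (E := E) (μ := μ) (half_pos hε) hs
  refine ((h0.add h1).const_mul (Real.exp (N ^ 2 / (2 * ε)))).mono' ?_ (.of_forall fun ξ => ?_)
  · exact (by fun_prop : Measurable fun ξ : E =>
      Real.exp (-ε * ‖ξ‖ ^ 2) * ((1 + ‖ξ‖) ^ N * (1 + ‖ξ‖ ^ s))).aestronglyMeasurable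
  · rw [Real.norm_of_nonneg (by positivity)]
    calc _ = Real.exp (-ε * ‖ξ‖ ^ 2) * (1 + ‖ξ‖) ^ N * (1 + ‖ξ‖ ^ s) := by ring
      _ ≤ Real.exp (N ^ 2 / (2 * ε)) * Real.exp (-(ε / 2) * ‖ξ‖ ^ 2) * (1 + ‖ξ‖ ^ s) := by
          gcongr ?_ * _
          exact exp_neg_mul_sq_mul_pow_le hε N (norm_nonneg _)
      _ = _ := by
          simp only [Pi.add_apply, Real.rpow_zero]
          ring

theorem ae_ne_zero [Nontrivial E] : ∀ᵐ ξ : E ∂μ, ξ ≠ 0 :=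
  compl_mem_ae_iff.2 (measure_singleton 0)

end GaussianIntegrable

/-! ### The regularized reproducing kernel -/

section Kernel

open scoped RealInnerProductSpace

variable {E : Type*} [NormedAddCommGroup E] [InnerProductSpace ℝ E]

/-- The amplitude `e^{i⟨ξ,w⟩ - |ξ|^κ |w|²/2} (1 + (iκ/2) ⟨w,ξ⟩ |ξ|^{κ-2})`, which is what remains of
the integrand of the inversion formula after the integration in `x'`. -/
def amplitude (κ : ℝ) (w ξ : E) : ℂ :=
  Complex.exp (Complex.I * (⟪ξ, w⟫ : ℝ)) * (Real.exp (-(‖ξ‖ ^ κ * (‖w‖ ^ 2 / 2))) : ℝ) *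
    (1 + Complex.I * (κ / 2 * (⟪ξ, w⟫ * ‖ξ‖ ^ (κ - 2)) : ℝ))

theorem norm_cexp_I_inner (ξ w : E) : ‖Complex.exp (Complex.I * (⟪ξ, w⟫ : ℝ))‖ = 1 := by
  rw [mul_comm, Complex.norm_exp_ofReal_mul_I]

theorem norm_amplitude_le {κ : ℝ} (hκ : 0 < κ) (w ξ : E) :
    ‖amplitude κ w ξ‖ ≤ 1 + κ * ‖w‖ * ‖ξ‖ ^ (κ - 1) := by
  unfold amplitude
  rw [norm_mul, norm_mul, norm_cexp_I_inner, one_mul, Complex.norm_real,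
    Real.norm_of_nonneg (Real.exp_nonneg _)]
  have h1 : Real.exp (-(‖ξ‖ ^ κ * (‖w‖ ^ 2 / 2))) ≤ 1 :=
    Real.exp_le_one_iff.2 (neg_nonpos.2 (by positivity))
  have h2 : |κ / 2 * (⟪ξ, w⟫ * ‖ξ‖ ^ (κ - 2))| ≤ κ * ‖w‖ * ‖ξ‖ ^ (κ - 1) := by
    rcases eq_or_ne ξ 0 with rfl | hξ
    · simp only [inner_zero_left, zero_mul, mul_zero, abs_zero]
      positivity
    have h3 : ‖ξ‖ ^ (κ - 1) = ‖ξ‖ * ‖ξ‖ ^ (κ - 2) := by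
      rw [show κ - 1 = κ - 2 + 1 by ring, Real.rpow_add_one (norm_ne_zero_iff.2 hξ), mul_comm]
    rw [abs_mul, abs_mul, abs_of_pos (half_pos hκ),
      abs_of_nonneg (by positivity : (0 : ℝ) ≤ ‖ξ‖ ^ (κ - 2)), h3]
    have := abs_real_inner_le_norm ξ w
    calc _ ≤ κ / 2 * (‖ξ‖ * ‖w‖ * ‖ξ‖ ^ (κ - 2)) := by gcongr
      _ ≤ κ * (‖ξ‖ * ‖w‖ * ‖ξ‖ ^ (κ - 2)) := by
        gcongr
        linarith
      _ = _ := by ring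
  calc _ ≤ 1 * ‖1 + Complex.I * (κ / 2 * (⟪ξ, w⟫ * ‖ξ‖ ^ (κ - 2)) : ℝ)‖ := by gcongr
    _ ≤ 1 * (‖(1 : ℂ)‖ + ‖Complex.I * (κ / 2 * (⟪ξ, w⟫ * ‖ξ‖ ^ (κ - 2)) : ℝ)‖) := by
        gcongr
        exact norm_add_le _ _
    _ ≤ _ := by
        rw [norm_mul, Complex.norm_I, Complex.norm_real, norm_one, one_mul, one_mul,
          Real.norm_eq_abs]
        gcongr

/-- The oscillatory factor `e^{i⟨ξ,w⟩} (e^{-a (δ + |ξ|²)^{κ/2}} - 1)`, smooth in `ξ` for `δ > 0`. -/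
def phaseDefect (κ a δ : ℝ) (w ξ : E) : ℂ :=
  Complex.exp (Complex.I * (⟪ξ, w⟫ : ℝ)) *
    (Real.exp (-(a * (δ + ‖ξ‖ ^ 2) ^ (κ / 2))) - 1 : ℝ)

/-- The derivative of `phaseDefect κ a δ w` in the direction `w`. -/
def phaseDefectDeriv (κ a δ : ℝ) (w ξ : E) : ℂ :=
  Complex.exp (Complex.I * (⟪ξ, w⟫ : ℝ)) *
    (Complex.I * (‖w‖ ^ 2 * (Real.exp (-(a * (δ + ‖ξ‖ ^ 2) ^ (κ / 2))) - 1) : ℝ) -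
      (Real.exp (-(a * (δ + ‖ξ‖ ^ 2) ^ (κ / 2))) *
        (a * (κ * (⟪ξ, w⟫ * (δ + ‖ξ‖ ^ 2) ^ ((κ - 2) / 2)))) : ℝ))

theorem hasDerivAt_norm_sq_line (ξ w : E) :
    HasDerivAt (fun t : ℝ => ‖ξ + t • w‖ ^ 2) (2 * ⟪ξ, w⟫) 0 := by
  have h : HasDerivAt (fun t : ℝ => ξ + t • w) w 0 := by
    simpa using ((hasDerivAt_id (0 : ℝ)).smul_const w).const_add ξ
  simpa using h.norm_sq

theorem hasLineDerivAt_phaseDefect (κ a : ℝ) {δ : ℝ} (hδ : 0 < δ) (w ξ : E) :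
    HasLineDerivAt ℝ (phaseDefect κ a δ w) (phaseDefectDeriv κ a δ w ξ) ξ w := by
  have h1 := hasDerivAt_norm_sq_line ξ w
  have h2 : HasDerivAt (fun t : ℝ => (⟪ξ + t • w, w⟫ : ℝ)) (‖w‖ ^ 2) 0 := by
    simp only [inner_add_left, inner_smul_left, real_inner_self_eq_norm_sq]
    simpa using ((hasDerivAt_id (0 : ℝ)).mul_const (‖w‖ ^ 2)).const_add ⟪ξ, w⟫
  have h3 := (((h1.const_add δ).rpow_const (p := κ / 2)
    (Or.inl (by positivity))).const_mul a).neg.exp.sub_const 1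
  have h4 := (h2.ofReal_comp.const_mul Complex.I).cexp
  refine (h4.mul h3.ofReal_comp).congr_deriv ?_
  simp only [phaseDefectDeriv, zero_smul, add_zero, Pi.neg_apply,
    show κ / 2 - 1 = (κ - 2) / 2 by ring]
  push_cast
  ring

theorem abs_exp_neg_sub_one_le {x : ℝ} (hx : 0 ≤ x) : |Real.exp (-x) - 1| ≤ 1 := by
  have h1 := Real.exp_pos (-x)
  have h2 : Real.exp (-x) ≤ 1 := Real.exp_le_one_iff.2 (by linarith)
  rw [abs_le]
  constructor <;> linarith

theorem norm_phaseDefect_le (κ : ℝ) {a δ : ℝ} (ha : 0 ≤ a) (hδ : 0 ≤ δ) (w ξ : E) :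
    ‖phaseDefect κ a δ w ξ‖ ≤ 1 := by
  rw [phaseDefect, norm_mul, norm_cexp_I_inner, one_mul, Complex.norm_real, Real.norm_eq_abs]
  exact abs_exp_neg_sub_one_le (by positivity)

theorem norm_phaseDefectDeriv_le {κ a δ : ℝ} (hκ0 : 0 < κ) (hκ1 : κ ≤ 1) (ha : 0 ≤ a) (hδ : 0 ≤ δ)
    (w : E) {ξ : E} (hξ : ξ ≠ 0) :
    ‖phaseDefectDeriv κ a δ w ξ‖ ≤ ‖w‖ ^ 2 + a * κ * ‖w‖ * ‖ξ‖ ^ (κ - 1) := by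
  have hξ' : 0 < ‖ξ‖ := norm_pos_iff.2 hξ
  rw [phaseDefectDeriv, norm_mul, norm_cexp_I_inner, one_mul]
  refine (norm_sub_le _ _).trans ?_
  rw [norm_mul, Complex.norm_I, one_mul, Complex.norm_real, Complex.norm_real, Real.norm_eq_abs,
    Real.norm_eq_abs, abs_mul, abs_mul, abs_of_nonneg (sq_nonneg ‖w‖), Real.abs_exp]
  have h1 : |Real.exp (-(a * (δ + ‖ξ‖ ^ 2) ^ (κ / 2))) - 1| ≤ 1 :=
    abs_exp_neg_sub_one_le (by positivity)
  have h2 : Real.exp (-(a * (δ + ‖ξ‖ ^ 2) ^ (κ / 2))) ≤ 1 :=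
    Real.exp_le_one_iff.2 (neg_nonpos.2 (by positivity))
  have h3 : (δ + ‖ξ‖ ^ 2) ^ ((κ - 2) / 2) ≤ ‖ξ‖ ^ (κ - 2) := by
    rw [norm_rpow_eq_sq_rpow]
    exact Real.rpow_le_rpow_of_nonpos (by positivity) (by linarith) (by linarith)
  have h4 : |a * (κ * (⟪ξ, w⟫ * (δ + ‖ξ‖ ^ 2) ^ ((κ - 2) / 2)))| ≤
      a * κ * ‖w‖ * ‖ξ‖ ^ (κ - 1) := by
    rw [abs_mul, abs_mul, abs_mul, abs_of_nonneg ha, abs_of_pos hκ0,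
      abs_of_nonneg (by positivity : (0 : ℝ) ≤ (δ + ‖ξ‖ ^ 2) ^ ((κ - 2) / 2)),
      show κ - 1 = κ - 2 + 1 by ring, Real.rpow_add_one hξ'.ne']
    calc _ ≤ a * (κ * (‖ξ‖ * ‖w‖ * ‖ξ‖ ^ (κ - 2))) := by
          gcongr
          exact abs_real_inner_le_norm ξ w
      _ = _ := by ring
  calc _ ≤ ‖w‖ ^ 2 * 1 + 1 * (a * κ * ‖w‖ * ‖ξ‖ ^ (κ - 1)) := by gcongr
    _ = _ := by ring

/-- The amplitude `e^{i⟨ξ,w⟩} (1 + 2iε |ξ|^{κ/2} ⟨ξ, g(|ξ|^{κ/2} w)⟩)`, with `g` the error symbol.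
It has the same integral against `e^{-ε|ξ|²}` as `amplitude`, and it is bounded in `w`. -/
def boundedAmplitude (κ ε : ℝ) (w ξ : E) : ℂ :=
  Complex.exp (Complex.I * (⟪ξ, w⟫ : ℝ)) *
    (1 + 2 * ε * Complex.I * ((‖ξ‖ ^ (κ / 2) : ℝ) * (⟪ξ, errorSymbol (‖ξ‖ ^ (κ / 2) • w)⟫ : ℝ)))

theorem phaseDefectDeriv_zero {κ : ℝ} (w ξ : E) :
    phaseDefectDeriv κ (‖w‖ ^ 2 / 2) 0 w ξ = Complex.I * ‖w‖ ^ 2 *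
      (amplitude κ w ξ - Complex.exp (Complex.I * (⟪ξ, w⟫ : ℝ))) := by
  unfold phaseDefectDeriv amplitude
  rw [← norm_rpow_eq_sq_rpow, ← norm_rpow_eq_sq_rpow, mul_comm (‖ξ‖ ^ κ)]
  push_cast
  linear_combination (-(Complex.exp (Complex.I * (⟪ξ, w⟫ : ℝ)) *
    Complex.exp (-(‖w‖ ^ 2 / 2 * (‖ξ‖ ^ κ : ℝ))) * (κ / 2) * ⟪ξ, w⟫ *
    (‖ξ‖ ^ (κ - 2) : ℝ) * ‖w‖ ^ 2)) * Complex.I_sq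

theorem inner_smul_phaseDefect_zero {κ : ℝ} {w : E} (hw : w ≠ 0) (ξ : E) :
    (⟪ξ, w⟫ : ℂ) * phaseDefect κ (‖w‖ ^ 2 / 2) 0 w ξ = -(‖w‖ ^ 2 : ℝ) *
      (Complex.exp (Complex.I * (⟪ξ, w⟫ : ℝ)) *
        ((‖ξ‖ ^ (κ / 2) : ℝ) * (⟪ξ, errorSymbol (‖ξ‖ ^ (κ / 2) • w)⟫ : ℝ))) := by
  rcases eq_or_ne ξ 0 with rfl | hξ
  · simp
  have h1 : ‖ξ‖ ^ κ = (‖ξ‖ ^ (κ / 2)) ^ 2 := by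
    rw [← Real.rpow_mul_natCast (norm_nonneg _)]
    congr 1
    push_cast
    ring
  have h2 : (0 : ℝ) < ‖ξ‖ ^ (κ / 2) := Real.rpow_pos_of_pos (norm_pos_iff.2 hξ) _
  have h3 : ‖w‖ ≠ 0 := norm_ne_zero_iff.2 hw
  have h4 : ⟪ξ, w⟫ * (Real.exp (-(‖w‖ ^ 2 / 2 * ‖ξ‖ ^ κ)) - 1) =
      -(‖w‖ ^ 2) * (‖ξ‖ ^ (κ / 2) * ⟪ξ, errorSymbol (‖ξ‖ ^ (κ / 2) • w)⟫) := by
    rw [errorSymbol, norm_smul, Real.norm_of_nonneg h2.le, inner_smul_right, inner_smul_right, h1,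
      show ((‖ξ‖ ^ (κ / 2) * ‖w‖) ^ 2 / 2) = ‖w‖ ^ 2 / 2 * (‖ξ‖ ^ (κ / 2)) ^ 2 by ring]
    field_simp
    ring
  unfold phaseDefect
  rw [← norm_rpow_eq_sq_rpow]
  have h5 := congrArg (fun r : ℝ => (r : ℂ)) h4
  simp only [Complex.ofReal_mul] at h5 ⊢
  rw [Complex.ofReal_neg] at h5
  linear_combination (Complex.exp (Complex.I * (⟪ξ, w⟫ : ℝ))) * h5

theorem gaussian_smul_phaseDefect_bounds {κ a ε : ℝ} (hκ0 : 0 < κ) (hκ1 : κ ≤ 1) (ha : 0 ≤ a)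
    (w : E) :
    (∀ δ, 0 ≤ δ → ∀ ξ : E, ‖Real.exp (-ε * ‖ξ‖ ^ 2) • phaseDefect κ a δ w ξ‖ ≤
      1 * (Real.exp (-ε * ‖ξ‖ ^ 2) * ((1 + ‖ξ‖) ^ 1 * (1 + ‖ξ‖ ^ (κ - 1))))) ∧
    (∀ δ, 0 ≤ δ → ∀ ξ : E, ‖(-ε * (2 * ⟪ξ, w⟫) * Real.exp (-ε * ‖ξ‖ ^ 2)) • phaseDefect κ a δ w ξ‖ ≤
      |2 * ε * ‖w‖| * (Real.exp (-ε * ‖ξ‖ ^ 2) * ((1 + ‖ξ‖) ^ 1 * (1 + ‖ξ‖ ^ (κ - 1))))) ∧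
    (∀ δ, 0 ≤ δ → ∀ ξ : E, ξ ≠ 0 → ‖Real.exp (-ε * ‖ξ‖ ^ 2) • phaseDefectDeriv κ a δ w ξ‖ ≤
      (‖w‖ ^ 2 + a * κ * ‖w‖) *
        (Real.exp (-ε * ‖ξ‖ ^ 2) * ((1 + ‖ξ‖) ^ 1 * (1 + ‖ξ‖ ^ (κ - 1))))) := by
  have h0 : ∀ ξ : E, 1 ≤ (1 + ‖ξ‖) ^ 1 * (1 + ‖ξ‖ ^ (κ - 1)) := fun ξ => by
    have h1 : 0 ≤ ‖ξ‖ := norm_nonneg ξ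
    have h2 : 0 ≤ ‖ξ‖ ^ (κ - 1) := by positivity
    nlinarith [mul_nonneg h1 h2]
  have h0' : ∀ ξ : E, ‖ξ‖ ≤ (1 + ‖ξ‖) ^ 1 * (1 + ‖ξ‖ ^ (κ - 1)) := fun ξ => by
    have h1 : 0 ≤ ‖ξ‖ := norm_nonneg ξ
    have h2 : 0 ≤ ‖ξ‖ ^ (κ - 1) := by positivity
    nlinarith [mul_nonneg h1 h2]
  have h0'' : ∀ ξ : E, ‖ξ‖ ^ (κ - 1) ≤ (1 + ‖ξ‖) ^ 1 * (1 + ‖ξ‖ ^ (κ - 1)) := fun ξ => by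
    have h1 : 0 ≤ ‖ξ‖ := norm_nonneg ξ
    have h2 : 0 ≤ ‖ξ‖ ^ (κ - 1) := by positivity
    nlinarith [mul_nonneg h1 h2]
  refine ⟨fun δ hδ ξ => ?_, fun δ hδ ξ => ?_, fun δ hδ ξ hξ => ?_⟩
  · rw [norm_smul, Real.norm_of_nonneg (Real.exp_nonneg _), one_mul]
    have := norm_phaseDefect_le κ ha hδ w ξ
    gcongr
    exact this.trans (h0 ξ)
  · rw [norm_smul, norm_mul, Real.norm_of_nonneg (Real.exp_nonneg _), Real.norm_eq_abs]
    have := norm_phaseDefect_le κ ha hδ w ξ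
    have h3 : |-ε * (2 * ⟪ξ, w⟫)| ≤ |2 * ε * ‖w‖| * ‖ξ‖ := by
      have := abs_real_inner_le_norm ξ w
      rw [abs_mul, abs_mul, abs_mul, abs_mul, abs_neg, abs_norm, abs_two]
      calc _ ≤ |ε| * (2 * (‖ξ‖ * ‖w‖)) := by gcongr
        _ = _ := by ring
    calc _ ≤ |2 * ε * ‖w‖| * ‖ξ‖ * Real.exp (-ε * ‖ξ‖ ^ 2) * 1 := by gcongr
      _ = |2 * ε * ‖w‖| * (Real.exp (-ε * ‖ξ‖ ^ 2) * ‖ξ‖) := by ring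
      _ ≤ _ := by
        gcongr
        exact h0' ξ
  · rw [norm_smul, Real.norm_of_nonneg (Real.exp_nonneg _)]
    have h4 := norm_phaseDefectDeriv_le hκ0 hκ1 ha hδ w hξ
    calc _ ≤ Real.exp (-ε * ‖ξ‖ ^ 2) * (‖w‖ ^ 2 + a * κ * ‖w‖ * ‖ξ‖ ^ (κ - 1)) := by gcongr
      _ ≤ Real.exp (-ε * ‖ξ‖ ^ 2) * (‖w‖ ^ 2 * ((1 + ‖ξ‖) ^ 1 * (1 + ‖ξ‖ ^ (κ - 1))) +
          a * κ * ‖w‖ * ((1 + ‖ξ‖) ^ 1 * (1 + ‖ξ‖ ^ (κ - 1)))) := by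
        have := h0 ξ
        have := h0'' ξ
        gcongr
        exact le_mul_of_one_le_right (by positivity) (h0 ξ)
      _ = _ := by ring

theorem tendsto_phaseDefect {κ a : ℝ} (w : E) {ξ : E} (hξ : ξ ≠ 0) :
    Tendsto (fun δ => phaseDefect κ a δ w ξ) (𝓝[>] 0) (𝓝 (phaseDefect κ a 0 w ξ)) ∧
    Tendsto (fun δ => phaseDefectDeriv κ a δ w ξ) (𝓝[>] 0) (𝓝 (phaseDefectDeriv κ a 0 w ξ)) := by
  have h : ∀ s : ℝ, ContinuousAt (fun δ : ℝ => (δ + ‖ξ‖ ^ 2) ^ s) 0 := fun s =>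
    (continuousAt_id.add continuousAt_const).rpow_const
      (Or.inl (by simpa using hξ))
  have h1 := h (κ / 2)
  have h2 := h ((κ - 2) / 2)
  have h3 : ContinuousAt (fun δ => phaseDefect κ a δ w ξ) 0 := by
    unfold phaseDefect
    fun_prop
  have h4 : ContinuousAt (fun δ => phaseDefectDeriv κ a δ w ξ) 0 := by
    unfold phaseDefectDeriv
    fun_prop
  exact ⟨h3.tendsto.mono_left nhdsWithin_le_nhds, h4.tendsto.mono_left nhdsWithin_le_nhds⟩

variable [FiniteDimensional ℝ E] [MeasurableSpace E] [BorelSpace E]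

theorem measurable_phaseDefect (κ a δ : ℝ) (w : E) : Measurable (phaseDefect κ a δ w) := by
  unfold phaseDefect
  fun_prop

theorem measurable_phaseDefectDeriv (κ a δ : ℝ) (w : E) :
    Measurable (phaseDefectDeriv κ a δ w) := by
  unfold phaseDefectDeriv
  fun_prop

variable [Nontrivial E]

/-- Integration by parts in `ξ`, for `δ > 0`; see `integral_gaussian_phaseDefectDeriv` for
`δ = 0`. -/
theorem integral_gaussian_phaseDefectDeriv_of_pos {κ a ε δ : ℝ} (hκ0 : 0 < κ) (hκ1 : κ ≤ 1)
    (ha : 0 ≤ a) (hε : 0 < ε) (hδ : 0 < δ) (w : E) :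
    ∫ ξ : E, Real.exp (-ε * ‖ξ‖ ^ 2) • phaseDefectDeriv κ a δ w ξ =
      -∫ ξ : E, (-ε * (2 * ⟪ξ, w⟫) * Real.exp (-ε * ‖ξ‖ ^ 2)) • phaseDefect κ a δ w ξ := by
  obtain ⟨b1, b2, b3⟩ := gaussian_smul_phaseDefect_bounds (ε := ε) hκ0 hκ1 ha w
  have hi := integrable_gaussian_mul_growth (E := E) (μ := volume) hε 1
    (neg_finrank_lt (s := κ - 1) (by linarith))
  refine integral_bilinear_hasLineDerivAt_right_eq_neg_left_of_integrable
    (B := ContinuousLinearMap.lsmul ℝ ℝ) (v := w) (f := fun ξ : E => Real.exp (-ε * ‖ξ‖ ^ 2))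
    (f' := fun ξ : E => -ε * (2 * ⟪ξ, w⟫) * Real.exp (-ε * ‖ξ‖ ^ 2))
    (g := phaseDefect κ a δ w) (g' := phaseDefectDeriv κ a δ w) ?_ ?_ ?_ ?_ ?_
  · exact (hi.const_mul _).mono' ((by fun_prop : Measurable fun ξ : E => -ε * (2 * ⟪ξ, w⟫) *
      Real.exp (-ε * ‖ξ‖ ^ 2)).smul (measurable_phaseDefect κ a δ w)).aestronglyMeasurable
      (.of_forall (b2 δ hδ.le))
  · exact (hi.const_mul _).mono' ((by fun_prop : Measurable fun ξ : E =>
      Real.exp (-ε * ‖ξ‖ ^ 2)).smul (measurable_phaseDefectDeriv κ a δ w)).aestronglyMeasurable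
      (ae_ne_zero.mono (b3 δ hδ.le))
  · exact (hi.const_mul _).mono' ((by fun_prop : Measurable fun ξ : E =>
      Real.exp (-ε * ‖ξ‖ ^ 2)).smul (measurable_phaseDefect κ a δ w)).aestronglyMeasurable
      (.of_forall (b1 δ hδ.le))
  · intro ξ _
    refine ((hasDerivAt_norm_sq_line ξ w).const_mul (-ε)).exp.congr_deriv ?_
    simp only [zero_smul, add_zero]
    ring
  · exact fun ξ _ => hasLineDerivAt_phaseDefect κ a hδ w ξ

/-- The integration by parts, which is singular at `ξ = 0`: the singularity is removed by replacing
`|ξ|^κ` with `(δ + |ξ|²)^{κ/2}`, and `δ → 0`. -/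
theorem integral_gaussian_phaseDefectDeriv {κ a ε : ℝ} (hκ0 : 0 < κ) (hκ1 : κ ≤ 1)
    (ha : 0 ≤ a) (hε : 0 < ε) (w : E) :
    ∫ ξ : E, Real.exp (-ε * ‖ξ‖ ^ 2) • phaseDefectDeriv κ a 0 w ξ =
      -∫ ξ : E, (-ε * (2 * ⟪ξ, w⟫) * Real.exp (-ε * ‖ξ‖ ^ 2)) • phaseDefect κ a 0 w ξ := by
  obtain ⟨b1, b2, b3⟩ := gaussian_smul_phaseDefect_bounds (ε := ε) hκ0 hκ1 ha w
  have hi := integrable_gaussian_mul_growth (E := E) (μ := volume) hε 1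
    (neg_finrank_lt (s := κ - 1) (by linarith))
  have t1 : Tendsto (fun δ => ∫ ξ : E, Real.exp (-ε * ‖ξ‖ ^ 2) • phaseDefectDeriv κ a δ w ξ)
      (𝓝[>] 0) (𝓝 (∫ ξ : E, Real.exp (-ε * ‖ξ‖ ^ 2) • phaseDefectDeriv κ a 0 w ξ)) := by
    refine tendsto_integral_filter_of_dominated_convergence _ (.of_forall fun δ => ?_) ?_
      (hi.const_mul (‖w‖ ^ 2 + a * κ * ‖w‖)) ?_
    · exact ((by fun_prop : Measurable fun ξ : E =>
        Real.exp (-ε * ‖ξ‖ ^ 2)).smul (measurable_phaseDefectDeriv κ a δ w)).aestronglyMeasurable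
    · filter_upwards [self_mem_nhdsWithin] with δ hδ
      exact ae_ne_zero.mono (b3 δ (le_of_lt hδ))
    · exact ae_ne_zero.mono fun ξ hξ => (tendsto_phaseDefect w hξ).2.const_smul _
  have t2 : Tendsto (fun δ => -∫ ξ : E, (-ε * (2 * ⟪ξ, w⟫) * Real.exp (-ε * ‖ξ‖ ^ 2)) •
      phaseDefect κ a δ w ξ) (𝓝[>] 0) (𝓝 (-∫ ξ : E, (-ε * (2 * ⟪ξ, w⟫) *
        Real.exp (-ε * ‖ξ‖ ^ 2)) • phaseDefect κ a 0 w ξ)) := by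
    refine (tendsto_integral_filter_of_dominated_convergence _ (.of_forall fun δ => ?_) ?_
      (hi.const_mul |2 * ε * ‖w‖|) ?_).neg
    · exact ((by fun_prop : Measurable fun ξ : E => -ε * (2 * ⟪ξ, w⟫) *
        Real.exp (-ε * ‖ξ‖ ^ 2)).smul (measurable_phaseDefect κ a δ w)).aestronglyMeasurable
    · filter_upwards [self_mem_nhdsWithin] with δ hδ
      exact .of_forall (b2 δ (le_of_lt hδ))
    · exact ae_ne_zero.mono fun ξ hξ => (tendsto_phaseDefect w hξ).1.const_smul _
  refine tendsto_nhds_unique t1 (t2.congr' ?_)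
  filter_upwards [self_mem_nhdsWithin] with δ hδ
  exact (integral_gaussian_phaseDefectDeriv_of_pos hκ0 hκ1 ha hε hδ w).symm

theorem integrable_gaussian_smul_amplitude {κ ε : ℝ} (hκ0 : 0 < κ) (hε : 0 < ε) (w : E) :
    Integrable fun ξ : E => Real.exp (-ε * ‖ξ‖ ^ 2) • amplitude κ w ξ := by
  have hi := integrable_gaussian_mul_growth (E := E) (μ := volume) hε 0
    (neg_finrank_lt (s := κ - 1) (by linarith))
  refine (hi.const_mul (1 + κ * ‖w‖)).mono' ?_ (.of_forall fun ξ => ?_)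
  · have : Measurable (amplitude κ w) := by
      unfold amplitude
      fun_prop
    exact ((by fun_prop : Measurable fun ξ : E => Real.exp (-ε * ‖ξ‖ ^ 2)).smul
      this).aestronglyMeasurable
  · rw [norm_smul, Real.norm_of_nonneg (Real.exp_nonneg _), pow_zero, one_mul]
    calc _ ≤ Real.exp (-ε * ‖ξ‖ ^ 2) * (1 + κ * ‖w‖ * ‖ξ‖ ^ (κ - 1)) := by
          gcongr
          exact norm_amplitude_le hκ0 w ξ
      _ ≤ Real.exp (-ε * ‖ξ‖ ^ 2) * ((1 + κ * ‖w‖) * (1 + ‖ξ‖ ^ (κ - 1))) := by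
          have : 0 ≤ ‖ξ‖ ^ (κ - 1) := by positivity
          have : 0 ≤ κ * ‖w‖ := by positivity
          gcongr
          nlinarith
      _ = _ := by ring

theorem integrable_gaussian_smul_cexp {ε : ℝ} (hε : 0 < ε) (w : E) :
    Integrable fun ξ : E => Real.exp (-ε * ‖ξ‖ ^ 2) •
      Complex.exp (Complex.I * (⟪ξ, w⟫ : ℝ)) := by
  have hi := integrable_gaussian_mul_rpow (E := E) (μ := volume) hε
    (neg_finrank_lt (s := 0) (by norm_num))
  refine hi.mono' (by fun_prop) (.of_forall fun ξ => ?_)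
  rw [norm_smul, norm_cexp_I_inner, Real.norm_of_nonneg (Real.exp_nonneg _), Real.rpow_zero]

/-- Up to a factor `i|w|²`, the difference of `amplitude` and `e^{i⟨ξ,w⟩}` is a derivative in `ξ`.
The integration by parts gains the factor `ε`, and the division by `|w|²` leaves the error
symbol. -/
theorem integral_gaussian_amplitude {κ ε : ℝ} (hκ0 : 0 < κ) (hκ1 : κ ≤ 1) (hε : 0 < ε) (w : E) :
    ∫ ξ : E, Real.exp (-ε * ‖ξ‖ ^ 2) • amplitude κ w ξ =
      ∫ ξ : E, Real.exp (-ε * ‖ξ‖ ^ 2) • boundedAmplitude κ ε w ξ := by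
  rcases eq_or_ne w 0 with rfl | hw
  · simp [amplitude, boundedAmplitude, errorSymbol]
  have hw' : (Complex.I * ‖w‖ ^ 2 : ℂ) ≠ 0 :=
    mul_ne_zero Complex.I_ne_zero (pow_ne_zero _ (by simpa using hw))
  have h1 := integral_gaussian_phaseDefectDeriv hκ0 hκ1 (a := ‖w‖ ^ 2 / 2) (by positivity) hε w
  simp only [phaseDefectDeriv_zero] at h1
  have hA := integrable_gaussian_smul_amplitude hκ0 hε w
  have hE := integrable_gaussian_smul_cexp hε w
  have h2 : ∀ ξ : E, Real.exp (-ε * ‖ξ‖ ^ 2) • boundedAmplitude κ ε w ξ =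
      Real.exp (-ε * ‖ξ‖ ^ 2) • Complex.exp (Complex.I * (⟪ξ, w⟫ : ℝ)) +
      (Complex.I * ‖w‖ ^ 2)⁻¹ * -((-ε * (2 * ⟪ξ, w⟫) * Real.exp (-ε * ‖ξ‖ ^ 2)) •
        phaseDefect κ (‖w‖ ^ 2 / 2) 0 w ξ) := by
    intro ξ
    have h3 := inner_smul_phaseDefect_zero (κ := κ) hw ξ
    have h4 : (-ε * (2 * ⟪ξ, w⟫) * Real.exp (-ε * ‖ξ‖ ^ 2)) •
        phaseDefect κ (‖w‖ ^ 2 / 2) 0 w ξ = (-ε * 2 * (Real.exp (-ε * ‖ξ‖ ^ 2) : ℝ) : ℂ) *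
          ((⟪ξ, w⟫ : ℂ) * phaseDefect κ (‖w‖ ^ 2 / 2) 0 w ξ) := by
      rw [Complex.real_smul]
      push_cast
      ring
    rw [h4, h3, boundedAmplitude, Complex.real_smul, Complex.real_smul]
    have : (‖w‖ : ℂ) ≠ 0 := by simpa using hw
    rw [mul_inv, Complex.inv_I]
    push_cast
    field_simp
  have h5 : Integrable fun ξ : E => (Complex.I * ‖w‖ ^ 2)⁻¹ *
      -((-ε * (2 * ⟪ξ, w⟫) * Real.exp (-ε * ‖ξ‖ ^ 2)) • phaseDefect κ (‖w‖ ^ 2 / 2) 0 w ξ) := by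
    obtain ⟨b1, b2, b3⟩ := gaussian_smul_phaseDefect_bounds (ε := ε) hκ0 hκ1
      (a := ‖w‖ ^ 2 / 2) (by positivity) w
    have hi := integrable_gaussian_mul_growth (E := E) (μ := volume) hε 1
      (neg_finrank_lt (s := κ - 1) (by linarith))
    exact (Integrable.neg ((hi.const_mul _).mono' ((by fun_prop : Measurable fun ξ : E =>
      -ε * (2 * ⟪ξ, w⟫) * Real.exp (-ε * ‖ξ‖ ^ 2)).smul
        (measurable_phaseDefect κ _ 0 w)).aestronglyMeasurable
      (.of_forall (b2 0 le_rfl)))).const_mul _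
  rw [integral_congr_ae (.of_forall h2), integral_add hE h5, integral_const_mul, integral_neg, ← h1]
  have h6 : ∀ ξ : E, Real.exp (-ε * ‖ξ‖ ^ 2) • (Complex.I * ‖w‖ ^ 2 *
      (amplitude κ w ξ - Complex.exp (Complex.I * (⟪ξ, w⟫ : ℝ)))) = (Complex.I * ‖w‖ ^ 2) *
      (Real.exp (-ε * ‖ξ‖ ^ 2) • amplitude κ w ξ -
        Real.exp (-ε * ‖ξ‖ ^ 2) • Complex.exp (Complex.I * (⟪ξ, w⟫ : ℝ))) := by
    intro ξ
    simp only [Complex.real_smul]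
    ring
  rw [integral_congr_ae (.of_forall h6), integral_const_mul, inv_mul_cancel_left₀ hw',
    integral_sub hA hE, add_sub_cancel]

end Kernel

/-! ### The reproducing kernel is an approximate identity -/

section ApproximateIdentity

open scoped RealInnerProductSpace FourierTransform

universe u

variable {E : Type u} [NormedAddCommGroup E] [InnerProductSpace ℝ E] [FiniteDimensional ℝ E]

theorem norm_rpow_half_le {E : Type*} [NormedAddCommGroup E] {κ : ℝ} (hκ0 : 0 < κ) (hκ1 : κ ≤ 1)
    (ξ : E) :
    1 + ‖ξ‖ ^ (κ / 2) ≤ 2 * (1 + ‖ξ‖) ^ (1 / 2 : ℝ) := by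
  have h1 : ‖ξ‖ ^ (κ / 2) ≤ (1 + ‖ξ‖) ^ (1 / 2 : ℝ) :=
    calc ‖ξ‖ ^ (κ / 2) ≤ (1 + ‖ξ‖) ^ (κ / 2) := by
          have := norm_nonneg ξ
          gcongr
          linarith
      _ ≤ (1 + ‖ξ‖) ^ (1 / 2 : ℝ) :=
          Real.rpow_le_rpow_of_exponent_le (by linarith [norm_nonneg ξ]) (by linarith)
  have h2 : 1 ≤ (1 + ‖ξ‖) ^ (1 / 2 : ℝ) :=
    Real.one_le_rpow (by linarith [norm_nonneg ξ]) (by norm_num)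
  linarith

theorem rpow_half_sq {E : Type*} [NormedAddCommGroup E] (ξ : E) :
    ((1 + ‖ξ‖) ^ (1 / 2 : ℝ)) ^ 2 = 1 + ‖ξ‖ := by
  rw [← Real.rpow_mul_natCast (by positivity)]
  norm_num

theorem norm_rpow_half_le_one_add {E : Type*} [NormedAddCommGroup E] {κ : ℝ} (hκ0 : 0 < κ)
    (hκ1 : κ ≤ 1) (ξ : E) :
    ‖ξ‖ ^ (κ / 2) ≤ 1 + ‖ξ‖ := by
  have h1 := norm_nonneg ξ
  calc ‖ξ‖ ^ (κ / 2) ≤ (1 + ‖ξ‖) ^ (κ / 2) := by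
        gcongr
        linarith
    _ ≤ (1 + ‖ξ‖) ^ (1 : ℝ) :=
        Real.rpow_le_rpow_of_exponent_le (by linarith) (by linarith)
    _ = _ := Real.rpow_one _

theorem continuous_boundedAmplitude {κ : ℝ} (hκ0 : 0 < κ) (ε : ℝ) :
    Continuous fun p : E × E => boundedAmplitude κ ε p.2 p.1 := by
  have h1 : Continuous (errorSymbol : E → E) := contDiff_errorSymbol_and_bound.1.continuous
  have h2 : Continuous fun p : E × E => ‖p.1‖ ^ (κ / 2) :=
    continuous_fst.norm.rpow_const fun _ => Or.inr (by linarith)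
  have h3 : Continuous fun p : E × E => errorSymbol (‖p.1‖ ^ (κ / 2) • p.2) :=
    h1.comp (h2.smul continuous_snd)
  unfold boundedAmplitude
  fun_prop

theorem exists_norm_boundedAmplitude_le {κ : ℝ} (hκ0 : 0 < κ) (hκ1 : κ ≤ 1) :
    ∃ C, 0 ≤ C ∧ ∀ ε, 0 < ε → ∀ w ξ : E,
      ‖boundedAmplitude κ ε w ξ‖ ≤ (1 + ε * C) * (1 + ‖ξ‖) ^ 2 := by
  obtain ⟨C, hC, h⟩ := contDiff_errorSymbol_and_bound (E := E).2 0
  refine ⟨2 * C, by positivity, fun ε hε w ξ => ?_⟩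
  rw [boundedAmplitude, norm_mul, norm_cexp_I_inner, one_mul]
  have h1 := norm_nonneg ξ
  have h2 : ‖errorSymbol (‖ξ‖ ^ (κ / 2) • w)‖ ≤ C := by
    have := h (‖ξ‖ ^ (κ / 2) • w)
    rwa [norm_iteratedFDeriv_zero] at this
  have h3 := norm_rpow_half_le_one_add hκ0 hκ1 ξ
  calc _ ≤ ‖(1 : ℂ)‖ + ‖2 * ε * Complex.I * ((‖ξ‖ ^ (κ / 2) : ℝ) *
        (⟪ξ, errorSymbol (‖ξ‖ ^ (κ / 2) • w)⟫ : ℝ))‖ := norm_add_le _ _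
    _ = 1 + 2 * ε * (‖ξ‖ ^ (κ / 2) * |⟪ξ, errorSymbol (‖ξ‖ ^ (κ / 2) • w)⟫|) := by
        simp [abs_of_pos hε, abs_of_nonneg (Real.rpow_nonneg h1 (κ / 2))]
    _ ≤ 1 + 2 * ε * ((1 + ‖ξ‖) * (‖ξ‖ * C)) := by
        gcongr
        exact (abs_real_inner_le_norm _ _).trans (by gcongr)
    _ ≤ _ := by
        have : 0 ≤ ε * C := by positivity
        nlinarith [mul_nonneg this h1, mul_nonneg this (sq_nonneg ‖ξ‖)]

variable [MeasurableSpace E] [BorelSpace E] {F : Type*} [NormedAddCommGroup F] [NormedSpace ℂ F]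

/-- The kernel `G_ε(w) = (2π)^{-m} ∫ e^{-ε|ξ|²} amplitude(w, ξ) dξ`. -/
def reproducingKernel (κ ε : ℝ) (w : E) : ℂ :=
  (((2 * Real.pi) ^ Module.finrank ℝ E)⁻¹ : ℝ) •
    ∫ ξ : E, Real.exp (-ε * ‖ξ‖ ^ 2) • amplitude κ w ξ

theorem integral_boundedAmplitude_smul {κ ε : ℝ} {f : E → F} (hf : Continuous f)
    (hi : Integrable f) (y ξ : E) :
    ∫ w, (Real.exp (-ε * ‖ξ‖ ^ 2) • boundedAmplitude κ ε w ξ) • f (y + w) =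
      Real.exp (-ε * ‖ξ‖ ^ 2) •
        ((∫ w, Complex.exp (Complex.I * (⟪ξ, w⟫ : ℝ)) • f (y + w)) +
        (2 * ε * Complex.I * (‖ξ‖ ^ (κ / 2) : ℝ)) • ∫ w, Complex.exp (Complex.I * (⟪ξ, w⟫ : ℝ)) •
          ((⟪ξ, errorSymbol (‖ξ‖ ^ (κ / 2) • w)⟫ : ℝ) : ℂ) • f (y + w)) := by
  have hiy := hi.comp_add_left y
  have hi1 : Integrable fun w => Complex.exp (Complex.I * (⟪ξ, w⟫ : ℝ)) • f (y + w) :=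
    hiy.norm.mono' (by fun_prop) (.of_forall fun w => by
      rw [norm_smul, norm_cexp_I_inner, one_mul])
  obtain ⟨C, hC, h⟩ := contDiff_errorSymbol_and_bound (E := E).2 0
  have hi2 : Integrable fun w => Complex.exp (Complex.I * (⟪ξ, w⟫ : ℝ)) •
          ((⟪ξ, errorSymbol (‖ξ‖ ^ (κ / 2) • w)⟫ : ℝ) : ℂ) • f (y + w) := by
    refine (hiy.norm.const_mul (‖ξ‖ * C)).mono' ?_ (.of_forall fun w => ?_)
    · have h1 : Continuous fun w : E => errorSymbol (‖ξ‖ ^ (κ / 2) • w) :=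
        contDiff_errorSymbol_and_bound.1.continuous.comp (continuous_const.smul continuous_id)
      exact (by fun_prop : Continuous fun w => Complex.exp (Complex.I * (⟪ξ, w⟫ : ℝ)) •
          ((⟪ξ, errorSymbol (‖ξ‖ ^ (κ / 2) • w)⟫ : ℝ) : ℂ) • f (y + w)).aestronglyMeasurable
    · rw [norm_smul, norm_cexp_I_inner, one_mul, norm_smul, Complex.norm_real, Real.norm_eq_abs]
      gcongr
      refine (abs_real_inner_le_norm _ _).trans ?_
      gcongr
      have := h (‖ξ‖ ^ (κ / 2) • w)
      rwa [norm_iteratedFDeriv_zero] at this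
  rw [← integral_smul, ← integral_add hi1 (g := fun w => (2 * ε * Complex.I *
    (‖ξ‖ ^ (κ / 2) : ℝ)) • Complex.exp (Complex.I * (⟪ξ, w⟫ : ℝ)) •
      ((⟪ξ, errorSymbol (‖ξ‖ ^ (κ / 2) • w)⟫ : ℝ) : ℂ) • f (y + w)) (hi2.smul _), ← integral_smul]
  refine integral_congr_ae (.of_forall fun w => ?_)
  simp only [boundedAmplitude, smul_assoc, smul_smul, ← add_smul]
  congr 2
  ring

theorem norm_one_sub_exp_le {x : ℝ} (hx : 0 ≤ x) : |Real.exp (-x) - 1| ≤ x := by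
  have h1 := Real.add_one_le_exp (-x)
  have h2 : Real.exp (-x) ≤ 1 := Real.exp_le_one_iff.2 (by linarith)
  rw [abs_le]
  constructor <;> linarith

theorem integrable_one_add_norm_inv_pow {E : Type*} [NormedAddCommGroup E] [NormedSpace ℝ E]
    [FiniteDimensional ℝ E] [MeasurableSpace E] [BorelSpace E] {μ : Measure E}
    [μ.IsAddHaarMeasure] :
    Integrable (fun ξ : E => ((1 + ‖ξ‖) ^ (Module.finrank ℝ E + 1))⁻¹) μ := by
  refine (integrable_one_add_norm (E := E) (μ := μ) (r := (Module.finrank ℝ E + 1 : ℕ))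
    (by push_cast; linarith)).congr (.of_forall fun ξ => ?_)
  simp only
  rw [Real.rpow_neg (by positivity), Real.rpow_natCast]

/-- The Fourier inversion formula, at the point `y`. -/
theorem integral_integral_cexp_smul [CompleteSpace F] {f : E → F} (hf : ContDiff ℝ ∞ f)
    (hc : HasCompactSupport f) (y : E) :
    Integrable (fun ξ : E => ∫ w, Complex.exp (Complex.I * (⟪ξ, w⟫ : ℝ)) • f (y + w)) ∧
    (((2 * Real.pi) ^ Module.finrank ℝ E)⁻¹ : ℝ) • ∫ ξ : E, ∫ w,
      Complex.exp (Complex.I * (⟪ξ, w⟫ : ℝ)) • f (y + w) = f y := by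
  let g : E → F := fun w => f (y + w)
  have hg : ContDiff ℝ ∞ g := hf.comp (contDiff_const.add contDiff_id)
  have hgc : HasCompactSupport g := hc.comp_homeomorph (Homeomorph.addLeft y)
  have hgi : Integrable g := hg.continuous.integrable_of_hasCompactSupport hgc
  have h1 : (fun ξ : E => ∫ w, Complex.exp (Complex.I * (⟪ξ, w⟫ : ℝ)) • f (y + w)) =
      fun ξ => 𝓕 g (-(2 * Real.pi)⁻¹ • ξ) :=
    funext fun ξ => integral_cexp_inner_smul_eq_fourier g ξ
  have hR : -(2 * Real.pi)⁻¹ ≠ 0 := neg_ne_zero.2 (by positivity)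
  have hi : Integrable (fun ξ => 𝓕 g (-(2 * Real.pi)⁻¹ • ξ)) := by
    obtain ⟨C, hC, h⟩ := exists_oscillatory_decay (F := F) E (Module.finrank ℝ E + 1)
    refine (integrable_one_add_norm_inv_pow.mul_const (C * ∑ j ∈ Finset.range
      (Module.finrank ℝ E + 1 + 1), ∫ w, ‖iteratedFDeriv ℝ j g w‖)).mono' ?_
      (.of_forall fun ξ => ?_)
    · have : Continuous (𝓕 g) := VectorFourier.fourierIntegral_continuous
        Real.continuous_fourierChar continuous_inner hgi
      exact (this.comp (continuous_const_smul _)).aestronglyMeasurable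
    · rw [← integral_cexp_inner_smul_eq_fourier, ← div_eq_inv_mul, le_div_iff₀' (by positivity)]
      exact h g hg hgc ξ
  rw [h1]
  refine ⟨hi, ?_⟩
  rw [Measure.integral_comp_smul, smul_smul]
  have h2 := hgi.fourierInv_fourier_eq ((integrable_comp_smul_iff volume _ hR).1 hi)
    (v := 0) hg.continuous.continuousAt
  rw [Real.fourierInv_eq'] at h2
  simp only [inner_zero_right, mul_zero, Complex.ofReal_zero, zero_mul, Complex.exp_zero,
    one_smul] at h2
  rw [h2]
  have h3 : ((2 * Real.pi) ^ Module.finrank ℝ E)⁻¹ *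
      |((-(2 * Real.pi)⁻¹) ^ Module.finrank ℝ E)⁻¹| = 1 := by
    rw [abs_inv, abs_pow, abs_neg, abs_of_pos (by positivity), inv_pow, inv_inv]
    exact inv_mul_cancel₀ (by positivity)
  rw [h3, one_smul]
  simp [g]

variable [Nontrivial E]

theorem reproducingKernel_eq {κ ε : ℝ} (hκ0 : 0 < κ) (hκ1 : κ ≤ 1) (hε : 0 < ε) (w : E) :
    reproducingKernel κ ε w = (((2 * Real.pi) ^ Module.finrank ℝ E)⁻¹ : ℝ) •
      ∫ ξ : E, Real.exp (-ε * ‖ξ‖ ^ 2) • boundedAmplitude κ ε w ξ := by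
  rw [reproducingKernel, integral_gaussian_amplitude hκ0 hκ1 hε]

theorem integrable_gaussian_pow {ε : ℝ} (hε : 0 < ε) (N : ℕ) :
    Integrable fun ξ : E => Real.exp (-ε * ‖ξ‖ ^ 2) * (1 + ‖ξ‖) ^ N := by
  have h := integrable_gaussian_mul_growth (E := E) (μ := volume) hε N
    (neg_finrank_lt (s := 0) (by norm_num))
  refine (h.const_mul 2⁻¹).congr (.of_forall fun ξ => ?_)
  simp only [Real.rpow_zero]
  ring

theorem integrable_boundedAmplitude_smul {κ ε : ℝ} (hκ0 : 0 < κ) (hκ1 : κ ≤ 1) (hε : 0 < ε)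
    {f : E → F} (hf : Continuous f) (hi : Integrable f) (y : E) :
    Integrable (fun p : E × E =>
      (Real.exp (-ε * ‖p.1‖ ^ 2) • boundedAmplitude κ ε p.2 p.1) • f (y + p.2))
      (volume.prod volume) := by
  obtain ⟨C, hC, h⟩ := exists_norm_boundedAmplitude_le (E := E) hκ0 hκ1
  have h1 := ((integrable_gaussian_pow (E := E) hε 2).const_mul (1 + ε * C)).mul_prod
    (hi.comp_add_left y).norm
  refine h1.mono' ?_ (.of_forall fun p => ?_)
  · have := continuous_boundedAmplitude (E := E) hκ0 ε
    exact (by fun_prop : Continuous fun p : E × E =>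
      (Real.exp (-ε * ‖p.1‖ ^ 2) • boundedAmplitude κ ε p.2 p.1) • f (y + p.2)).aestronglyMeasurable
  · rw [norm_smul, norm_smul, Real.norm_of_nonneg (Real.exp_nonneg _)]
    refine mul_le_mul_of_nonneg_right ?_ (norm_nonneg _)
    calc _ ≤ Real.exp (-ε * ‖p.1‖ ^ 2) * ((1 + ε * C) * (1 + ‖p.1‖) ^ 2) := by
          gcongr
          exact h ε hε _ _
      _ = _ := by ring

theorem continuous_reproducingKernel_and_bound {κ ε : ℝ} (hκ0 : 0 < κ) (hκ1 : κ ≤ 1) (hε : 0 < ε) :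
    Continuous (reproducingKernel κ ε : E → ℂ) ∧
      ∃ C, 0 ≤ C ∧ ∀ w : E, ‖reproducingKernel κ ε w‖ ≤ C := by
  obtain ⟨C, hC, h⟩ := exists_norm_boundedAmplitude_le (E := E) hκ0 hκ1
  have hi := (integrable_gaussian_pow (E := E) hε 2).const_mul (1 + ε * C)
  have hb : ∀ w ξ : E, ‖Real.exp (-ε * ‖ξ‖ ^ 2) • boundedAmplitude κ ε w ξ‖ ≤
      (1 + ε * C) * (Real.exp (-ε * ‖ξ‖ ^ 2) * (1 + ‖ξ‖) ^ 2) := fun w ξ => by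
    rw [norm_smul, Real.norm_of_nonneg (Real.exp_nonneg _)]
    calc _ ≤ Real.exp (-ε * ‖ξ‖ ^ 2) * ((1 + ε * C) * (1 + ‖ξ‖) ^ 2) := by
          gcongr
          exact h ε hε _ _
      _ = _ := by ring
  have hc := continuous_boundedAmplitude (E := E) hκ0 ε
  have heq := funext fun w : E => reproducingKernel_eq hκ0 hκ1 hε w
  constructor
  · rw [heq]
    have h0 : Continuous fun w : E => ∫ ξ : E,
        Real.exp (-ε * ‖ξ‖ ^ 2) • boundedAmplitude κ ε w ξ := by
      refine continuous_of_dominated (fun w => ?_) (fun w => .of_forall (hb w)) hi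
        (.of_forall fun ξ => ?_)
      · have : Continuous fun ξ => boundedAmplitude κ ε w ξ :=
          hc.comp (continuous_id.prodMk continuous_const)
        exact (by fun_prop : Continuous fun ξ : E =>
          Real.exp (-ε * ‖ξ‖ ^ 2) • boundedAmplitude κ ε w ξ).aestronglyMeasurable
      · have : Continuous fun w => boundedAmplitude κ ε w ξ :=
          hc.comp (continuous_const.prodMk continuous_id)
        exact (by fun_prop : Continuous fun w : E =>
          Real.exp (-ε * ‖ξ‖ ^ 2) • boundedAmplitude κ ε w ξ)
    exact (continuous_const (y := ((2 * Real.pi) ^ Module.finrank ℝ E)⁻¹)).smul h0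
  · refine ⟨((2 * Real.pi) ^ Module.finrank ℝ E)⁻¹ * ∫ ξ : E, (1 + ε * C) *
      (Real.exp (-ε * ‖ξ‖ ^ 2) * (1 + ‖ξ‖) ^ 2), by positivity, fun w => ?_⟩
    rw [reproducingKernel_eq hκ0 hκ1 hε, norm_smul, Real.norm_of_nonneg (by positivity)]
    gcongr
    exact norm_integral_le_of_norm_le hi (.of_forall (hb w))

/-- Fubini's theorem: the smoothing operator as a Fourier integral, with the error term of order `ε`
apart from the Gaussian regularization of the Fourier inversion formula. -/
theorem integral_reproducingKernel_smul [CompleteSpace F] {κ ε : ℝ} (hκ0 : 0 < κ) (hκ1 : κ ≤ 1)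
    (hε : 0 < ε) {f : E → F} (hf : Continuous f) (hi : Integrable f) (y : E) :
    ∫ w, reproducingKernel κ ε w • f (y + w) = (((2 * Real.pi) ^ Module.finrank ℝ E)⁻¹ : ℝ) •
      ∫ ξ : E, Real.exp (-ε * ‖ξ‖ ^ 2) •
        ((∫ w, Complex.exp (Complex.I * (⟪ξ, w⟫ : ℝ)) • f (y + w)) +
        (2 * ε * Complex.I * (‖ξ‖ ^ (κ / 2) : ℝ)) • ∫ w, Complex.exp (Complex.I * (⟪ξ, w⟫ : ℝ)) •
          ((⟪ξ, errorSymbol (‖ξ‖ ^ (κ / 2) • w)⟫ : ℝ) : ℂ) • f (y + w)) := by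
  have h1 : ∀ w, reproducingKernel κ ε w • f (y + w) =
      (((2 * Real.pi) ^ Module.finrank ℝ E)⁻¹ : ℝ) • ∫ ξ : E,
        (Real.exp (-ε * ‖ξ‖ ^ 2) • boundedAmplitude κ ε w ξ) • f (y + w) := fun w => by
    rw [reproducingKernel_eq hκ0 hκ1 hε, smul_assoc, integral_smul_const]
  simp only [h1]
  rw [integral_smul, ← integral_integral_swap
    (f := fun ξ w => (Real.exp (-ε * ‖ξ‖ ^ 2) • boundedAmplitude κ ε w ξ) • f (y + w))
    (integrable_boundedAmplitude_smul hκ0 hκ1 hε hf hi y)]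
  simp only [integral_boundedAmplitude_smul hf hi]

/-- The kernels `G_ε` form an approximate identity on test functions, at the rate `ε`. -/
theorem exists_norm_integral_reproducingKernel_sub_le (E : Type u) [NormedAddCommGroup E]
    [InnerProductSpace ℝ E] [FiniteDimensional ℝ E] [MeasurableSpace E] [BorelSpace E]
    [Nontrivial E] (F : Type*) [NormedAddCommGroup F] [NormedSpace ℂ F] [CompleteSpace F]
    {κ : ℝ} (hκ0 : 0 < κ) (hκ1 : κ ≤ 1) :
    ∃ N : ℕ, ∃ C, 0 ≤ C ∧ ∀ f : E → F, ContDiff ℝ ∞ f → HasCompactSupport f → ∀ ε, 0 < ε → ∀ y,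
      ‖(∫ w, reproducingKernel κ ε w • f (y + w)) - f y‖ ≤
        ε * (C * ∑ j ∈ Finset.range (N + 1), ∫ w, ‖iteratedFDeriv ℝ j f w‖) := by
  set m := Module.finrank ℝ E
  -- `2 M` powers of decay, of which the dilation by `|ξ|^{κ/2} ≤ |ξ|^{1/2}` costs `M`
  let M := m + 3
  obtain ⟨C, hC, h⟩ := exists_oscillatory_decay_dilated (F := F) E (2 * M)
  obtain ⟨B, hB0, hB⟩ := exists_bound_iteratedFDeriv_inner_errorSymbol (E := E) (2 * M)
  refine ⟨2 * M, (((2 * Real.pi) ^ m)⁻¹ * ∫ ξ : E, ((1 + ‖ξ‖) ^ (m + 1))⁻¹) *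
    (C * (1 + 2 * (4 ^ M * B))), by positivity, fun f hf hc ε hε y => ?_⟩
  set S := ∑ j ∈ Finset.range (2 * M + 1), ∫ w, ‖iteratedFDeriv ℝ j f w‖ with hS
  have hS0 : 0 ≤ S := Finset.sum_nonneg fun i _ => integral_nonneg fun _ => norm_nonneg _
  have hfi : Integrable f := hf.continuous.integrable_of_hasCompactSupport hc
  obtain ⟨hAi, hA⟩ := integral_integral_cexp_smul hf hc y
  rw [integral_reproducingKernel_smul hκ0 hκ1 hε hf.continuous hfi y]
  nth_rewrite 1 [← hA]
  set A : E → F := fun ξ => ∫ w, Complex.exp (Complex.I * (⟪ξ, w⟫ : ℝ)) • f (y + w) with hAdef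
  set R : E → F := fun ξ => ∫ w, Complex.exp (Complex.I * (⟪ξ, w⟫ : ℝ)) •
          ((⟪ξ, errorSymbol (‖ξ‖ ^ (κ / 2) • w)⟫ : ℝ) : ℂ) • f (y + w) with hRdef
  have hA1 : ∀ ξ, (1 + ‖ξ‖) ^ (2 * M) * ‖A ξ‖ ≤ C * S := fun ξ => by
    have h1 := h f hf hc (fun _ => 1) contDiff_const 1 (fun j _ v => by
      rcases j with _ | j
      · rw [norm_iteratedFDeriv_zero]
        simp
      · simp [iteratedFDeriv_succ_const]) 0 le_rfl y ξ
    simpa using h1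
  have hR1 : ∀ ξ, (1 + ‖ξ‖) ^ (2 * M) * ‖R ξ‖ ≤
      C * (1 + ‖ξ‖ ^ (κ / 2)) ^ (2 * M) * (‖ξ‖ * B) * S := fun ξ =>
    h f hf hc (fun v => ((⟪ξ, errorSymbol v⟫ : ℝ) : ℂ))
      (Complex.ofRealCLM.contDiff.comp ((innerSL ℝ ξ).contDiff.comp
        contDiff_errorSymbol_and_bound.1)) _ (hB ξ) _ (by positivity) y ξ
  have hRi : Integrable fun ξ : E => Real.exp (-ε * ‖ξ‖ ^ 2) • (A ξ +
      (2 * ε * Complex.I * (‖ξ‖ ^ (κ / 2) : ℝ)) • R ξ) :=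
    (integrable_boundedAmplitude_smul hκ0 hκ1 hε hf.continuous hfi y).integral_prod_left.congr
      (.of_forall fun ξ => integral_boundedAmplitude_smul hf.continuous hfi y ξ)
  rw [← smul_sub, ← integral_sub hRi hAi, norm_smul, Real.norm_of_nonneg (by positivity)]
  have hpt : ∀ ξ, ‖Real.exp (-ε * ‖ξ‖ ^ 2) • (A ξ +
      (2 * ε * Complex.I * (‖ξ‖ ^ (κ / 2) : ℝ)) • R ξ) - A ξ‖ ≤
        ((1 + ‖ξ‖) ^ (m + 1))⁻¹ * (ε * (C * (1 + 2 * (4 ^ M * B)) * S)) := by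
    intro ξ
    have hξ := norm_nonneg ξ
    have e1 : Real.exp (-ε * ‖ξ‖ ^ 2) ≤ 1 := Real.exp_le_one_iff.2 (by
      rw [neg_mul]
      exact neg_nonpos.2 (by positivity))
    have e2 : |Real.exp (-ε * ‖ξ‖ ^ 2) - 1| ≤ ε * ‖ξ‖ ^ 2 := by
      rw [neg_mul]
      exact norm_one_sub_exp_le (by positivity)
    have e3 : Real.exp (-ε * ‖ξ‖ ^ 2) • (A ξ + (2 * ε * Complex.I * (‖ξ‖ ^ (κ / 2) : ℝ)) • R ξ) -
        A ξ = (Real.exp (-ε * ‖ξ‖ ^ 2) - 1) • A ξ +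
          Real.exp (-ε * ‖ξ‖ ^ 2) • (2 * ε * Complex.I * (‖ξ‖ ^ (κ / 2) : ℝ)) • R ξ := by
      rw [sub_smul, one_smul, smul_add]
      abel
    have e4 := norm_rpow_half_le_one_add hκ0 hκ1 ξ
    have e5 : (1 + ‖ξ‖ ^ (κ / 2)) ^ (2 * M) ≤ 4 ^ M * (1 + ‖ξ‖) ^ M := by
      calc (1 + ‖ξ‖ ^ (κ / 2)) ^ (2 * M) ≤ (2 * (1 + ‖ξ‖) ^ (1 / 2 : ℝ)) ^ (2 * M) := by
            gcongr
            exact norm_rpow_half_le hκ0 hκ1 ξ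
        _ = _ := by
            rw [pow_mul, mul_pow, rpow_half_sq, mul_pow]
            norm_num
    have e6 : ‖Real.exp (-ε * ‖ξ‖ ^ 2) • (A ξ +
        (2 * ε * Complex.I * (‖ξ‖ ^ (κ / 2) : ℝ)) • R ξ) - A ξ‖ ≤
        ε * ‖ξ‖ ^ 2 * ‖A ξ‖ + 2 * ε * (1 + ‖ξ‖) * ‖R ξ‖ := by
      rw [e3]
      refine (norm_add_le _ _).trans ?_
      rw [norm_smul, norm_smul, norm_smul, Real.norm_eq_abs,
        Real.norm_of_nonneg (Real.exp_nonneg _)]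
      have e7 : ‖(2 * ε * Complex.I * (‖ξ‖ ^ (κ / 2) : ℝ) : ℂ)‖ = 2 * ε * ‖ξ‖ ^ (κ / 2) := by
        simp [abs_of_pos hε, abs_of_nonneg (Real.rpow_nonneg hξ (κ / 2))]
      rw [e7]
      calc _ ≤ ε * ‖ξ‖ ^ 2 * ‖A ξ‖ + 1 * (2 * ε * (1 + ‖ξ‖) * ‖R ξ‖) := by gcongr
        _ = _ := by ring
    refine e6.trans ?_
    rw [← div_eq_inv_mul, le_div_iff₀ (by positivity)]
    -- after multiplication with `(1 + |ξ|)^{2M}` both terms are `O((1 + |ξ|)^{M + 2})`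
    refine le_of_mul_le_mul_right (a := (1 + ‖ξ‖) ^ (M + 2)) ?_ (by positivity)
    have e8 : (1 + ‖ξ‖) ^ (m + 1) * (1 + ‖ξ‖) ^ (M + 2) = (1 + ‖ξ‖) ^ (2 * M) := by
      rw [← pow_add]
      congr 1
      omega
    have e9 : (1 + ‖ξ‖) ^ 2 ≤ (1 + ‖ξ‖) ^ (M + 2) :=
      pow_le_pow_right₀ (by linarith) (by omega)
    calc (ε * ‖ξ‖ ^ 2 * ‖A ξ‖ + 2 * ε * (1 + ‖ξ‖) * ‖R ξ‖) * (1 + ‖ξ‖) ^ (m + 1) *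
          (1 + ‖ξ‖) ^ (M + 2)
        = ε * ‖ξ‖ ^ 2 * ((1 + ‖ξ‖) ^ (2 * M) * ‖A ξ‖) +
          2 * ε * (1 + ‖ξ‖) * ((1 + ‖ξ‖) ^ (2 * M) * ‖R ξ‖) := by
          rw [← e8]
          ring
      _ ≤ ε * ‖ξ‖ ^ 2 * (C * S) + 2 * ε * (1 + ‖ξ‖) *
          (C * (1 + ‖ξ‖ ^ (κ / 2)) ^ (2 * M) * (‖ξ‖ * B) * S) := by
          gcongr ε * ‖ξ‖ ^ 2 * ?_ + 2 * ε * (1 + ‖ξ‖) * ?_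
          · exact hA1 ξ
          · exact hR1 ξ
      _ ≤ ε * (1 + ‖ξ‖) ^ (M + 2) * (C * S) + 2 * ε * (1 + ‖ξ‖) *
          (C * (4 ^ M * (1 + ‖ξ‖) ^ M) * ((1 + ‖ξ‖) * B) * S) := by
          have : ‖ξ‖ ^ 2 ≤ (1 + ‖ξ‖) ^ (M + 2) := le_trans (by gcongr; linarith) e9
          gcongr
          linarith
      _ = _ := by ring
  calc _ ≤ ((2 * Real.pi) ^ m)⁻¹ * ∫ ξ : E, ((1 + ‖ξ‖) ^ (m + 1))⁻¹ *
        (ε * (C * (1 + 2 * (4 ^ M * B)) * S)) := by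
        gcongr
        exact norm_integral_le_of_norm_le (integrable_one_add_norm_inv_pow.mul_const _)
          (.of_forall hpt)
    _ = _ := by
        rw [integral_mul_const]
        ring

end ApproximateIdentity

/-! ### Smoothing of test functions -/

section Smoothing

theorem norm_iteratedFDeriv_of_eq_comp {E A B : Type*} [NormedAddCommGroup E] [NormedSpace ℝ E]
    [NormedAddCommGroup A] [NormedSpace ℝ A] [NormedAddCommGroup B] [NormedSpace ℝ B]
    (L : A ≃ₗᵢ[ℝ] B) (g : E → A) (f : E → B) (hf : f = L ∘ g) (j : ℕ) (x : E) :
    ‖iteratedFDeriv ℝ j f x‖ = ‖iteratedFDeriv ℝ j g x‖ := by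
  rw [hf, L.norm_iteratedFDeriv_comp_left]

set_option maxHeartbeats 1000000 in
theorem norm_iteratedFDeriv_iteratedFDeriv {E F : Type*} [NormedAddCommGroup E] [NormedSpace ℝ E]
    [NormedAddCommGroup F] [NormedSpace ℝ F] (f : E → F) (j k : ℕ) (x : E) :
    ‖iteratedFDeriv ℝ j (iteratedFDeriv ℝ k f) x‖ = ‖iteratedFDeriv ℝ (j + k) f x‖ := by
  induction k generalizing j with
  | zero =>
    rw [iteratedFDeriv_zero_eq_comp]
    exact LinearIsometryEquiv.norm_iteratedFDeriv_comp_left _ _ _ _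
  | succ k ih =>
    have h : ‖iteratedFDeriv ℝ j (iteratedFDeriv ℝ (k + 1) f) x‖ =
        ‖iteratedFDeriv ℝ j (fderiv ℝ (iteratedFDeriv ℝ k f)) x‖ :=
      norm_iteratedFDeriv_of_eq_comp (A := E →L[ℝ] E [×k]→L[ℝ] F) (B := E [×(k + 1)]→L[ℝ] F)
        (continuousMultilinearCurryLeftEquiv ℝ (fun _ : Fin (k + 1) => E) F).symm _ _
        iteratedFDeriv_succ_eq_comp_left j x
    rw [h, norm_iteratedFDeriv_fderiv, ih (j + 1), show j + 1 + k = j + (k + 1) by ring]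

theorem iteratedFDeriv_integral_smul_translate {E : Type*} [NormedAddCommGroup E]
    [NormedSpace ℝ E] [FiniteDimensional ℝ E] [MeasurableSpace E] [BorelSpace E] {μ : Measure E}
    [IsFiniteMeasureOnCompacts μ] {G f : E → ℂ} (hG : Continuous G) (hf : ContDiff ℝ ∞ f)
    (hc : HasCompactSupport f) :
    ContDiff ℝ ∞ (fun y => ∫ w, G w • f (y + w) ∂μ) ∧ ∀ k,
      (iteratedFDeriv ℝ k fun y => ∫ w, G w • f (y + w) ∂μ) =
        fun y => ∫ w, G w • iteratedFDeriv ℝ k f (y + w) ∂μ := by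
  have hfy : ∀ w, ContDiff ℝ ∞ fun y => f (y + w) := fun w =>
    hf.comp (contDiff_id.add contDiff_const)
  have hd : ∀ k w y, iteratedFDeriv ℝ k (fun y => G w • f (y + w)) y =
      G w • iteratedFDeriv ℝ k f (y + w) := fun k w y => by
    refine (iteratedFDeriv_const_smul_apply (f := fun y => f (y + w)) (a := G w)
      ((hfy w).of_le (by exact_mod_cast le_top)).contDiffAt).trans ?_
    rw [iteratedFDeriv_comp_add_right]
  have hcont : ∀ k, Continuous (iteratedFDeriv ℝ k f) := fun k =>
    hf.continuous_iteratedFDeriv (by exact_mod_cast le_top)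
  have h1 : ∀ᵐ w ∂μ, ContDiff ℝ ∞ fun y => G w • f (y + w) :=
    .of_forall fun w => contDiff_const.mul (hfy w)
  have h2 : ∀ k y, AEStronglyMeasurable
      (fun w => iteratedFDeriv ℝ k (fun y => G w • f (y + w)) y) μ := by
    intro k y
    simp only [hd]
    exact (hG.smul ((hcont k).comp (continuous_const.add continuous_id))).aestronglyMeasurable
  have h3 : ∀ k y, ∃ s ∈ 𝓝 y, ∃ b : E → ℝ, Integrable b μ ∧
      ∀ᵐ w ∂μ, ∀ z ∈ s, ‖iteratedFDeriv ℝ k (fun y => G w • f (y + w)) z‖ ≤ b w := by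
    intro k y
    obtain ⟨C, hC⟩ := (hcont k).bounded_above_of_compact_support (hc.iteratedFDeriv k)
    have hK : IsCompact ((fun p : E × E => p.1 - p.2) '' (tsupport f ×ˢ Metric.closedBall y 1)) :=
      (IsCompact.prod hc (isCompact_closedBall y 1)).image continuous_sub
    set K := (fun p : E × E => p.1 - p.2) '' (tsupport f ×ˢ Metric.closedBall y 1)
    refine ⟨Metric.closedBall y 1, Metric.closedBall_mem_nhds y one_pos,
      K.indicator fun w => ‖G w‖ * C, ?_, .of_forall fun w z hz => ?_⟩
    · exact (integrable_indicator_iff hK.measurableSet).2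
        ((hG.norm.mul continuous_const).continuousOn.integrableOn_compact hK)
    · rw [hd]
      by_cases hw : w ∈ K
      · rw [indicator_of_mem hw, norm_smul]
        gcongr
        exact hC _
      · rw [indicator_of_notMem hw]
        have h0 : iteratedFDeriv ℝ k f (z + w) = 0 := by
          by_contra h
          refine hw ⟨(z + w, z), ⟨?_, hz⟩, by simp⟩
          exact support_iteratedFDeriv_subset k h
        rw [h0, smul_zero, norm_zero]
  refine ⟨contDiff_integral h1 h2 h3, fun k => ?_⟩
  rw [(iteratedFDeriv_integral h1 h2 h3 k).1]
  simp only [hd]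

end Smoothing

/-! ### Pairing a compactly supported distribution with an integral -/

section Pairing

variable {m : ℕ} {V : Opens (EuclideanSpace ℝ (Fin m))}

namespace CompactDistribution

/-- The Banach space of tuples `(f_0, …, f_N)` of continuous functions on the compact set `K`,
with `f_k` valued in the `k`-linear forms. -/
def JetSpace (V : Opens (EuclideanSpace ℝ (Fin m))) (N : ℕ) (K : Set V) : Type :=
  (k : Fin (N + 1)) →
    C(K, ContinuousMultilinearMap ℝ (fun _ : Fin k => EuclideanSpace ℝ (Fin m)) ℂ)

variable {N : ℕ} {K : Set V}

instance [CompactSpace K] : NormedAddCommGroup (JetSpace V N K) :=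
  inferInstanceAs (NormedAddCommGroup ((k : Fin (N + 1)) →
    C(K, ContinuousMultilinearMap ℝ (fun _ : Fin k => EuclideanSpace ℝ (Fin m)) ℂ)))

instance [CompactSpace K] : NormedSpace ℂ (JetSpace V N K) :=
  inferInstanceAs (NormedSpace ℂ ((k : Fin (N + 1)) →
    C(K, ContinuousMultilinearMap ℝ (fun _ : Fin k => EuclideanSpace ℝ (Fin m)) ℂ)))

instance [CompactSpace K] : CompleteSpace (JetSpace V N K) :=
  inferInstanceAs (CompleteSpace ((k : Fin (N + 1)) →
    C(K, ContinuousMultilinearMap ℝ (fun _ : Fin k => EuclideanSpace ℝ (Fin m)) ℂ)))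

theorem JetSpace.norm_le_iff [CompactSpace K] (J : JetSpace V N K) {b : ℝ} (hb : 0 ≤ b) :
    ‖J‖ ≤ b ↔ ∀ k x, ‖J k x‖ ≤ b :=
  (pi_norm_le_iff_of_nonneg hb).trans (forall_congr' fun k => ContinuousMap.norm_le (J k) hb)

theorem JetSpace.norm_apply_le [CompactSpace K] (J : JetSpace V N K) (k : Fin (N + 1)) (x : K) :
    ‖J k x‖ ≤ ‖J‖ :=
  (JetSpace.norm_le_iff J (norm_nonneg _)).1 le_rfl k x

/-- The evaluation of the component of order `k` of a jet at the point `x`. -/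
def JetSpace.eval [CompactSpace K] (k : Fin (N + 1)) (x : K) : JetSpace V N K →L[ℂ]
    ContinuousMultilinearMap ℝ (fun _ : Fin k => EuclideanSpace ℝ (Fin m)) ℂ :=
  LinearMap.mkContinuous
    { toFun := fun J => J k x, map_add' := fun _ _ => rfl, map_smul' := fun _ _ => rfl } 1
    fun J => by
      rw [one_mul]
      exact JetSpace.norm_apply_le J k x

/-- The derivatives of order at most `N` of `f ∈ C^∞(V)`, restricted to the compact set `K ⊆ V`. -/
def jet (V : Opens (EuclideanSpace ℝ (Fin m))) (N : ℕ) (K : Set V) [CompactSpace K] :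
    SmoothFun V →ₗ[ℂ] JetSpace V N K where
  toFun f k := (SmoothFun.derivMap k f).restrict K
  map_add' f g := by
    funext k
    ext1 x
    exact congrArg (fun h => h (x : V)) ((SmoothFun.derivLin V k).map_add f g)
  map_smul' c f := by
    funext k
    ext1 x
    exact congrArg (fun h => h (x : V)) ((SmoothFun.derivLin V k).map_smul c f)

/-- The continuity of `u` in terms of the seminorms that define the topology of `C^∞(V)`. -/
theorem exists_seminorm_bound (u : CompactDistribution V) :
    ∃ (N : ℕ) (K : Set V) (r : ℝ), IsCompact K ∧ 0 < r ∧ ∀ f : SmoothFun V,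
      (∀ k ≤ N, ∀ x ∈ K, ‖iteratedFDeriv ℝ k f x‖ < r) → ‖u f‖ < 1 := by
  have h0 : {f : SmoothFun V | ‖u f‖ < 1} ∈ 𝓝 (0 : SmoothFun V) := by
    have h1 : Continuous fun f : SmoothFun V => ‖u f‖ :=
      (show Continuous u from map_continuous u).norm
    exact h1.continuousAt.preimage_mem_nhds (Iio_mem_nhds (by simp))
  have h1 : 𝓝 (0 : SmoothFun V) = ⨅ k, comap (SmoothFun.derivLin V k) (𝓝 0) := by
    rw [nhds_iInf]
    simp only [nhds_induced, map_zero]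
  rw [h1, mem_iInf] at h0
  obtain ⟨I, hI, T, hT, hTU⟩ := h0
  have h2 : ∀ i : I, ∃ (K : Set V) (r : ℝ), IsCompact K ∧ 0 < r ∧ ∀ f : SmoothFun V,
      (∀ x ∈ K, ‖iteratedFDeriv ℝ i f x‖ < r) → f ∈ T i := by
    intro i
    obtain ⟨A, hA, hAT⟩ := mem_comap.1 (hT i)
    have h3 := ContinuousMap.hasBasis_compactConvergenceUniformity (α := V)
      (β := ContinuousMultilinearMap ℝ (fun _ : Fin i => EuclideanSpace ℝ (Fin m)) ℂ)
    obtain ⟨⟨K, R⟩, ⟨hK, hR⟩, hKR⟩ := (nhds_basis_uniformity' h3).mem_iff.1 hA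
    obtain ⟨r, hr, hrR⟩ := Metric.mem_uniformity_dist.1 hR
    refine ⟨K, r, hK, hr, fun f hf => hAT (hKR fun x hx => hrR ?_)⟩
    rw [dist_eq_norm, ← norm_neg]
    have h4 : SmoothFun.derivLin V i f x - (0 : C(V, ContinuousMultilinearMap ℝ
        (fun _ : Fin i => EuclideanSpace ℝ (Fin m)) ℂ)) x = iteratedFDeriv ℝ i f x := sub_zero _
    rw [neg_sub, h4]
    exact hf x hx
  choose K r hK hr h using h2
  have : Finite I := hI
  have : Fintype I := Fintype.ofFinite I
  obtain ⟨N, hN⟩ := hI.bddAbove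
  obtain ⟨r₀, hr₀, hr₀r⟩ : ∃ r₀, 0 < r₀ ∧ ∀ i, r₀ ≤ r i := by
    rcases isEmpty_or_nonempty I with hE | hE
    · exact ⟨1, one_pos, fun i => (hE.false i).elim⟩
    · obtain ⟨i₀, hi₀⟩ := Finite.exists_min r
      exact ⟨r i₀, hr i₀, hi₀⟩
  refine ⟨N, ⋃ i, K i, r₀, isCompact_iUnion hK, hr₀, fun f hf => ?_⟩
  have hfU : f ∈ ⋂ i, T i := mem_iInter.2 fun i => h i f fun x hx =>
    (hf i (hN i.2) x (mem_iUnion.2 ⟨i, hx⟩)).trans_le (hr₀r i)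
  rw [← hTU] at hfU
  exact hfU

/-- By the Hahn–Banach theorem, a compactly supported distribution is a continuous functional of
finitely many derivatives on a compact set. -/
theorem exists_eq_comp_jet (u : CompactDistribution V) :
    ∃ (N : ℕ) (K : Set V) (_ : CompactSpace K) (U : JetSpace V N K →L[ℂ] ℂ),
      ∀ f, u f = U (jet V N K f) := by
  obtain ⟨N, K, r, hK, hr, h⟩ := exists_seminorm_bound u
  have hKc : CompactSpace K := isCompact_iff_compactSpace.1 hK
  have hb : ∀ f, ‖u f‖ ≤ r⁻¹ * ‖jet V N K f‖ := by
    intro f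
    refine le_of_forall_gt_imp_ge_of_dense fun a ha => ?_
    have ha0 : 0 < a := lt_of_le_of_lt (by positivity) ha
    have h1 : ‖jet V N K (((a⁻¹ : ℝ) : ℂ) • f)‖ < r := by
      rw [map_smul, norm_smul, Complex.norm_real, norm_inv, Real.norm_of_nonneg ha0.le]
      rw [inv_mul_lt_iff₀ hr] at ha
      rw [inv_mul_lt_iff₀ ha0]
      linarith
    have h2 := h (((a⁻¹ : ℝ) : ℂ) • f) fun k hk x hx => by
      refine lt_of_le_of_lt ?_ h1
      exact JetSpace.norm_apply_le (jet V N K (((a⁻¹ : ℝ) : ℂ) • f)) ⟨k, by omega⟩ ⟨x, hx⟩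
    rw [map_smul, norm_smul, Complex.norm_real, norm_inv, Real.norm_of_nonneg ha0.le,
      inv_mul_lt_iff₀ ha0, mul_one] at h2
    exact h2.le
  let J := jet V N K
  obtain ⟨g, hg⟩ := LinearMap.exists_rightInverse_of_surjective J.rangeRestrict
    (LinearMap.range_rangeRestrict J)
  have hJg : ∀ z : J.range, J (g z) = z := fun z =>
    congrArg Subtype.val (LinearMap.congr_fun hg z)
  let uL : SmoothFun V →ₗ[ℂ] ℂ :=
    { toFun := u, map_add' := map_add u, map_smul' := map_smul u }
  let U₀ : J.range →L[ℂ] ℂ := (uL ∘ₗ g).mkContinuous r⁻¹ fun z => by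
    refine (hb (g z)).trans (le_of_eq ?_)
    change r⁻¹ * ‖J (g z)‖ = _
    rw [hJg]
    rfl
  obtain ⟨U, hU, -⟩ := exists_extension_norm_eq J.range U₀
  refine ⟨N, K, hKc, U, fun f => ?_⟩
  have h1 : U (J f) = u (g ⟨J f, LinearMap.mem_range_self J f⟩) :=
    hU ⟨J f, LinearMap.mem_range_self J f⟩
  change u f = U (J f)
  rw [h1, ← sub_eq_zero, ← map_sub, ← norm_le_zero_iff]
  refine (hb _).trans (le_of_eq ?_)
  change r⁻¹ * ‖J _‖ = 0
  rw [map_sub, hJg, sub_self, norm_zero, mul_zero]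

theorem jet_ofFun_apply [CompactSpace K] {f : EuclideanSpace ℝ (Fin m) → ℂ}
    (hf : ContDiff ℝ ∞ f) (k : Fin (N + 1)) (x : K) :
    jet V N K (SmoothFun.ofFun V f) k x = iteratedFDeriv ℝ k f (x : V) := by
  change iteratedFDeriv ℝ k (SmoothFun.ofFun V f) (x : V) = _
  refine (Filter.EventuallyEq.iteratedFDeriv ℝ ?_ k).eq_of_nhds
  filter_upwards [V.isOpen.mem_nhds (x : V).2] with y hy
  exact SmoothFun.ofFun_apply hf.contDiffOn hy

theorem exists_norm_pair_le (u : CompactDistribution V) :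
    ∃ (N : ℕ) (C : ℝ), 0 ≤ C ∧ ∀ f : EuclideanSpace ℝ (Fin m) → ℂ, ContDiff ℝ ∞ f →
      ∀ b : ℝ, (∀ k ≤ N, ∀ y, ‖iteratedFDeriv ℝ k f y‖ ≤ b) → ‖u.pair f‖ ≤ C * b := by
  obtain ⟨N, K, hK, U, hU⟩ := u.exists_eq_comp_jet
  refine ⟨N, ‖U‖, norm_nonneg _, fun f hf b hb => ?_⟩
  have hb0 : 0 ≤ b := (norm_nonneg _).trans (hb 0 (Nat.zero_le _) 0)
  rw [pair, hU]
  refine (U.le_opNorm _).trans ?_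
  gcongr
  refine (JetSpace.norm_le_iff _ hb0).2 fun k x => ?_
  rw [jet_ofFun_apply hf]
  exact hb k (by omega) _

variable {X : Type*} [TopologicalSpace X] {S : Set X} {Φ : X → EuclideanSpace ℝ (Fin m) → ℂ}

theorem continuousOn_jet [CompactSpace K] (hΦ : ∀ p ∈ S, ContDiff ℝ ∞ (Φ p))
    (hcont : ∀ k, ContinuousOn (fun z : X × EuclideanSpace ℝ (Fin m) =>
      iteratedFDeriv ℝ k (Φ z.1) z.2) (S ×ˢ univ)) :
    ContinuousOn (fun p => jet V N K (SmoothFun.ofFun V (Φ p))) S := by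
  rw [continuousOn_iff_continuous_domRestrict]
  refine continuous_pi fun k => ContinuousMap.continuous_of_continuous_uncurry _ ?_
  have h1 : Continuous fun z : S × K => ((z.1 : X), ((z.2 : V) : EuclideanSpace ℝ (Fin m))) := by
    fun_prop
  refine ((hcont k).comp_continuous h1 fun z => ⟨z.1.2, mem_univ _⟩).congr fun z => ?_
  exact (jet_ofFun_apply (hΦ _ z.1.2) k z.2).symm

theorem continuousOn_pair (u : CompactDistribution V) (hΦ : ∀ p ∈ S, ContDiff ℝ ∞ (Φ p))
    (hcont : ∀ k, ContinuousOn (fun z : X × EuclideanSpace ℝ (Fin m) =>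
      iteratedFDeriv ℝ k (Φ z.1) z.2) (S ×ˢ univ)) :
    ContinuousOn (fun p => u.pair (Φ p)) S := by
  obtain ⟨N, K, hK, U, hU⟩ := u.exists_eq_comp_jet
  simp only [pair, hU]
  exact U.continuous.comp_continuousOn (continuousOn_jet hΦ hcont)

variable [SecondCountableTopology X] [MeasurableSpace X] [OpensMeasurableSpace X] {μ : Measure X}

/-- A compactly supported distribution commutes with the integral of a family of smooth functions
that depends continuously on the parameter in a set `S` of full measure. -/
theorem pair_integral (u : CompactDistribution V) (hS : MeasurableSet S) (hSμ : ∀ᵐ p ∂μ, p ∈ S)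
    (hΦ : ∀ p ∈ S, ContDiff ℝ ∞ (Φ p))
    (hcont : ∀ k, ContinuousOn (fun z : X × EuclideanSpace ℝ (Fin m) =>
      iteratedFDeriv ℝ k (Φ z.1) z.2) (S ×ˢ univ))
    {c : X → ℂ} (hc : AEStronglyMeasurable c μ) {B : ℕ → X → ℝ}
    (hB : ∀ k, ∀ p ∈ S, ∀ y, ‖iteratedFDeriv ℝ k (Φ p) y‖ ≤ B k p)
    (hi : ∀ k, Integrable (fun p => ‖c p‖ * B k p) μ) :
    u.pair (fun y => ∫ p, c p * Φ p y ∂μ) = ∫ p, c p * u.pair (Φ p) ∂μ := by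
  obtain ⟨N, K, hK, U, hU⟩ := u.exists_eq_comp_jet
  have hd : ∀ k, ∀ p ∈ S, ∀ y, iteratedFDeriv ℝ k (fun y => c p * Φ p y) y =
      c p • iteratedFDeriv ℝ k (Φ p) y := fun k p hp y =>
    iteratedFDeriv_const_smul_apply (f := Φ p) (a := c p)
      ((hΦ p hp).of_le (by exact_mod_cast le_top)).contDiffAt
  have hm : ∀ k y, AEStronglyMeasurable (fun p => iteratedFDeriv ℝ k (Φ p) y) μ := by
    intro k y
    rw [← Measure.restrict_eq_self_of_ae_mem hSμ]
    exact ((hcont k).comp (f := fun p => (p, y)) (by fun_prop)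
      fun p hp => ⟨hp, mem_univ _⟩).aestronglyMeasurable hS
  have h1 : ∀ᵐ p ∂μ, ContDiff ℝ ∞ fun y => c p * Φ p y :=
    hSμ.mono fun p hp => contDiff_const.mul (hΦ p hp)
  have h2 : ∀ k y, AEStronglyMeasurable
      (fun p => iteratedFDeriv ℝ k (fun y => c p * Φ p y) y) μ := fun k y =>
    (hc.smul (hm k y)).congr (hSμ.mono fun p hp => (hd k p hp y).symm)
  have h3 : ∀ k y, ∃ s ∈ 𝓝 y, ∃ b : X → ℝ, Integrable b μ ∧
      ∀ᵐ p ∂μ, ∀ z ∈ s, ‖iteratedFDeriv ℝ k (fun y => c p * Φ p y) z‖ ≤ b p := fun k y =>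
    ⟨univ, univ_mem, _, hi k, hSμ.mono fun p hp z _ => by
      rw [hd k p hp, norm_smul]
      exact mul_le_mul_of_nonneg_left (hB k p hp z) (norm_nonneg _)⟩
  have hJm : AEStronglyMeasurable (fun p => jet V N K (SmoothFun.ofFun V (Φ p))) μ := by
    rw [← Measure.restrict_eq_self_of_ae_mem hSμ]
    exact (continuousOn_jet hΦ hcont).aestronglyMeasurable hS
  have hJi : Integrable (fun p => c p • jet V N K (SmoothFun.ofFun V (Φ p))) μ := by
    refine (integrable_finsetSum (Finset.range (N + 1)) fun k _ => hi k).mono' (hc.smul hJm)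
      (hSμ.mono fun p hp => ?_)
    have hB0 : ∀ k, 0 ≤ B k p := fun k => (norm_nonneg _).trans (hB k p hp 0)
    rw [norm_smul, ← Finset.mul_sum]
    refine mul_le_mul_of_nonneg_left ?_ (norm_nonneg _)
    refine (JetSpace.norm_le_iff _ (Finset.sum_nonneg fun k _ => hB0 k)).2 fun k x => ?_
    rw [jet_ofFun_apply (hΦ p hp)]
    exact (hB k p hp _).trans (Finset.single_le_sum (f := fun k => B k p) (fun k _ => hB0 k)
      (Finset.mem_range.2 k.2))
  have hJ : jet V N K (SmoothFun.ofFun V fun y => ∫ p, c p * Φ p y ∂μ) =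
      ∫ p, c p • jet V N K (SmoothFun.ofFun V (Φ p)) ∂μ := by
    funext k
    ext1 x
    rw [jet_ofFun_apply (contDiff_integral h1 h2 h3), (iteratedFDeriv_integral h1 h2 h3 k).1]
    change _ = JetSpace.eval k x (∫ p, c p • jet V N K (SmoothFun.ofFun V (Φ p)) ∂μ)
    rw [← (JetSpace.eval k x).integral_comp_comm hJi]
    refine integral_congr_ae (hSμ.mono fun p hp => ?_)
    simp only [map_smul]
    rw [hd k p hp]
    congr 1
    exact (jet_ofFun_apply (hΦ p hp) k x).symm
  simp only [pair, hU]
  rw [hJ, ← U.integral_comp_comm hJi]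
  simp only [map_smul, smul_eq_mul]

end CompactDistribution

end Pairing

/-! ### The transform kernel -/

section PlaneKernel

open scoped RealInnerProductSpace

theorem contDiffAt_iteratedFDeriv_uncurry {X E F : Type*} [NormedAddCommGroup X] [NormedSpace ℝ X]
    [NormedAddCommGroup E] [NormedSpace ℝ E] [NormedAddCommGroup F] [NormedSpace ℝ F]
    {Φ : X → E → F} {p : X} (h : ∀ y, ContDiffAt ℝ ∞ (Function.uncurry Φ) (p, y)) (k : ℕ) (y : E) :
    ContDiffAt ℝ ∞ (fun z : X × E => iteratedFDeriv ℝ k (Φ z.1) z.2) (p, y) := by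
  induction k generalizing y with
  | zero =>
    simp only [iteratedFDeriv_zero_eq_comp, Function.comp_apply]
    exact (continuousMultilinearCurryFin0 ℝ E F).symm.contDiff.contDiffAt.comp (p, y) (h y)
  | succ k ih =>
    let L : (E →L[ℝ] E [×k]→L[ℝ] F) ≃ₗᵢ[ℝ] (E [×(k + 1)]→L[ℝ] F) :=
      (continuousMultilinearCurryLeftEquiv ℝ (fun _ : Fin (k + 1) => E) F).symm
    have h1 : ContDiffAt ℝ ∞
        (fun z : X × E => fderiv ℝ (iteratedFDeriv ℝ k (Φ z.1)) z.2) (p, y) := by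
      refine ContDiffAt.fderiv (n := ∞) (f := fun z : X × E => iteratedFDeriv ℝ k (Φ z.1))
        (g := Prod.snd) ?_ contDiffAt_snd (by simp)
      exact (ih y).comp ((p, y), y)
        ((contDiffAt_fst.comp _ contDiffAt_fst).prodMk contDiffAt_snd)
    have h2 : (fun z : X × E => iteratedFDeriv ℝ (k + 1) (Φ z.1) z.2) =
        fun z => L (fderiv ℝ (iteratedFDeriv ℝ k (Φ z.1)) z.2) := by
      funext z
      rw [iteratedFDeriv_succ_eq_comp_left]
      rfl
    rw [h2]
    exact (ContinuousLinearEquiv.contDiff (𝕜 := ℝ) (E := E →L[ℝ] E [×k]→L[ℝ] F)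
      (F := E [×(k + 1)]→L[ℝ] F) L.toContinuousLinearEquiv).contDiffAt.comp (p, y) h1

variable {E : Type} [NormedAddCommGroup E] [InnerProductSpace ℝ E]

/-- The kernel `e^{i⟨ξ,w⟩ - |ξ|^κ |w|²} (1 + iκ ⟨ξ,w⟩ |ξ|^{κ-2})` of the transform, as a function of
the real vector `w = x' - y`. -/
def planeKernel (κ : ℝ) (w ξ : E) : ℂ :=
  Complex.exp (Complex.I * (⟪ξ, w⟫ : ℝ)) * (Real.exp (-(‖ξ‖ ^ κ * ‖w‖ ^ 2)) *
    (1 + Complex.I * (κ * (⟪ξ, w⟫ * ‖ξ‖ ^ (κ - 2)) : ℝ)))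

theorem contDiffAt_norm_rpow {ξ : E} (hξ : ξ ≠ 0) (s : ℝ) :
    ContDiffAt ℝ ∞ (fun ξ : E => ‖ξ‖ ^ s) ξ :=
  (contDiffAt_norm ℝ hξ).rpow_const_of_ne (norm_ne_zero_iff.2 hξ)

theorem contDiffAt_planeKernel (κ : ℝ) {p : E × E} (hp : p.2 ≠ 0) (y : E) :
    ContDiffAt ℝ ∞ (Function.uncurry fun (p : E × E) (y : E) => planeKernel κ (p.1 - y) p.2)
      (p, y) := by
  have hw : ContDiffAt ℝ ∞ (fun z : (E × E) × E => z.1.1 - z.2) (p, y) := by fun_prop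
  have hξ : ContDiffAt ℝ ∞ (fun z : (E × E) × E => z.1.2) (p, y) := by fun_prop
  have hin : ContDiffAt ℝ ∞ (fun z : (E × E) × E => ⟪z.1.2, z.1.1 - z.2⟫) (p, y) := hξ.inner ℝ hw
  have hs : ∀ s : ℝ, ContDiffAt ℝ ∞ (fun z : (E × E) × E => ‖z.1.2‖ ^ s) (p, y) := fun s =>
    ContDiffAt.comp (p, y) (g := fun ξ : E => ‖ξ‖ ^ s) (f := fun z : (E × E) × E => z.1.2)
      (contDiffAt_norm_rpow hp s) hξ
  have hr : ∀ {f : (E × E) × E → ℝ}, ContDiffAt ℝ ∞ f (p, y) →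
      ContDiffAt ℝ ∞ (fun z => (f z : ℂ)) (p, y) := fun hf =>
    Complex.ofRealCLM.contDiff.contDiffAt.comp (p, y) hf
  refine ContDiffAt.mul ?_ (ContDiffAt.mul ?_ ?_)
  · exact (contDiffAt_const.mul (hr hin)).cexp
  · exact hr (((hs κ).mul (hw.norm_sq ℝ)).neg.exp)
  · exact contDiffAt_const.add (contDiffAt_const.mul
      (hr (contDiffAt_const.mul (hin.mul (hs (κ - 2))))))

/-- The derivatives of the kernel grow polynomially in `ξ`, apart from an integrable singularity
at `ξ = 0`. -/
theorem exists_norm_iteratedFDeriv_planeKernel_le [FiniteDimensional ℝ E] {κ : ℝ} (hκ0 : 0 < κ)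
    (hκ1 : κ ≤ 1) (k : ℕ) :
    ∃ C, 0 ≤ C ∧ ∀ x ξ : E, ξ ≠ 0 → ∀ y,
      ‖iteratedFDeriv ℝ k (fun y => planeKernel κ (x - y) ξ) y‖ ≤
        C * ((1 + ‖ξ‖) ^ k * (1 + ‖ξ‖ ^ (κ / 2 - 1))) := by
  have hP1 : (fun v : E => v).HasTemperateGrowth := Function.HasTemperateGrowth.id
  have hγ0 := fun k => exists_bound_iteratedFDeriv_gaussian_smul (E := E) one_pos
    (Function.HasTemperateGrowth.const (1 : ℂ)) k
  have hγ1 := fun k => exists_bound_iteratedFDeriv_gaussian_smul (E := E) one_pos hP1 k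
  choose C0 hC0 h0 using hγ0
  choose C1 hC1 h1 using hγ1
  let M : ℝ := ∑ j ∈ Finset.range (k + 1), (C0 j + C1 j)
  have hM : ∀ j ≤ k, C0 j + C1 j ≤ M := fun j hj =>
    Finset.single_le_sum (f := fun j => C0 j + C1 j) (fun i _ => add_nonneg (hC0 i) (hC1 i))
      (Finset.mem_range.2 (by omega))
  have hM0 : 0 ≤ M := Finset.sum_nonneg fun i _ => add_nonneg (hC0 i) (hC1 i)
  refine ⟨(∑ i ∈ Finset.range (k + 1), (k.choose i : ℝ)) * M, by positivity, fun x ξ hξ y => ?_⟩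
  have hξ0 : 0 < ‖ξ‖ := norm_pos_iff.2 hξ
  set τ := ‖ξ‖ ^ (κ / 2) with hτdef
  have hτ : 0 < τ := Real.rpow_pos_of_pos hξ0 _
  have hτ2 : τ ^ 2 = ‖ξ‖ ^ κ := by
    rw [hτdef, ← Real.rpow_mul_natCast hξ0.le]
    congr 1
    push_cast
    ring
  -- in terms of `v = |ξ|^{κ/2} w` the non-oscillating part is
  -- `γ(v) = e^{-|v|²} (1 + iκ |ξ|^{κ/2-2} ⟨ξ,v⟩)`
  let g0 : E → ℂ := fun v => Real.exp (-1 * ‖v‖ ^ 2) • (1 : ℂ)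
  let g1 : E → E := fun v => Real.exp (-1 * ‖v‖ ^ 2) • v
  let L : E →L[ℝ] ℂ := (κ * ‖ξ‖ ^ (κ / 2 - 2)) • (Complex.I • (Complex.ofRealCLM ∘L innerSL ℝ ξ))
  let γ : E → ℂ := fun v => g0 v + L (g1 v)
  have hg0 : ContDiff ℝ ∞ g0 := (contDiff_rexp_neg_norm_sq 1).smul contDiff_const
  have hg1 : ContDiff ℝ ∞ g1 := (contDiff_rexp_neg_norm_sq 1).smul contDiff_id
  have hL : ‖L‖ ≤ ‖ξ‖ ^ (κ / 2 - 1) := by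
    have h2 : ‖Complex.I • (Complex.ofRealCLM ∘L innerSL ℝ ξ)‖ ≤ ‖ξ‖ := by
      rw [norm_smul, Complex.norm_I, one_mul]
      refine (ContinuousLinearMap.opNorm_comp_le _ _).trans ?_
      rw [Complex.ofRealCLM_norm, one_mul, innerSL_apply_norm]
    rw [norm_smul, Real.norm_of_nonneg (by positivity),
      show κ / 2 - 1 = κ / 2 - 2 + 1 by ring, Real.rpow_add_one hξ0.ne']
    calc _ ≤ 1 * ‖ξ‖ ^ (κ / 2 - 2) * ‖ξ‖ := by gcongr
      _ = _ := by ring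
  have hγ : ContDiff ℝ ∞ γ := hg0.add (L.contDiff.comp hg1)
  have hγb : ∀ j ≤ k, ∀ v, ‖iteratedFDeriv ℝ j γ v‖ ≤ M * (1 + ‖ξ‖ ^ (κ / 2 - 1)) := by
    intro j hj v
    have e1 : iteratedFDeriv ℝ j γ v = iteratedFDeriv ℝ j g0 v + iteratedFDeriv ℝ j (L ∘ g1) v :=
      iteratedFDeriv_add_apply (hg0.of_le (by exact_mod_cast le_top)).contDiffAt
        ((L.contDiff.comp hg1).of_le (by exact_mod_cast le_top)).contDiffAt
    have e2 := L.norm_iteratedFDeriv_comp_left (f := g1) (x := v) (n := j) hg1.contDiffAt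
      (by exact_mod_cast le_top)
    have e3 : 0 ≤ ‖ξ‖ ^ (κ / 2 - 1) := by positivity
    calc ‖iteratedFDeriv ℝ j γ v‖ ≤ C0 j + ‖ξ‖ ^ (κ / 2 - 1) * C1 j := by
          rw [e1]
          refine (norm_add_le _ _).trans (add_le_add (h0 j v) (e2.trans ?_))
          gcongr
          exact h1 j v
      _ ≤ M + ‖ξ‖ ^ (κ / 2 - 1) * M := by
          have := hM j hj
          have := hC0 j
          have := hC1 j
          gcongr <;> linarith
      _ = _ := by ring
  have hγτ : ContDiff ℝ ∞ fun w => γ (τ • w) := hγ.comp (contDiff_const.smul contDiff_id)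
  have heq : (fun w => planeKernel κ w ξ) =
      fun w => Complex.exp (Complex.I * (⟪ξ, w⟫ : ℝ)) * γ (τ • w) := by
    funext w
    have e4 : ‖ξ‖ ^ (κ - 2) = ‖ξ‖ ^ (κ / 2 - 2) * τ := by
      rw [hτdef, ← Real.rpow_add hξ0]
      ring_nf
    have e5 : L (g1 (τ • w)) = (κ * ‖ξ‖ ^ (κ / 2 - 2)) • (Complex.I •
        ((⟪ξ, Real.exp (-1 * ‖τ • w‖ ^ 2) • τ • w⟫ : ℝ) : ℂ)) := rfl
    have e6 : ‖τ • w‖ ^ 2 = ‖ξ‖ ^ κ * ‖w‖ ^ 2 := by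
      rw [norm_smul, mul_pow, Real.norm_of_nonneg hτ.le, hτ2]
    simp only [planeKernel, γ, e5, g0]
    rw [e6, e4, inner_smul_right, inner_smul_right]
    simp only [Complex.real_smul, smul_eq_mul, neg_mul, one_mul]
    push_cast
    ring
  have hK : ContDiff ℝ ∞ fun w => planeKernel κ w ξ := by
    rw [heq]
    exact (contDiff_cexp_inner ξ).mul hγτ
  have hKb : ∀ w, ‖iteratedFDeriv ℝ k (fun w => planeKernel κ w ξ) w‖ ≤
      (∑ i ∈ Finset.range (k + 1), (k.choose i : ℝ)) * M *
        ((1 + ‖ξ‖) ^ k * (1 + ‖ξ‖ ^ (κ / 2 - 1))) := by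
    intro w
    rw [heq, Finset.sum_mul, Finset.sum_mul]
    refine (norm_iteratedFDeriv_mul_le (contDiff_cexp_inner ξ) hγτ w
      (by exact_mod_cast le_top)).trans (Finset.sum_le_sum fun i hi => ?_)
    have hik : i ≤ k := by simpa [Nat.lt_succ_iff] using hi
    have e7 := norm_iteratedFDeriv_comp_const_smul_le hγ hτ.le (k - i) (hγb (k - i) (by omega)) w
    have e8 := norm_rpow_half_le_one_add hκ0 hκ1 ξ
    have e9 : 0 ≤ ‖ξ‖ ^ (κ / 2 - 1) := by positivity
    calc _ ≤ (k.choose i : ℝ) * ‖ξ‖ ^ i * (τ ^ (k - i) * (M * (1 + ‖ξ‖ ^ (κ / 2 - 1)))) := by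
          gcongr
          exact norm_iteratedFDeriv_cexp_inner_le ξ i w
      _ ≤ (k.choose i : ℝ) * (1 + ‖ξ‖) ^ i *
          ((1 + ‖ξ‖) ^ (k - i) * (M * (1 + ‖ξ‖ ^ (κ / 2 - 1)))) := by
          gcongr
          linarith
      _ = (k.choose i : ℝ) * ((1 + ‖ξ‖) ^ i * (1 + ‖ξ‖) ^ (k - i)) *
          (M * (1 + ‖ξ‖ ^ (κ / 2 - 1))) := by ring
      _ = _ := by
          rw [← pow_add, Nat.add_sub_cancel' hik]
          ring
  have hx : (fun y => planeKernel κ (x - y) ξ) =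
      fun y => (fun v => planeKernel κ (x + v) ξ) ((-1 : ℝ) • y) := by
    funext y
    simp only [neg_smul, one_smul, sub_eq_add_neg]
  have hKx : ContDiff ℝ ∞ fun v => planeKernel κ (x + v) ξ :=
    hK.comp (contDiff_const.add contDiff_id)
  rw [hx, iteratedFDeriv_comp_const_smul (-1 : ℝ) (hKx.of_le (by exact_mod_cast le_top)),
    norm_smul, norm_pow, norm_neg, norm_one, one_pow, one_mul,
    iteratedFDeriv_comp_add_left (f := fun w => planeKernel κ w ξ)]
  exact hKb _

end PlaneKernel

/-! ### The double integral -/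

section DoubleIntegral

open scoped RealInnerProductSpace

variable {E : Type} [NormedAddCommGroup E] [InnerProductSpace ℝ E]

/-- The modulus of `inversionWeight`. -/
def weightNorm (κ ε : ℝ) (x : E) (p : E × E) : ℝ :=
  Real.exp (-(‖p.2‖ ^ κ * ‖x - p.1‖ ^ 2)) * Real.exp (-ε * ‖p.2‖ ^ 2) *
    ‖p.2‖ ^ (κ * Module.finrank ℝ E / 2)

/-- The factor `e^{i⟨ξ,x-x'⟩ - |ξ|^κ |x-x'|² - ε|ξ|²} |ξ|^{κm/2}` of the integrand at
`p = (x', ξ)`. -/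
def inversionWeight (κ ε : ℝ) (x : E) (p : E × E) : ℂ :=
  Complex.exp (Complex.I * (⟪p.2, x - p.1⟫ : ℝ)) * (weightNorm κ ε x p : ℝ)

theorem weightNorm_nonneg (κ ε : ℝ) (x : E) (p : E × E) : 0 ≤ weightNorm κ ε x p := by
  unfold weightNorm
  positivity

theorem norm_inversionWeight (κ ε : ℝ) (x : E) (p : E × E) :
    ‖inversionWeight κ ε x p‖ = weightNorm κ ε x p := by
  rw [inversionWeight, norm_mul, norm_cexp_I_inner, one_mul, Complex.norm_real,
    Real.norm_of_nonneg (weightNorm_nonneg κ ε x p)]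

theorem inversionWeight_mul_planeKernel {κ : ℝ} (ε : ℝ) (x y x' ξ : E) :
    inversionWeight κ ε x (x', ξ) * planeKernel κ (x' - y) ξ =
      (Complex.exp (Complex.I * (⟪ξ, x - y⟫ : ℝ)) *
        (Real.exp (-ε * ‖ξ‖ ^ 2) * ‖ξ‖ ^ (κ * Module.finrank ℝ E / 2) : ℝ)) *
      ((Real.exp (-(‖ξ‖ ^ κ * ‖x - x'‖ ^ 2)) * Real.exp (-(‖ξ‖ ^ κ * ‖x' - y‖ ^ 2)) : ℝ) *
        (1 + Complex.I * (⟪(κ * ‖ξ‖ ^ (κ - 2)) • ξ, x' - y⟫ : ℝ))) := by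
  have h : Complex.exp (Complex.I * (⟪ξ, x - y⟫ : ℝ)) =
      Complex.exp (Complex.I * (⟪ξ, x - x'⟫ : ℝ)) *
        Complex.exp (Complex.I * (⟪ξ, x' - y⟫ : ℝ)) := by
    rw [← Complex.exp_add, ← mul_add, ← Complex.ofReal_add, ← inner_add_right, sub_add_sub_cancel]
  rw [h, inner_smul_left]
  simp only [inversionWeight, weightNorm, planeKernel, conj_trivial]
  push_cast
  ring

variable [FiniteDimensional ℝ E]

theorem norm_planeKernel_le {κ : ℝ} (hκ0 : 0 < κ) (hκ1 : κ ≤ 1) :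
    ∃ C, 0 ≤ C ∧ ∀ x ξ : E, ξ ≠ 0 → ∀ y,
      ‖planeKernel κ (x - y) ξ‖ ≤ C * ((1 + ‖ξ‖) ^ 0 * (1 + ‖ξ‖ ^ (κ / 2 - 1))) := by
  obtain ⟨C, hC, h⟩ := exists_norm_iteratedFDeriv_planeKernel_le (E := E) hκ0 hκ1 0
  refine ⟨C, hC, fun x ξ hξ y => ?_⟩
  have := h x ξ hξ y
  rwa [norm_iteratedFDeriv_zero] at this

variable [MeasurableSpace E] [BorelSpace E]

theorem measurable_weightNorm (κ ε : ℝ) :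
    Measurable fun q : E × (E × E) => weightNorm κ ε q.1 q.2 := by
  unfold weightNorm
  fun_prop

theorem measurable_inversionWeight (κ ε : ℝ) :
    Measurable fun q : E × (E × E) => inversionWeight κ ε q.1 q.2 := by
  have := measurable_weightNorm (E := E) κ ε
  unfold inversionWeight
  fun_prop

theorem integrable_rexp_neg_mul_norm_sq {b : ℝ} (hb : 0 < b) :
    Integrable fun v : E => Real.exp (-b * ‖v‖ ^ 2) := by
  have h := GaussianFourier.integrable_cexp_neg_mul_sq_norm_add (V := E) (b := (b : ℂ))
    (by simpa using hb) 0 0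
  refine h.norm.congr (.of_forall fun v => ?_)
  simp only [zero_mul, add_zero]
  rw [Complex.norm_exp]
  congr 1
  norm_cast

theorem integral_weight_slice {κ : ℝ} {ξ : E} (hξ : ξ ≠ 0) (x : E) :
    Integrable (fun x' : E => Real.exp (-(‖ξ‖ ^ κ * ‖x - x'‖ ^ 2))) ∧
    (∫ x' : E, Real.exp (-(‖ξ‖ ^ κ * ‖x - x'‖ ^ 2))) * ‖ξ‖ ^ (κ * Module.finrank ℝ E / 2) =
      Real.pi ^ ((Module.finrank ℝ E : ℝ) / 2) := by
  have hξ0 : 0 < ‖ξ‖ := norm_pos_iff.2 hξ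
  have hl : 0 < ‖ξ‖ ^ κ := Real.rpow_pos_of_pos hξ0 _
  have h1 := integrable_rexp_neg_mul_norm_sq (E := E) hl
  simp only [← neg_mul]
  refine ⟨h1.comp_sub_left x, ?_⟩
  rw [integral_sub_left_eq_self (fun v => Real.exp (-‖ξ‖ ^ κ * ‖v‖ ^ 2)),
    GaussianFourier.integral_rexp_neg_mul_sq_norm hl, Real.div_rpow Real.pi_pos.le hl.le,
    ← Real.rpow_mul hξ0.le, mul_div_assoc κ]
  exact div_mul_cancel₀ _ (Real.rpow_pos_of_pos hξ0 _).ne'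

variable [Nontrivial E]

theorem integrable_weightNorm_mul {κ ε : ℝ} (hκ0 : 0 < κ) (hε : 0 < ε) (k : ℕ) (x : E) :
    Integrable (fun p : E × E =>
      weightNorm κ ε x p * ((1 + ‖p.2‖) ^ k * (1 + ‖p.2‖ ^ (κ / 2 - 1)))) ∧
    ∫ p : E × E, weightNorm κ ε x p * ((1 + ‖p.2‖) ^ k * (1 + ‖p.2‖ ^ (κ / 2 - 1))) =
      ∫ ξ : E, Real.pi ^ ((Module.finrank ℝ E : ℝ) / 2) *
        (Real.exp (-ε * ‖ξ‖ ^ 2) * ((1 + ‖ξ‖) ^ k * (1 + ‖ξ‖ ^ (κ / 2 - 1)))) := by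
  have hm : Measurable fun p : E × E =>
      weightNorm κ ε x p * ((1 + ‖p.2‖) ^ k * (1 + ‖p.2‖ ^ (κ / 2 - 1))) :=
    ((measurable_weightNorm κ ε).comp (by fun_prop : Measurable fun p : E × E => (x, p))).mul
      (by fun_prop)
  have hs : ∀ x' ξ : E, weightNorm κ ε x (x', ξ) * ((1 + ‖ξ‖) ^ k * (1 + ‖ξ‖ ^ (κ / 2 - 1))) =
      Real.exp (-(‖ξ‖ ^ κ * ‖x - x'‖ ^ 2)) * (‖ξ‖ ^ (κ * Module.finrank ℝ E / 2) *
        (Real.exp (-ε * ‖ξ‖ ^ 2) * ((1 + ‖ξ‖) ^ k * (1 + ‖ξ‖ ^ (κ / 2 - 1))))) := fun x' ξ => by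
    unfold weightNorm
    ring
  have hint : ∀ ξ : E, ξ ≠ 0 → ∫ x' : E, weightNorm κ ε x (x', ξ) *
      ((1 + ‖ξ‖) ^ k * (1 + ‖ξ‖ ^ (κ / 2 - 1))) = Real.pi ^ ((Module.finrank ℝ E : ℝ) / 2) *
        (Real.exp (-ε * ‖ξ‖ ^ 2) * ((1 + ‖ξ‖) ^ k * (1 + ‖ξ‖ ^ (κ / 2 - 1)))) := fun ξ hξ => by
    simp only [hs]
    rw [integral_mul_const, ← mul_assoc, (integral_weight_slice hξ x).2]
  have hi : Integrable (fun p : E × E =>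
      weightNorm κ ε x p * ((1 + ‖p.2‖) ^ k * (1 + ‖p.2‖ ^ (κ / 2 - 1)))) := by
    rw [Measure.volume_eq_prod, integrable_prod_iff' hm.aestronglyMeasurable]
    constructor
    · filter_upwards [ae_ne_zero] with ξ hξ
      simp only [hs]
      exact (integral_weight_slice hξ x).1.mul_const _
    · refine ((integrable_gaussian_mul_growth (E := E) (μ := volume) hε k
        (neg_finrank_lt (s := κ / 2 - 1) (by linarith))).const_mul
          (Real.pi ^ ((Module.finrank ℝ E : ℝ) / 2))).congr ?_
      filter_upwards [ae_ne_zero] with ξ hξ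
      rw [← hint ξ hξ]
      refine integral_congr_ae (.of_forall fun x' => ?_)
      have := weightNorm_nonneg κ ε x (x', ξ)
      simp only
      rw [Real.norm_of_nonneg (by positivity)]
  refine ⟨hi, ?_⟩
  rw [Measure.volume_eq_prod, integral_prod_symm _ hi]
  exact integral_congr_ae (ae_ne_zero.mono fun ξ hξ => hint ξ hξ)

/-- The integrability of `integrable_weightNorm_mul` after one more integration, against an
integrable function of `x`; the integral in `p` does not depend on `x`. -/
theorem integrable_mul_weightNorm_mul {κ ε : ℝ} (hκ0 : 0 < κ) (hε : 0 < ε) (k : ℕ) {b : E → ℝ}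
    (hb : Integrable b) :
    Integrable fun q : E × (E × E) => b q.1 *
      (weightNorm κ ε q.1 q.2 * ((1 + ‖q.2.2‖) ^ k * (1 + ‖q.2.2‖ ^ (κ / 2 - 1)))) := by
  have hm : AEStronglyMeasurable (fun q : E × (E × E) => b q.1 *
      (weightNorm κ ε q.1 q.2 * ((1 + ‖q.2.2‖) ^ k * (1 + ‖q.2.2‖ ^ (κ / 2 - 1)))))
      (volume.prod volume) :=
    hb.aestronglyMeasurable.comp_fst.mul
      ((measurable_weightNorm κ ε).mul (by fun_prop)).aestronglyMeasurable
  rw [Measure.volume_eq_prod, integrable_prod_iff hm]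
  constructor
  · exact .of_forall fun x => (integrable_weightNorm_mul hκ0 hε k x).1.const_mul (b x)
  · refine (hb.norm.mul_const (∫ ξ : E, Real.pi ^ ((Module.finrank ℝ E : ℝ) / 2) *
        (Real.exp (-ε * ‖ξ‖ ^ 2) * ((1 + ‖ξ‖) ^ k * (1 + ‖ξ‖ ^ (κ / 2 - 1)))))).congr
      (.of_forall fun x => ?_)
    simp only
    rw [← (integrable_weightNorm_mul hκ0 hε k x).2, ← integral_const_mul]
    refine integral_congr_ae (.of_forall fun p => ?_)
    have := weightNorm_nonneg κ ε x p
    simp only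
    rw [norm_mul, Real.norm_of_nonneg (r := weightNorm κ ε x p * _) (by positivity)]

/-- The Gaussian integral in `x'`: the first-order term is odd about the midpoint of `x` and `y`. -/
theorem integral_gaussian_midpoint {l : ℝ} (hl : 0 < l) (θ x y : E) :
    ∫ x' : E, (Real.exp (-(l * ‖x - x'‖ ^ 2)) * Real.exp (-(l * ‖x' - y‖ ^ 2)) : ℝ) *
        (1 + Complex.I * (⟪θ, x' - y⟫ : ℝ)) =
      ((Real.pi / (2 * l)) ^ ((Module.finrank ℝ E : ℝ) / 2) : ℝ) *
        ((Real.exp (-(l * (‖x - y‖ ^ 2 / 2))) : ℝ) *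
          (1 + Complex.I * (2⁻¹ * ⟪θ, x - y⟫ : ℝ))) := by
  have h1 : ∀ v : E, (Real.exp (-(l * ‖x - (v + (2 : ℝ)⁻¹ • (x + y))‖ ^ 2)) *
      Real.exp (-(l * ‖(v + (2 : ℝ)⁻¹ • (x + y)) - y‖ ^ 2)) : ℝ) *
        (1 + Complex.I * (⟪θ, (v + (2 : ℝ)⁻¹ • (x + y)) - y⟫ : ℝ)) =
      ((Real.exp (-(l * (‖x - y‖ ^ 2 / 2))) : ℝ) * (1 + Complex.I * (2⁻¹ * ⟪θ, x - y⟫ : ℝ))) *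
        (Real.exp (-(2 * l) * ‖v‖ ^ 2) : ℝ) +
      ((Real.exp (-(l * (‖x - y‖ ^ 2 / 2))) : ℝ) * Complex.I) *
        ((Real.exp (-(2 * l) * ‖v‖ ^ 2) * ⟪θ, v⟫ : ℝ) : ℂ) := by
    intro v
    have e1 : x - (v + (2 : ℝ)⁻¹ • (x + y)) = (2 : ℝ)⁻¹ • (x - y) - v := by module
    have e2 : (v + (2 : ℝ)⁻¹ • (x + y)) - y = (2 : ℝ)⁻¹ • (x - y) + v := by module
    have e3 : Real.exp (-(l * ‖(2 : ℝ)⁻¹ • (x - y) - v‖ ^ 2)) *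
        Real.exp (-(l * ‖(2 : ℝ)⁻¹ • (x - y) + v‖ ^ 2)) =
        Real.exp (-(l * (‖x - y‖ ^ 2 / 2))) * Real.exp (-(2 * l) * ‖v‖ ^ 2) := by
      rw [← Real.exp_add, ← Real.exp_add, norm_add_sq_real, norm_sub_sq_real, norm_smul]
      congr 1
      rw [Real.norm_of_nonneg (by norm_num)]
      ring
    rw [e1, e2, e3, inner_add_right, inner_smul_right]
    push_cast
    ring
  have hg := integrable_rexp_neg_mul_norm_sq (E := E) (b := 2 * l) (by positivity)
  have hodd : Integrable fun v : E => Real.exp (-(2 * l) * ‖v‖ ^ 2) * ⟪θ, v⟫ := by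
    have hb := (integrable_gaussian_pow (E := E) (ε := 2 * l) (by positivity) 1).const_mul ‖θ‖
    refine hb.mono' (by fun_prop) (.of_forall fun v => ?_)
    rw [norm_mul, Real.norm_of_nonneg (Real.exp_nonneg _), Real.norm_eq_abs]
    calc _ ≤ Real.exp (-(2 * l) * ‖v‖ ^ 2) * (‖θ‖ * ‖v‖) := by
          gcongr
          exact abs_real_inner_le_norm θ v
      _ ≤ Real.exp (-(2 * l) * ‖v‖ ^ 2) * (‖θ‖ * (1 + ‖v‖)) := by
          gcongr
          linarith
      _ = _ := by ring
  have hodd0 : ∫ v : E, Real.exp (-(2 * l) * ‖v‖ ^ 2) * ⟪θ, v⟫ = 0 := by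
    have h2 := integral_neg_eq_self (fun v : E => Real.exp (-(2 * l) * ‖v‖ ^ 2) * ⟪θ, v⟫) volume
    simp only [norm_neg, inner_neg_right, mul_neg, integral_neg] at h2
    linarith
  rw [← integral_add_right_eq_self _ ((2 : ℝ)⁻¹ • (x + y)), integral_congr_ae (.of_forall h1),
    integral_add (hg.ofReal.const_mul _) (hodd.ofReal.const_mul _), integral_const_mul,
    integral_const_mul, integral_complex_ofReal, integral_complex_ofReal, hodd0,
    GaussianFourier.integral_rexp_neg_mul_sq_norm (by positivity)]
  simp only [Complex.ofReal_zero, mul_zero, add_zero]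
  ring

/-- The integration in `x'` turns the kernel of the double integral into `reproducingKernel`. -/
theorem integral_inversionWeight_mul_planeKernel {κ ε : ℝ} (hκ0 : 0 < κ) (hκ1 : κ ≤ 1)
    (hε : 0 < ε) (x y : E) :
    ((1 / (2 * Real.pi ^ 3) ^ ((Module.finrank ℝ E : ℝ) / 2) : ℝ) : ℂ) *
      ∫ p : E × E, inversionWeight κ ε x p * planeKernel κ (p.1 - y) p.2 =
      reproducingKernel κ ε (x - y) := by
  obtain ⟨C, hC, hK⟩ := norm_planeKernel_le (E := E) hκ0 hκ1
  have hae : ∀ᵐ p : E × E ∂(volume.prod volume), p.2 ≠ 0 :=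
    Measure.quasiMeasurePreserving_snd.ae ae_ne_zero
  have hi : Integrable (fun p : E × E => inversionWeight κ ε x p * planeKernel κ (p.1 - y) p.2)
      (volume.prod volume) := by
    refine ((integrable_weightNorm_mul hκ0 hε 0 x).1.const_mul C).mono' ?_ (hae.mono fun p hp => ?_)
    · have h1 := (measurable_inversionWeight (E := E) κ ε).comp
        (by fun_prop : Measurable fun p : E × E => (x, p))
      have h2 : Measurable fun p : E × E => planeKernel κ (p.1 - y) p.2 := by
        unfold planeKernel
        fun_prop
      exact (h1.mul h2).aestronglyMeasurable
    · rw [norm_mul, norm_inversionWeight]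
      have := weightNorm_nonneg κ ε x p
      calc _ ≤ weightNorm κ ε x p * (C * ((1 + ‖p.2‖) ^ 0 * (1 + ‖p.2‖ ^ (κ / 2 - 1)))) := by
            gcongr
            exact hK _ _ hp _
        _ = _ := by ring
  have hslice : ∀ ξ : E, ξ ≠ 0 →
      ∫ x' : E, inversionWeight κ ε x (x', ξ) * planeKernel κ (x' - y) ξ =
        ((Real.pi / 2) ^ ((Module.finrank ℝ E : ℝ) / 2)) •
          (Real.exp (-ε * ‖ξ‖ ^ 2) • amplitude κ (x - y) ξ) := by
    intro ξ hξ
    have hξ0 : 0 < ‖ξ‖ := norm_pos_iff.2 hξ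
    have hl : 0 < ‖ξ‖ ^ κ := Real.rpow_pos_of_pos hξ0 _
    simp only [inversionWeight_mul_planeKernel]
    rw [integral_const_mul, integral_gaussian_midpoint hl, inner_smul_left]
    have e1 : (Real.pi / (2 * ‖ξ‖ ^ κ)) ^ ((Module.finrank ℝ E : ℝ) / 2) *
        ‖ξ‖ ^ (κ * Module.finrank ℝ E / 2) = (Real.pi / 2) ^ ((Module.finrank ℝ E : ℝ) / 2) := by
      rw [← div_div, Real.div_rpow (by positivity) hl.le, ← Real.rpow_mul hξ0.le, mul_div_assoc κ]
      exact div_mul_cancel₀ _ (Real.rpow_pos_of_pos hξ0 _).ne'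
    rw [← e1]
    simp only [amplitude, Complex.real_smul, conj_trivial]
    push_cast
    ring
  rw [Measure.volume_eq_prod, integral_prod_symm _ hi,
    integral_congr_ae (ae_ne_zero.mono hslice), integral_smul, reproducingKernel,
    ← Complex.real_smul, smul_smul]
  congr 1
  have e2 : ((2 * Real.pi) ^ Module.finrank ℝ E)⁻¹ =
      ((2 * Real.pi) ^ (-2 : ℝ)) ^ ((Module.finrank ℝ E : ℝ) / 2) := by
    rw [← Real.rpow_mul (by positivity), ← Real.rpow_natCast, ← Real.rpow_neg (by positivity)]
    congr 1
    ring
  rw [e2, one_div, ← Real.inv_rpow (by positivity), ← Real.mul_rpow (by positivity) (by positivity)]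
  congr 1
  rw [Real.rpow_neg (by positivity), Real.rpow_two]
  field_simp

end DoubleIntegral

/-! ### The smoothing operators on test functions -/

section SmoothingOperators

variable {m : ℕ} {V : Opens (EuclideanSpace ℝ (Fin m))}

theorem hasCompactSupport_ofReal_test (ψ : 𝓓(V, ℝ)) : HasCompactSupport fun x => (ψ x : ℂ) :=
  ψ.hasCompactSupport.comp_left (g := fun r : ℝ => (r : ℂ)) Complex.ofReal_zero

theorem integrable_smul_translate {E F : Type*} [NormedAddCommGroup E] [NormedSpace ℝ E]
    [FiniteDimensional ℝ E] [MeasurableSpace E] [BorelSpace E] {μ : Measure E}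
    [IsFiniteMeasureOnCompacts μ] [NormedAddCommGroup F] [NormedSpace ℂ F] {G : E → ℂ} {f : E → F}
    (hG : Continuous G) (hf : Continuous f) (hc : HasCompactSupport f) (y : E) :
    Integrable (fun w => G w • f (y + w)) μ :=
  (hG.smul (hf.comp (continuous_const.add continuous_id))).integrable_of_hasCompactSupport
    (HasCompactSupport.smul_left (hc.comp_homeomorph (Homeomorph.addLeft y)))

theorem contDiff_smoothing {G : EuclideanSpace ℝ (Fin m) → ℂ} (hG : Continuous G) (ψ : 𝓓(V, ℝ)) :
    ContDiff ℝ ∞ fun y => ∫ w, G w • (ψ (y + w) : ℂ) :=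
  (iteratedFDeriv_integral_smul_translate hG (SmoothFun.contDiff_ofReal_test ψ)
    (hasCompactSupport_ofReal_test ψ)).1

/-- The operator `ψ ↦ ∫ G(w) ψ(· + w) dw` from `𝓓(V)` to `C^∞(V)`, for a continuous kernel `G`. -/
def smoothingLin (V : Opens (EuclideanSpace ℝ (Fin m))) (G : EuclideanSpace ℝ (Fin m) → ℂ)
    (hG : Continuous G) : 𝓓(V, ℝ) →ₗ[ℝ] SmoothFun V where
  toFun ψ := SmoothFun.ofFun V fun y => ∫ w, G w • (ψ (y + w) : ℂ)
  map_add' ψ χ := SmoothFun.ext_on fun y hy => by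
    have hi : ∀ ψ : 𝓓(V, ℝ), Integrable fun w => G w • (ψ (y + w) : ℂ) := fun ψ =>
      integrable_smul_translate hG (SmoothFun.contDiff_ofReal_test ψ).continuous
        (hasCompactSupport_ofReal_test ψ) y
    refine (SmoothFun.ofFun_apply (contDiff_smoothing hG _).contDiffOn hy).trans ?_
    refine Eq.trans ?_ (congrArg₂ (· + ·)
      (SmoothFun.ofFun_apply (contDiff_smoothing hG ψ).contDiffOn hy)
      (SmoothFun.ofFun_apply (contDiff_smoothing hG χ).contDiffOn hy)).symm
    rw [← integral_add (hi ψ) (hi χ)]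
    refine integral_congr_ae (.of_forall fun w => ?_)
    simp [mul_add]
  map_smul' c ψ := SmoothFun.ext_on fun y hy => by
    refine (SmoothFun.ofFun_apply (contDiff_smoothing hG _).contDiffOn hy).trans ?_
    refine Eq.trans ?_ (congrArg (fun z => (c : ℂ) * z)
      (SmoothFun.ofFun_apply (contDiff_smoothing hG ψ).contDiffOn hy)).symm
    rw [← integral_const_mul]
    refine integral_congr_ae (.of_forall fun w => ?_)
    have h : (c • ψ) (y + w) = c * ψ (y + w) := rfl
    simp only [h, smul_eq_mul]
    push_cast
    ring

theorem iteratedFDeriv_smoothingLin {G : EuclideanSpace ℝ (Fin m) → ℂ} (hG : Continuous G)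
    (ψ : 𝓓(V, ℝ)) (k : ℕ) {y : EuclideanSpace ℝ (Fin m)} (hy : y ∈ V) :
    iteratedFDeriv ℝ k (smoothingLin V G hG ψ) y =
      ∫ w, G w • iteratedFDeriv ℝ k (fun x => (ψ x : ℂ)) (y + w) := by
  rw [← congrFun ((iteratedFDeriv_integral_smul_translate hG
    (SmoothFun.contDiff_ofReal_test ψ) (hasCompactSupport_ofReal_test ψ)).2 k) y]
  refine (Filter.EventuallyEq.iteratedFDeriv ℝ ?_ k).eq_of_nhds
  filter_upwards [V.isOpen.mem_nhds hy] with z hz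
  exact SmoothFun.ofFun_apply (contDiff_smoothing hG ψ).contDiffOn hz

theorem exists_norm_iteratedFDeriv_smoothingLin_le {G : EuclideanSpace ℝ (Fin m) → ℂ}
    (hG : Continuous G) (hb : ∃ C, 0 ≤ C ∧ ∀ w, ‖G w‖ ≤ C) (k : ℕ) :
    ∃ q : 𝓓(V, ℝ) → ℝ, Continuous q ∧ q 0 = 0 ∧
      ∀ ψ, ∀ y ∈ V, ‖iteratedFDeriv ℝ k (smoothingLin V G hG ψ) y‖ ≤ q ψ := by
  obtain ⟨C, hC, hGC⟩ := hb
  refine ⟨fun ψ => C * ∫ x, ‖iteratedFDeriv ℝ k (fun x => (ψ x : ℂ)) x‖,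
    continuous_const.mul (continuous_integral_norm_iteratedFDeriv k), ?_, fun ψ y hy => ?_⟩
  · have h0 : (fun x => (((0 : 𝓓(V, ℝ)) x : ℝ) : ℂ)) = fun _ => 0 := by
      funext x
      simp
    have h1 : iteratedFDeriv ℝ k (fun _ : EuclideanSpace ℝ (Fin m) => (0 : ℂ)) = 0 :=
      iteratedFDeriv_fun_zero
    simp only [h0, h1]
    simp
  · rw [iteratedFDeriv_smoothingLin hG ψ k hy]
    have h2 : Integrable fun w => C * ‖iteratedFDeriv ℝ k (fun x => (ψ x : ℂ)) (y + w)‖ :=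
      ((integrable_norm_iteratedFDeriv (SmoothFun.contDiff_ofReal_test ψ)
        (hasCompactSupport_ofReal_test ψ) k).comp_add_left y).const_mul C
    refine (norm_integral_le_of_norm_le h2 (.of_forall fun w => ?_)).trans (le_of_eq ?_)
    · rw [norm_smul]
      exact mul_le_mul_of_nonneg_right (hGC w) (norm_nonneg _)
    · rw [integral_const_mul, integral_add_left_eq_self
        (fun w => ‖iteratedFDeriv ℝ k (fun x => (ψ x : ℂ)) w‖)]

/-- `smoothingLin` is continuous if the kernel is bounded. -/
def smoothingCLM (V : Opens (EuclideanSpace ℝ (Fin m))) (G : EuclideanSpace ℝ (Fin m) → ℂ)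
    (hG : Continuous G) (hb : ∃ C, 0 ≤ C ∧ ∀ w, ‖G w‖ ≤ C) : 𝓓(V, ℝ) →L[ℝ] SmoothFun V :=
  smoothFunMkCLM (smoothingLin V G hG) (exists_norm_iteratedFDeriv_smoothingLin_le hG hb)

theorem smoothingCLM_apply (G : EuclideanSpace ℝ (Fin m) → ℂ) (hG : Continuous G)
    (hb : ∃ C, 0 ≤ C ∧ ∀ w, ‖G w‖ ≤ C) (ψ : 𝓓(V, ℝ)) :
    smoothingCLM V G hG hb ψ = SmoothFun.ofFun V fun y => ∫ w, G w • (ψ (y + w) : ℂ) := rfl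

/-- The smoothing operators of the reproducing kernels tend to the inclusion `𝓓(V) ⊆ C^∞(V)`, at
the rate `ε`. -/
theorem exists_norm_iteratedFDeriv_smoothingCLM_sub_le [Nontrivial (EuclideanSpace ℝ (Fin m))]
    {κ : ℝ} (hκ0 : 0 < κ) (hκ1 : κ ≤ 1) (k : ℕ) :
    ∃ q : 𝓓(V, ℝ) → ℝ, Continuous q ∧ ∀ ε, 0 < ε → ∀ hG hb ψ, ∀ y ∈ V,
      ‖iteratedFDeriv ℝ k (smoothingCLM V (reproducingKernel κ ε) hG hb ψ - ofTestCLM V ψ :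
        SmoothFun V) y‖ ≤ ε * q ψ := by
  obtain ⟨N, C, hC, h⟩ := exists_norm_integral_reproducingKernel_sub_le (EuclideanSpace ℝ (Fin m))
    (ContinuousMultilinearMap ℝ (fun _ : Fin k => EuclideanSpace ℝ (Fin m)) ℂ) hκ0 hκ1
  refine ⟨fun ψ => C * ∑ j ∈ Finset.range (N + 1),
    ∫ x, ‖iteratedFDeriv ℝ (j + k) (fun x => (ψ x : ℂ)) x‖, ?_, fun ε hε hG hb ψ y hy => ?_⟩
  · exact continuous_const.mul (continuous_finsetSum _ fun j _ =>
      continuous_integral_norm_iteratedFDeriv (j + k))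
  set f : EuclideanSpace ℝ (Fin m) → ℂ := fun x => (ψ x : ℂ) with hf
  have hfs : ContDiff ℝ ∞ f := SmoothFun.contDiff_ofReal_test ψ
  have hfc : HasCompactSupport f := hasCompactSupport_ofReal_test ψ
  obtain ⟨hs, hd⟩ := iteratedFDeriv_integral_smul_translate (μ := volume) hG hfs hfc
  have h1 : iteratedFDeriv ℝ k (smoothingCLM V (reproducingKernel κ ε) hG hb ψ - ofTestCLM V ψ :
      SmoothFun V) y =
      (∫ w, reproducingKernel κ ε w • iteratedFDeriv ℝ k f (y + w)) - iteratedFDeriv ℝ k f y := by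
    rw [← congrFun (hd k) y, ← iteratedFDeriv_sub_apply
      (hs.of_le (by exact_mod_cast le_top)).contDiffAt
      (hfs.of_le (by exact_mod_cast le_top)).contDiffAt]
    refine (Filter.EventuallyEq.iteratedFDeriv ℝ ?_ k).eq_of_nhds
    filter_upwards [V.isOpen.mem_nhds hy] with z hz
    change (smoothingCLM V (reproducingKernel κ ε) hG hb ψ) z - SmoothFun.ofTest ψ z = _
    rw [smoothingCLM_apply, SmoothFun.ofFun_apply hs.contDiffOn hz, SmoothFun.ofTest_apply ψ hz]
    rfl
  rw [h1]
  refine (h (iteratedFDeriv ℝ k f)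
    (hfs.iteratedFDeriv_right (m := ∞) (i := k) (by exact_mod_cast le_top))
    (hfc.iteratedFDeriv k) ε hε y).trans (le_of_eq ?_)
  simp only [norm_iteratedFDeriv_iteratedFDeriv]
  rfl

end SmoothingOperators

/-! ### The transform in real coordinates -/

section RealCoordinates

open scoped RealInnerProductSpace

variable {m n : ℕ}

theorem tubeZ_sub_tubeZ (φ : EuclideanSpace ℝ (Fin n) → EuclideanSpace ℝ (Fin m))
    (x y : EuclideanSpace ℝ (Fin m)) (t : EuclideanSpace ℝ (Fin n)) :
    tubeZ φ x t - tubeZ φ y t = fun k => (((x - y) k : ℝ) : ℂ) := by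
  funext k
  simp [tubeZ]

theorem realDot_ofReal (ξ w : EuclideanSpace ℝ (Fin m)) :
    realDot ξ (fun k => ((w k : ℝ) : ℂ)) = (⟪ξ, w⟫ : ℝ) := by
  rw [realDot, PiLp.inner_apply]
  push_cast
  refine Finset.sum_congr rfl fun k _ => ?_
  simp [mul_comm]

theorem sqBracket_ofReal (w : EuclideanSpace ℝ (Fin m)) :
    sqBracket (fun k => ((w k : ℝ) : ℂ)) = (‖w‖ ^ 2 : ℝ) := by
  rw [sqBracket, EuclideanSpace.real_norm_sq_eq]
  push_cast
  rfl

theorem fderiv_norm_rpow {κ : ℝ} {ξ : EuclideanSpace ℝ (Fin m)} (hξ : ξ ≠ 0)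
    (v : EuclideanSpace ℝ (Fin m)) :
    fderiv ℝ (fun η : EuclideanSpace ℝ (Fin m) => ‖η‖ ^ κ) ξ v =
      κ * ‖ξ‖ ^ (κ - 2) * ⟪ξ, v⟫ := by
  have h1 : (fun η : EuclideanSpace ℝ (Fin m) => ‖η‖ ^ κ) = fun η => (‖η‖ ^ 2) ^ (κ / 2) := by
    funext η
    rw [norm_rpow_eq_sq_rpow, zero_add]
  have h2 := ((hasStrictFDerivAt_norm_sq ξ).hasFDerivAt).rpow_const (p := κ / 2)
    (Or.inl (pow_ne_zero 2 (norm_ne_zero_iff.2 hξ)))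
  rw [h1, h2.fderiv, norm_rpow_eq_sq_rpow ξ (κ - 2), zero_add,
    show κ / 2 - 1 = (κ - 2) / 2 by ring]
  simp
  ring

/-- The Jacobian matrix is the identity plus a matrix of rank one. -/
theorem kappaJacobian_ofReal (κ : ℝ) (w : EuclideanSpace ℝ (Fin m))
    {ξ : EuclideanSpace ℝ (Fin m)} (hξ : ξ ≠ 0) :
    kappaJacobian κ (fun k => ((w k : ℝ) : ℂ)) ξ =
      1 + Complex.I * (κ * (⟪ξ, w⟫ * ‖ξ‖ ^ (κ - 2)) : ℝ) := by
  have h1 : (Matrix.of fun i j : Fin m =>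
      fderiv ℝ (fun η : EuclideanSpace ℝ (Fin m) =>
        (η i : ℂ) + Complex.I * ((w i : ℝ) : ℂ) * ((‖η‖ ^ κ : ℝ) : ℂ)) ξ
          (EuclideanSpace.single j 1)) =
      1 + Matrix.replicateCol Unit (fun i => Complex.I * (w i : ℂ)) *
        Matrix.replicateRow Unit (fun j => ((κ * ‖ξ‖ ^ (κ - 2) * ξ j : ℝ) : ℂ)) := by
    ext i j
    rw [Matrix.of_apply, fderiv_kappaMap κ hξ, fderiv_norm_rpow hξ]
    simp only [Matrix.add_apply, Matrix.mul_apply, Matrix.one_apply, Matrix.replicateCol_apply,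
      Matrix.replicateRow_apply, Finset.univ_unique, Finset.sum_singleton,
      EuclideanSpace.inner_single_right, PiLp.single_apply]
    congr 1
    · split_ifs <;> simp
    · simp
  rw [kappaJacobian, h1, Matrix.det_one_add_replicateCol_mul_replicateRow, PiLp.inner_apply,
    dotProduct, Finset.sum_mul, Finset.mul_sum]
  push_cast
  rw [Finset.mul_sum]
  congr 1
  refine Finset.sum_congr rfl fun j _ => ?_
  simp only [RCLike.inner_apply, conj_trivial]
  push_cast
  ring

end RealCoordinates

/-! ### The regularized inversion integral -/

section Inversion

variable {m n : ℕ} {V : Opens (EuclideanSpace ℝ (Fin m))}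

theorem kappaKernel_tubeZ (κ : ℝ) (φ : EuclideanSpace ℝ (Fin n) → EuclideanSpace ℝ (Fin m))
    (t : EuclideanSpace ℝ (Fin n)) (x' : EuclideanSpace ℝ (Fin m))
    {ξ : EuclideanSpace ℝ (Fin m)} (hξ : ξ ≠ 0) :
    kappaKernel κ φ t (tubeZ φ x' t) ξ = fun y => planeKernel κ (x' - y) ξ := by
  funext y
  rw [kappaKernel, tubeZ_sub_tubeZ, realDot_ofReal, sqBracket_ofReal, kappaJacobian_ofReal κ _ hξ,
    planeKernel, sub_eq_add_neg, Complex.exp_add, mul_assoc]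
  push_cast
  rfl

/-- On a tube structure the integrand does not depend on `φ`. -/
theorem inversionIntegrand_eq (κ : ℝ) (φ : EuclideanSpace ℝ (Fin n) → EuclideanSpace ℝ (Fin m))
    (u : EuclideanSpace ℝ (Fin n) → CompactDistribution V) (ε : ℝ) (t : EuclideanSpace ℝ (Fin n))
    (x : EuclideanSpace ℝ (Fin m)) {p : EuclideanSpace ℝ (Fin m) × EuclideanSpace ℝ (Fin m)}
    (hp : p.2 ≠ 0) :
    inversionIntegrand κ φ u ε t x p =
      inversionWeight κ ε x p * (u t).pair fun y => planeKernel κ (p.1 - y) p.2 := by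
  rw [inversionIntegrand, kappaFBI, kappaKernel_tubeZ κ φ t p.1 hp, tubeZ_sub_tubeZ, realDot_ofReal,
    sqBracket_ofReal, inversionWeight, weightNorm, finrank_euclideanSpace_fin, sub_eq_add_neg,
    sub_eq_add_neg, Complex.exp_add, Complex.exp_add]
  push_cast
  rw [neg_mul]
  ring

variable {κ ε : ℝ}

theorem contDiff_planeKernel (κ : ℝ) {p : EuclideanSpace ℝ (Fin m) × EuclideanSpace ℝ (Fin m)}
    (hp : p.2 ≠ 0) : ContDiff ℝ ∞ fun y => planeKernel κ (p.1 - y) p.2 :=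
  contDiff_iff_contDiffAt.2 fun y =>
    (contDiffAt_planeKernel κ hp y).comp y (f := fun y => (p, y))
      (contDiffAt_const.prodMk contDiffAt_id)

theorem continuousOn_iteratedFDeriv_planeKernel (κ : ℝ) (k : ℕ) :
    ContinuousOn (fun z : (EuclideanSpace ℝ (Fin m) × EuclideanSpace ℝ (Fin m)) ×
      EuclideanSpace ℝ (Fin m) =>
      iteratedFDeriv ℝ k (fun y => planeKernel κ (z.1.1 - y) z.1.2) z.2)
      ({p | p.2 ≠ 0} ×ˢ univ) := by
  rintro ⟨p, y⟩ ⟨hp, _⟩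
  exact (contDiffAt_iteratedFDeriv_uncurry
    (Φ := fun (p : EuclideanSpace ℝ (Fin m) × EuclideanSpace ℝ (Fin m)) y =>
      planeKernel κ (p.1 - y) p.2)
    (contDiffAt_planeKernel κ hp) k y).continuousAt.continuousWithinAt

theorem measurableSet_snd_ne_zero : MeasurableSet
    {p : EuclideanSpace ℝ (Fin m) × EuclideanSpace ℝ (Fin m) | p.2 ≠ 0} :=
  (isOpen_ne_fun continuous_snd continuous_const).measurableSet

/-- The transform grows at most polynomially at infinity and has an integrable singularity at
`ξ = 0`. -/
theorem exists_norm_pair_planeKernel_le (v : CompactDistribution V) (hκ0 : 0 < κ) (hκ1 : κ ≤ 1) :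
    ∃ (N : ℕ) (C : ℝ), 0 ≤ C ∧
      ∀ p : EuclideanSpace ℝ (Fin m) × EuclideanSpace ℝ (Fin m), p.2 ≠ 0 →
        ‖v.pair fun y => planeKernel κ (p.1 - y) p.2‖ ≤
          C * ((1 + ‖p.2‖) ^ N * (1 + ‖p.2‖ ^ (κ / 2 - 1))) := by
  obtain ⟨N, C, hC, h⟩ := v.exists_norm_pair_le
  choose D hD hK using fun k => exists_norm_iteratedFDeriv_planeKernel_le
    (E := EuclideanSpace ℝ (Fin m)) hκ0 hκ1 k
  refine ⟨N, C * ∑ k ∈ Finset.range (N + 1), D k,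
    mul_nonneg hC (Finset.sum_nonneg fun k _ => hD k), fun p hp => ?_⟩
  rw [mul_assoc]
  refine h _ (contDiff_planeKernel κ hp) _ fun k hk y => (hK k p.1 p.2 hp y).trans ?_
  have h1 : D k ≤ ∑ k ∈ Finset.range (N + 1), D k :=
    Finset.single_le_sum (fun k _ => hD k) (Finset.mem_range.2 (by omega))
  have h2 : 0 ≤ ∑ k ∈ Finset.range (N + 1), D k := (hD k).trans h1
  have h3 : (1 + ‖p.2‖) ^ k ≤ (1 + ‖p.2‖) ^ N :=
    pow_le_pow_right₀ (le_add_of_nonneg_right (norm_nonneg _)) hk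
  gcongr

variable [Nontrivial (EuclideanSpace ℝ (Fin m))]

theorem ae_snd_ne_zero :
    ∀ᵐ p : EuclideanSpace ℝ (Fin m) × EuclideanSpace ℝ (Fin m), p.2 ≠ 0 :=
  Measure.quasiMeasurePreserving_snd.ae ae_ne_zero

theorem aestronglyMeasurable_pair_planeKernel (v : CompactDistribution V) (κ : ℝ) :
    AEStronglyMeasurable (fun p : EuclideanSpace ℝ (Fin m) × EuclideanSpace ℝ (Fin m) =>
      v.pair fun y => planeKernel κ (p.1 - y) p.2) := by
  have h0 := v.continuousOn_pair
    (Φ := fun (p : EuclideanSpace ℝ (Fin m) × EuclideanSpace ℝ (Fin m)) y =>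
      planeKernel κ (p.1 - y) p.2) (S := {p | p.2 ≠ 0})
    (fun p hp => contDiff_planeKernel κ hp) (continuousOn_iteratedFDeriv_planeKernel κ)
  have h := h0.aestronglyMeasurable (μ := volume) measurableSet_snd_ne_zero
  have hr := Measure.restrict_eq_self_of_ae_mem
    (s := {p : EuclideanSpace ℝ (Fin m) × EuclideanSpace ℝ (Fin m) | p.2 ≠ 0}) ae_snd_ne_zero
  rwa [hr] at h

/-- The double integral converges absolutely and is bounded uniformly in `x`. -/
theorem integrable_inversionWeight_mul_pair (v : CompactDistribution V) (hκ0 : 0 < κ)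
    (hκ1 : κ ≤ 1) (hε : 0 < ε) :
    (∀ x, Integrable fun p : EuclideanSpace ℝ (Fin m) × EuclideanSpace ℝ (Fin m) =>
      inversionWeight κ ε x p * v.pair fun y => planeKernel κ (p.1 - y) p.2) ∧
    (∃ C, ∀ x : EuclideanSpace ℝ (Fin m),
      ‖∫ p, inversionWeight κ ε x p * v.pair fun y => planeKernel κ (p.1 - y) p.2‖ ≤ C) ∧
    ∀ b : EuclideanSpace ℝ (Fin m) → ℂ, Integrable b →
      Integrable fun q : EuclideanSpace ℝ (Fin m) ×
        (EuclideanSpace ℝ (Fin m) × EuclideanSpace ℝ (Fin m)) =>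
        b q.1 * inversionWeight κ ε q.1 q.2 *
          v.pair fun y => planeKernel κ (q.2.1 - y) q.2.2 := by
  obtain ⟨N, C, hC, h⟩ := exists_norm_pair_planeKernel_le v hκ0 hκ1
  have hm := aestronglyMeasurable_pair_planeKernel v κ
  have hle : ∀ x, ∀ᵐ p : EuclideanSpace ℝ (Fin m) × EuclideanSpace ℝ (Fin m),
      ‖inversionWeight κ ε x p * v.pair fun y => planeKernel κ (p.1 - y) p.2‖ ≤
        C * (weightNorm κ ε x p * ((1 + ‖p.2‖) ^ N * (1 + ‖p.2‖ ^ (κ / 2 - 1)))) := fun x =>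
    ae_snd_ne_zero.mono fun p hp => by
      rw [norm_mul, norm_inversionWeight, mul_left_comm]
      exact mul_le_mul_of_nonneg_left (h p hp) (weightNorm_nonneg κ ε x p)
  have hi := fun x : EuclideanSpace ℝ (Fin m) =>
    (integrable_weightNorm_mul (κ := κ) (ε := ε) hκ0 hε N x).1.const_mul C
  refine ⟨fun x => (hi x).mono' (AEStronglyMeasurable.mul ?_ hm) (hle x), ?_, fun b hb => ?_⟩
  · exact ((measurable_inversionWeight κ ε).comp
      (by fun_prop : Measurable fun p : EuclideanSpace ℝ (Fin m) × EuclideanSpace ℝ (Fin m) =>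
        (x, p))).aestronglyMeasurable
  · refine ⟨_, fun x => (norm_integral_le_of_norm_le (hi x) (hle x)).trans
      (integral_const_mul C _ |>.trans
        (congrArg (C * ·) (integrable_weightNorm_mul hκ0 hε N x).2)).le⟩
  · refine ((integrable_mul_weightNorm_mul hκ0 hε N hb.norm).const_mul C).mono' ?_ ?_
    · exact (hb.aestronglyMeasurable.comp_fst.mul
        (measurable_inversionWeight κ ε).aestronglyMeasurable).mul hm.comp_snd
    · have hae : ∀ᵐ q : EuclideanSpace ℝ (Fin m) ×
          (EuclideanSpace ℝ (Fin m) × EuclideanSpace ℝ (Fin m)), q.2.2 ≠ 0 :=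
        Measure.quasiMeasurePreserving_snd.ae ae_snd_ne_zero
      refine hae.mono fun q hq => ?_
      rw [norm_mul, norm_mul, norm_inversionWeight, mul_assoc, mul_left_comm C]
      refine mul_le_mul_of_nonneg_left ?_ (norm_nonneg _)
      rw [mul_left_comm C]
      exact mul_le_mul_of_nonneg_left (h q.2 hq) (weightNorm_nonneg κ ε _ _)

theorem regularizedInversion_eq (φ : EuclideanSpace ℝ (Fin n) → EuclideanSpace ℝ (Fin m))
    (u : EuclideanSpace ℝ (Fin n) → CompactDistribution V) (t : EuclideanSpace ℝ (Fin n))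
    (x : EuclideanSpace ℝ (Fin m)) :
    regularizedInversion κ φ u ε t x = ((1 / (2 * Real.pi ^ 3) ^ ((m : ℝ) / 2) : ℝ) : ℂ) *
      ∫ p, inversionWeight κ ε x p * (u t).pair fun y => planeKernel κ (p.1 - y) p.2 := by
  rw [regularizedInversion]
  congr 1
  exact integral_congr_ae (ae_snd_ne_zero.mono fun p hp => inversionIntegrand_eq κ φ u ε t x hp)

theorem integrable_inversionIntegrand (φ : EuclideanSpace ℝ (Fin n) → EuclideanSpace ℝ (Fin m))
    (u : EuclideanSpace ℝ (Fin n) → CompactDistribution V) (hκ0 : 0 < κ) (hκ1 : κ ≤ 1)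
    (hε : 0 < ε) (t : EuclideanSpace ℝ (Fin n)) (x : EuclideanSpace ℝ (Fin m)) :
    Integrable (inversionIntegrand κ φ u ε t x) :=
  ((integrable_inversionWeight_mul_pair (u t) hκ0 hκ1 hε).1 x).congr
    (ae_snd_ne_zero.mono fun _ hp => (inversionIntegrand_eq κ φ u ε t x hp).symm)

theorem locallyIntegrable_regularizedInversion
    (φ : EuclideanSpace ℝ (Fin n) → EuclideanSpace ℝ (Fin m))
    (u : EuclideanSpace ℝ (Fin n) → CompactDistribution V) (hκ0 : 0 < κ) (hκ1 : κ ≤ 1)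
    (hε : 0 < ε) (t : EuclideanSpace ℝ (Fin n)) :
    LocallyIntegrable (regularizedInversion κ φ u ε t) := by
  obtain ⟨-, ⟨C, hC⟩, -⟩ := integrable_inversionWeight_mul_pair (u t) hκ0 hκ1 hε
  have hm : AEStronglyMeasurable fun x : EuclideanSpace ℝ (Fin m) =>
      ∫ p, inversionWeight κ ε x p * (u t).pair fun y => planeKernel κ (p.1 - y) p.2 :=
    AEStronglyMeasurable.integral_prod_right' (ν := volume)
      (f := fun q : EuclideanSpace ℝ (Fin m) × _ => inversionWeight κ ε q.1 q.2 *
        (u t).pair fun y => planeKernel κ (q.2.1 - y) q.2.2)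
      ((measurable_inversionWeight κ ε).aestronglyMeasurable.mul
        (aestronglyMeasurable_pair_planeKernel (u t) κ).comp_snd)
  have h1 : LocallyIntegrable fun x : EuclideanSpace ℝ (Fin m) =>
      ∫ p, inversionWeight κ ε x p * (u t).pair fun y => planeKernel κ (p.1 - y) p.2 :=
    (locallyIntegrable_const C).mono hm (.of_forall fun x => (hC x).trans (Real.le_norm_self C))
  have h2 := h1.smul ((1 / (2 * Real.pi ^ 3) ^ ((m : ℝ) / 2) : ℝ) : ℂ)
  rwa [show regularizedInversion κ φ u ε t = _ from funext (regularizedInversion_eq φ u t)]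

/-- The regularized inversion integral is the transpose of a smoothing operator, applied to `u`. -/
theorem integral_mul_regularizedInversion
    (φ : EuclideanSpace ℝ (Fin n) → EuclideanSpace ℝ (Fin m))
    (u : EuclideanSpace ℝ (Fin n) → CompactDistribution V) (hκ0 : 0 < κ) (hκ1 : κ ≤ 1)
    (hε : 0 < ε) (t : EuclideanSpace ℝ (Fin n)) (ψ : 𝓓(V, ℝ)) :
    ∫ x, (ψ x : ℂ) * regularizedInversion κ φ u ε t x =
      (u t).pair fun y => ∫ w, reproducingKernel κ ε w • (ψ (y + w) : ℂ) := by
  set c : ℂ := ((1 / (2 * Real.pi ^ 3) ^ ((m : ℝ) / 2) : ℝ) : ℂ) with hc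
  have hψ : Integrable fun x => (ψ x : ℂ) * c :=
    ((SmoothFun.contDiff_ofReal_test ψ).continuous.integrable_of_hasCompactSupport
      (hasCompactSupport_ofReal_test ψ)).mul_const c
  choose D hD hK using fun k => exists_norm_iteratedFDeriv_planeKernel_le
    (E := EuclideanSpace ℝ (Fin m)) hκ0 hκ1 k
  have hS : MeasurableSet {q : EuclideanSpace ℝ (Fin m) ×
      (EuclideanSpace ℝ (Fin m) × EuclideanSpace ℝ (Fin m)) | q.2.2 ≠ 0} :=
    measurable_snd measurableSet_snd_ne_zero
  have hae : ∀ᵐ q : EuclideanSpace ℝ (Fin m) ×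
      (EuclideanSpace ℝ (Fin m) × EuclideanSpace ℝ (Fin m)), q.2.2 ≠ 0 :=
    Measure.quasiMeasurePreserving_snd.ae ae_snd_ne_zero
  have hcm : AEStronglyMeasurable fun q : EuclideanSpace ℝ (Fin m) ×
      (EuclideanSpace ℝ (Fin m) × EuclideanSpace ℝ (Fin m)) =>
      (ψ q.1 : ℂ) * c * inversionWeight κ ε q.1 q.2 :=
    hψ.aestronglyMeasurable.comp_fst.mul (measurable_inversionWeight κ ε).aestronglyMeasurable
  have hbound : ∀ k, Integrable fun q : EuclideanSpace ℝ (Fin m) ×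
      (EuclideanSpace ℝ (Fin m) × EuclideanSpace ℝ (Fin m)) =>
      ‖(ψ q.1 : ℂ) * c * inversionWeight κ ε q.1 q.2‖ *
        (D k * ((1 + ‖q.2.2‖) ^ k * (1 + ‖q.2.2‖ ^ (κ / 2 - 1)))) := fun k => by
    refine ((integrable_mul_weightNorm_mul hκ0 hε k hψ.norm).const_mul (D k)).congr
      (.of_forall fun q => ?_)
    simp only [norm_mul _ (inversionWeight κ ε q.1 q.2), norm_inversionWeight]
    ring
  have h1 := (u t).pair_integral (μ := volume) hS hae
    (Φ := fun (q : EuclideanSpace ℝ (Fin m) ×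
      (EuclideanSpace ℝ (Fin m) × EuclideanSpace ℝ (Fin m))) y => planeKernel κ (q.2.1 - y) q.2.2)
    (fun q hq => contDiff_planeKernel κ hq)
    (fun k => (continuousOn_iteratedFDeriv_planeKernel κ k).comp
      (f := fun z : (EuclideanSpace ℝ (Fin m) ×
        (EuclideanSpace ℝ (Fin m) × EuclideanSpace ℝ (Fin m))) × EuclideanSpace ℝ (Fin m) =>
        (z.1.2, z.2)) (by fun_prop) fun z hz => ⟨hz.1, mem_univ _⟩)
    hcm (fun k q hq y => hK k q.2.1 q.2.2 hq y) hbound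
  have h2 : ∫ x, (ψ x : ℂ) * regularizedInversion κ φ u ε t x =
      ∫ q : EuclideanSpace ℝ (Fin m) × (EuclideanSpace ℝ (Fin m) × EuclideanSpace ℝ (Fin m)),
        (ψ q.1 : ℂ) * c * inversionWeight κ ε q.1 q.2 *
          (u t).pair fun y => planeKernel κ (q.2.1 - y) q.2.2 := by
    rw [Measure.volume_eq_prod, integral_prod _
      ((integrable_inversionWeight_mul_pair (u t) hκ0 hκ1 hε).2.2 _ hψ)]
    refine integral_congr_ae (.of_forall fun x => ?_)
    simp only [regularizedInversion_eq, mul_assoc, integral_const_mul]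
    rfl
  rw [h2, ← h1]
  congr 1
  funext y
  have hi : Integrable fun q : EuclideanSpace ℝ (Fin m) ×
      (EuclideanSpace ℝ (Fin m) × EuclideanSpace ℝ (Fin m)) =>
      (ψ q.1 : ℂ) * c * inversionWeight κ ε q.1 q.2 * planeKernel κ (q.2.1 - y) q.2.2 := by
    refine (hbound 0).mono' (hcm.mul ?_) (hae.mono fun q hq => ?_)
    · have : Measurable fun q : EuclideanSpace ℝ (Fin m) ×
          (EuclideanSpace ℝ (Fin m) × EuclideanSpace ℝ (Fin m)) =>
          planeKernel κ (q.2.1 - y) q.2.2 := by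
        unfold planeKernel
        fun_prop
      exact this.aestronglyMeasurable
    · rw [norm_mul]
      refine mul_le_mul_of_nonneg_left ?_ (norm_nonneg _)
      have := hK 0 q.2.1 q.2.2 hq y
      rwa [norm_iteratedFDeriv_zero] at this
  have h3 := fun x : EuclideanSpace ℝ (Fin m) =>
    integral_inversionWeight_mul_planeKernel hκ0 hκ1 hε x y
  simp only [finrank_euclideanSpace_fin] at h3
  rw [Measure.volume_eq_prod, integral_prod _ hi]
  simp only [mul_assoc, integral_const_mul]
  rw [← integral_add_left_eq_self _ y]
  refine integral_congr_ae (.of_forall fun w => ?_)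
  have h4 := h3 (y + w)
  rw [add_sub_cancel_left] at h4
  refine (congrArg ((ψ (y + w) : ℂ) * ·) h4).trans ?_
  exact mul_comm _ _

end Inversion

/-! ### The operators `u ↦ u_ε` -/

section Operators

variable {m n : ℕ} {V : Opens (EuclideanSpace ℝ (Fin m))}

theorem inversionIntegrand_finZero {V : Opens (EuclideanSpace ℝ (Fin 0))} (κ : ℝ)
    (φ : EuclideanSpace ℝ (Fin n) → EuclideanSpace ℝ (Fin 0))
    (u : EuclideanSpace ℝ (Fin n) → CompactDistribution V) (ε : ℝ)
    (t : EuclideanSpace ℝ (Fin n)) (x : EuclideanSpace ℝ (Fin 0)) :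
    inversionIntegrand κ φ u ε t x = fun _ => (u t).pair fun _ => 1 := by
  funext p
  have h1 : kappaKernel κ φ t (tubeZ φ p.1 t) p.2 = fun _ => 1 := by
    funext y
    simp [kappaKernel, realDot, sqBracket, kappaJacobian]
  have h2 : p.2 = 0 := Subsingleton.elim _ _
  rw [inversionIntegrand, kappaFBI, h1, h2]
  simp [realDot, sqBracket]

theorem regularizedInversion_finZero {V : Opens (EuclideanSpace ℝ (Fin 0))} (κ : ℝ)
    (φ : EuclideanSpace ℝ (Fin n) → EuclideanSpace ℝ (Fin 0))
    (u : EuclideanSpace ℝ (Fin n) → CompactDistribution V) (ε : ℝ)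
    (t : EuclideanSpace ℝ (Fin n)) :
    regularizedInversion κ φ u ε t = fun _ => (u t).pair fun _ => 1 := by
  funext x
  rw [regularizedInversion, inversionIntegrand_finZero, Measure.volume_eq_prod,
    volume_euclideanSpace_eq_dirac]
  simp

/-- `u_ε` is obtained from `u` by applying, for each `t` separately, a continuous operator from
`E'(V)` to `D'(V)`, the transpose of an operator `D(V) → C^∞(V)`; as `ε → 0`, the latter tends to
the inclusion at the rate `ε`. -/
theorem exists_smoothing_operators {κ : ℝ} (hκ0 : 0 < κ) (hκ1 : κ ≤ 1)
    (φ : EuclideanSpace ℝ (Fin n) → EuclideanSpace ℝ (Fin m))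
    (u : EuclideanSpace ℝ (Fin n) → CompactDistribution V) :
    ∃ P : ℝ → 𝓓(V, ℝ) →L[ℝ] SmoothFun V,
      (∀ k : ℕ, ∃ q : 𝓓(V, ℝ) → ℝ, Continuous q ∧ ∀ ε : ℝ, 0 < ε → ∀ ψ, ∀ y ∈ V,
        ‖iteratedFDeriv ℝ k (P ε ψ - ofTestCLM V ψ : SmoothFun V) y‖ ≤ ε * q ψ) ∧
      ∀ ε, 0 < ε → ∀ t, (∀ x, Integrable (inversionIntegrand κ φ u ε t x)) ∧
        LocallyIntegrableOn (regularizedInversion κ φ u ε t) V ∧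
        functionDistribution V (regularizedInversion κ φ u ε t) = transposeCLM (P ε) (u t) := by
  rcases m.eq_zero_or_pos with rfl | hm
  · -- on the one-point space `ℝ^0` all functions are constant, and `u_ε = u`
    refine ⟨fun _ => ofTestCLM V, fun k => ⟨0, continuous_const, fun ε _ ψ y _ => ?_⟩,
      fun ε _ t => ?_⟩
    · have h : ((ofTestCLM V ψ - ofTestCLM V ψ : SmoothFun V) : EuclideanSpace ℝ (Fin 0) → ℂ) =
          0 := congrArg Subtype.val (sub_self (ofTestCLM V ψ))
      rw [h, iteratedFDeriv_zero]
      simp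
    have hl : LocallyIntegrableOn (regularizedInversion κ φ u ε t) V := by
      rw [regularizedInversion_finZero]
      exact (locallyIntegrable_const _).locallyIntegrableOn _
    refine ⟨fun x => ?_, hl, DFunLike.ext _ _ fun ψ => ?_⟩
    · rw [inversionIntegrand_finZero]
      have : Finite (EuclideanSpace ℝ (Fin 0)) := Finite.of_subsingleton
      exact integrable_const _
    · rw [functionDistribution_apply hl, regularizedInversion_finZero, transposeCLM_apply,
        volume_euclideanSpace_eq_dirac, integral_dirac]
      have h : SmoothFun.ofTest ψ = (ψ 0 : ℂ) • SmoothFun.ofFun V fun _ => (1 : ℂ) :=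
        SmoothFun.ext_on fun y hy => by
          rw [SmoothFun.ofTest_apply ψ hy, Subsingleton.elim y 0]
          refine Eq.trans ?_ (congrArg (fun z => (ψ 0 : ℂ) * z)
            (SmoothFun.ofFun_apply contDiffOn_const (Subsingleton.elim y 0 ▸ hy)).symm)
          rw [mul_one]
      change _ = u t (SmoothFun.ofTest ψ)
      rw [h, map_smul]
      rfl
  · have : Nonempty (Fin m) := ⟨⟨0, hm⟩⟩
    have hG := fun (ε : ℝ) (hε : 0 < ε) =>
      continuous_reproducingKernel_and_bound (E := EuclideanSpace ℝ (Fin m)) hκ0 hκ1 hε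
    let P : ℝ → 𝓓(V, ℝ) →L[ℝ] SmoothFun V := fun ε => if hε : 0 < ε then
      smoothingCLM V (reproducingKernel κ ε) (hG ε hε).1 (hG ε hε).2 else ofTestCLM V
    have hP : ∀ ε (hε : 0 < ε), P ε =
        smoothingCLM V (reproducingKernel κ ε) (hG ε hε).1 (hG ε hε).2 := fun ε hε => dif_pos hε
    refine ⟨P, fun k => ?_, fun ε hε t => ?_⟩
    · obtain ⟨q, hq, h⟩ := exists_norm_iteratedFDeriv_smoothingCLM_sub_le (V := V) hκ0 hκ1 k
      refine ⟨q, hq, fun ε hε ψ y hy => ?_⟩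
      rw [hP ε hε]
      exact h ε hε _ _ ψ y hy
    · have hl := (locallyIntegrable_regularizedInversion φ u hκ0 hκ1 hε t).locallyIntegrableOn V
      refine ⟨integrable_inversionIntegrand φ u hκ0 hκ1 hε t, hl, DFunLike.ext _ _ fun ψ => ?_⟩
      rw [functionDistribution_apply hl, integral_mul_regularizedInversion φ u hκ0 hκ1 hε t ψ,
        transposeCLM_apply, hP ε hε]
      rfl

theorem toDistribution_eq_transposeCLM (v : CompactDistribution V) :
    v.toDistribution = transposeCLM (ofTestCLM V) v := rfl

end Operators

end KappaFBI

end

theorem mainTheorem10 {m n : ℕ}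
    (V : TopologicalSpace.Opens (EuclideanSpace ℝ (Fin m)))
    (W : TopologicalSpace.Opens (EuclideanSpace ℝ (Fin n)))
    (φ : EuclideanSpace ℝ (Fin n) → EuclideanSpace ℝ (Fin m)) (hφ : AnalyticOnNhd ℝ φ W)
    (u : EuclideanSpace ℝ (Fin n) → KappaFBI.CompactDistribution V)
    (hu : KappaFBI.IsC1On W u) (κ : ℝ) (hκ0 : 0 < κ) (hκ1 : κ ≤ 1) :
    -- for every `ε > 0` the double integral converges absolutely, and it defines an element of
    -- `C¹(W; D'(V))`
    (∀ ε : ℝ, 0 < ε →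
      (∀ t ∈ W, ∀ x, MeasureTheory.Integrable (KappaFBI.inversionIntegrand κ φ u ε t x)) ∧
      (∀ t ∈ W, MeasureTheory.LocallyIntegrableOn (KappaFBI.regularizedInversion κ φ u ε t) V) ∧
      KappaFBI.IsC1On W fun t =>
        KappaFBI.functionDistribution V (KappaFBI.regularizedInversion κ φ u ε t)) ∧
    -- as `ε → 0⁺`, it converges to `u` in `C¹(W; D'(V))`
    KappaFBI.IsC1On W (fun t => (u t).toDistribution) ∧
    KappaFBI.TendstoC1On (𝓝[>] (0 : ℝ)) W
      (fun ε t => KappaFBI.functionDistribution V (KappaFBI.regularizedInversion κ φ u ε t))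
      (fun t => (u t).toDistribution) := by
  obtain ⟨P, hP, hPu⟩ := KappaFBI.exists_smoothing_operators hκ0 hκ1 φ u
  refine ⟨fun ε hε => ⟨fun t _ => (hPu ε hε t).1, fun t _ => (hPu ε hε t).2.1,
    KappaFBI.isC1On_of_eqOn hu (KappaFBI.transposeCLM (P ε)) fun t _ => (hPu ε hε t).2.2⟩,
    KappaFBI.isC1On_of_eqOn hu (KappaFBI.transposeCLM (KappaFBI.ofTestCLM V)) fun t _ =>
      KappaFBI.toDistribution_eq_transposeCLM (u t),
    KappaFBI.tendstoC1On_of_tendsto (KappaFBI.tendsto_transposeCLM hP) hu ?_ fun t _ =>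
      KappaFBI.toDistribution_eq_transposeCLM (u t)⟩
  filter_upwards [self_mem_nhdsWithin] with ε hε t _
  exact (hPu ε hε t).2.2
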